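/- **Setting.** Fix $K\ge 1$, factor numbers $r_1,\dots,r_K\ge 1$, and constants $\epsilon\in(0,1)$, $\omega,c_0,c_\epsilon>0$, $\bar\lambda<\infty$, $0<\alpha^{(k)}_j\le\beta^{(k)}_j$ ($j\le r_k$) with $\alpha^{(k)}_j>\beta^{(k)}_{j+1}$. For sample size $n$ and dimensions $p_1,\dots,p_K$ write $p=\prod_k p_k$, $p_{-k}=p/p_k$, and let $\mathrm{mat}_k$ be the mode-$k$ unfolding and $|\cdot|_2$ the Euclidean norm of the entries. We observe $\mathcal X_t=\mathcal F_t\times_1\Lambda_1\times_2\cdots\times_K\Lambda_K+\xi_t\in\mathbb R^{p_1\times\cdots\times p_K}$, $1\le t\le n$, where $\Lambda_k\in\mathbb R^{p_k\times r_k}$, $\mathcal F_t\in\mathbb R^{r_1\times\cdots\times r_K}$ is deterministic, $\xi_{\mathbf i,t}$ ($\mathbf i\in\prod_k[p_k]$, $t\in\mathbb Z$) are random with mean $0$, and: 1. $p_k^{-1}\Lambda_k^\top\Lambda_k=I_{r_k}$ and all entries of $\Lambda_k$ are at most $\bar\lambda$ in absolute value. 2. $n^{-1}\sum_{t\le n}\mathrm{mat}_k(\mathcal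 F_t)\mathrm{mat}_k(\mathcal F_t)^\top$ is diagonal with $j$-th diagonal entry in $[\alpha_j^{(k)},\beta_j^{(k)}]$. 3. $\|\xi_{\mathbf i,t}\|_{2+2\epsilon}\le\omega$ for all $\mathbf i,t$; $n^{-1}\sum_{t\le n}|\mathcal F_t|_2^\nu\le\omega^\nu$ for $\nu\in\{1+\epsilon,2,2+2\epsilon\}$; and $\max(\max_{t\le n}|\mathcal F_t|_2,\omega)\le M_n$, where $M_n$ may diverge. 4. One of the following two settings holds throughout, where $\alpha(\mathcal A,\mathcal B)=\sup_{A\in\mathcal A,B\in\mathcal B}|P(A\cap B)-P(A)P(B)|$ and $\Sigma(a)=n^{-1}\sum_{t,u\le n}|\mathcal F_t|_2^{1+\epsilon}|\mathcal F_u|_2^{1+\epsilon}e^{-a|t-u|}$. * *(Independence.)* The time series $\{\xi_{\mathbf i,t}\}_{t\in\mathbb Z}$ are mutually independent over $\mathbf i$; $\alpha(\sigma\{\xi_{\mathbf i,u}:u\le t\},\sigma\{\xi_{\mathbf i,v}:v\ge t+m\})\le e^{-c_0m}$ for all $\mathbf i$, $t$ and $m\ge0$; $\Sigma(\tfrac{c_0\epsilon}{1+\epsilon})\le\omega^{2+2\epsilon}c_\epsilon$;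 and $\Sigma(\tfrac{c_0}{3\log(np_{-k})})\le\omega^{2+2\epsilon}c_\epsilon\log(np_{-k})$ for all $k$. Put $\ell_k=\log(np_{-k})$. * *(Random field.)* $\alpha(\sigma\{\xi_{\mathbf i,t}:(\mathbf i,t)\in E_1\},\sigma\{\xi_{\mathbf i,t}:(\mathbf i,t)\in E_2\})\le e^{-c_0m}$ for all $m\ge0$ and all sets of sites $E_1,E_2$ such that $\max(\max_k|i_k-j_k|,|t-u|)\ge m$ for all $(\mathbf i,t)\in E_1$, $(\mathbf j,u)\in E_2$; $\Sigma(\tfrac{c_0\epsilon}{K(1+\epsilon)})\le\omega^{2+2\epsilon}c_\epsilon K$; and $\Sigma(\tfrac{c_0}{3K\log(np)})\le\omega^{2+2\epsilon}c_\epsilon K\log(np)$. Put $\ell_k=\log^K(np)$. Let $\tau^{(k)}_{n,p}=\omega(np_{-k}/\ell_k)^{1/(2+2\epsilon)}$ and $\psi^{(k)}_{n,p}=\omega^2(\ell_k/(np_{-k}))^{\epsilon/(1+\epsilon)}$. **Estimator.** For truncation levels $\tau_k>0$ (possibly all equal), let $\mathcal X_t^{\tau}$ have entries $\mathrm{sign}(X_{\mathbf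 i,t})(|X_{\mathbf i,t}|\wedge\tau)$, and let $\hat e^{(k)}_1,\hat e^{(k)}_2,\dots$ be orthonormal eigenvectors, in decreasing order of the eigenvalues, of $\hat\Gamma^{(k)}=\frac1{np_{-k}}\sum_{t\le n}\mathrm{mat}_k(\mathcal X_t^{\tau_k})\mathrm{mat}_k(\mathcal X_t^{\tau_k})^\top$. Given $1\le\bar r_k\le p_k-1$, $\rho>0$ and a (possibly random) starting value $\hat r^{(0)}$ (for instance $\hat r^{(0)}_k=\bar r_k$), define for $m\ge1$: $D^{(m)}_k$ is the Kronecker product over $k'\ne k$ (in decreasing order of $k'$) of the matrices $[\hat e^{(k')}_j,\ 1\le j\le\hat r^{(m-1)}_{k'}]$; $\check\mu^{(k),(m)}_j$ is $p_k^{-1}$ times the $j$-th largest eigenvalue of $\check\Gamma^{(k),(m)}=\frac1{np_{-k}}\sum_{t\le n}\mathrm{mat}_k(\mathcal X_t^{\tau_k})D_k^{(m)}(D_k^{(m)})^\top\mathrm{mat}_k(\mathcal X_t^{\tau_k})^\top$; and $$\hat r^{(m)}_k\in\operatorname*{arg\,max}_{1\le j\le\bar r_k}\ \frac{\check\mu^{(k),(m)}_j}{\check\mu^{(k),(m)}_{j+1}+\rho}.$$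 **Proposition.** Let $\min(n,p_1,\dots,p_K)\to\infty$ (along any sequence; $\Lambda_k,\mathcal F_t,\xi,M_n,\tau_k,\rho,\bar r_k$ may vary along it, the constants may not). Suppose that, for each $k$, $\tau_k\asymp\tau^{(k)}_{n,p}$ and $M_n(\tau^{(k)}_{n,p})^{-1}\log^{1/(2\epsilon)}(np_{-k})\to0$, and that $\rho=\rho_{n,p}\to0$ satisfies $\sum_{k'=1}^K\big(\psi^{(k')}_{n,p}\vee\frac1{p_{k'}}\big)=O(\rho_{n,p})$. If, for a given $m\ge1$, the previous iterate satisfies $r_k\le\hat r^{(m-1)}_k\le\bar r_k$ for all $k$ with probability tending to one, then $P(\hat r^{(m)}_k=r_k)\to1$ for every $k$, for every choice of the eigenvectors and every way of breaking ties in the argmax. -/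

import Mathlib

open MeasureTheory ProbabilityTheory Filter Topology Asymptotics

namespace TensorFactor

/-! ### Tensors, unfoldings and eigenvalues -/

/-- Real order-`K` tensors of dimensions `d 0 × ⋯ × d (K-1)`. -/
abbrev Tensor {K : ℕ} (d : Fin K → ℕ) : Type := (∀ k, Fin (d k)) → ℝ

/-- The index set of the columns of a mode-`k` unfolding, of cardinality `∏_{j ≠ k} d j`. -/
abbrev ColIdx {K : ℕ} (d : Fin K → ℕ) (k : Fin K) : Type := ∀ j : {j // j ≠ k}, Fin (d j)

/-- The mode-`k` unfolding: rows are indexed by the `k`-th coordinate, columns by all others. -/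
def unfold {K : ℕ} {d : Fin K → ℕ} (k : Fin K) (X : Tensor d) :
    Matrix (Fin (d k)) (ColIdx d k) ℝ :=
  Matrix.of fun i c => X ((Equiv.piSplitAt k fun j => Fin (d j)).symm (i, c))

/-- The Euclidean norm of the vector of all entries. -/
noncomputable def tnorm {K : ℕ} {d : Fin K → ℕ} (X : Tensor d) : ℝ := √(∑ i, X i ^ 2)

/-- `F ×₁ Λ₁ ×₂ ⋯ ×_K Λ_K`, written out entrywise. -/
def tucker {K : ℕ} {d e : Fin K → ℕ} (F : Tensor d)
    (L : ∀ k, Matrix (Fin (e k)) (Fin (d k)) ℝ) : Tensor e :=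
  fun i => ∑ j, F j * ∏ k, L k (i k) (j k)

/-- The Kronecker product of the matrices `E j`, `j ≠ k`, with rows and columns indexed by
tuples (so rows match the columns of a mode-`k` unfolding). For `K = 1` it is the `1 × 1`
identity. -/
def kronExcept {K : ℕ} {d s : Fin K → ℕ} (k : Fin K)
    (E : ∀ j, Matrix (Fin (d j)) (Fin (s j)) ℝ) : Matrix (ColIdx d k) (ColIdx s k) ℝ :=
  Matrix.of fun c a => ∏ j : {j // j ≠ k}, E j (c j) (a j)

/-- The `j`-th largest eigenvalue (`1 ≤ j ≤ m`, with multiplicity) of a symmetric matrix. -/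
noncomputable def eigVal {m : ℕ} (A : Matrix (Fin m) (Fin m) ℝ) (j : ℕ) : ℝ :=
  open Classical in
  if h : A.IsHermitian ∧ 1 ≤ j ∧ j ≤ m then
    h.1.eigenvalues₀ ⟨j - 1, by rw [Fintype.card_fin]; omega⟩
  else 0

/-- `e 0, e 1, …` is an orthonormal basis of eigenvectors of `A`, in decreasing order of the
eigenvalues. -/
structure IsEigenbasis {m : ℕ} (A : Matrix (Fin m) (Fin m) ℝ) (e : Fin m → Fin m → ℝ) :
    Prop where
  orthonormal : ∀ i j, e i ⬝ᵥ e j = if i = j then 1 else 0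
  eigenvector : ∀ j : Fin m, A.mulVec (e j) = eigVal A (j + 1) • e j

/-- The matrix with columns the first `s` of the vectors `e 0, e 1, …`
(zero columns are appended in the irrelevant case `m < s`). -/
def leading {m : ℕ} (e : Fin m → Fin m → ℝ) (s : ℕ) : Matrix (Fin m) (Fin s) ℝ :=
  Matrix.of fun i j => if h : (j : ℕ) < m then e ⟨j, h⟩ i else 0

/-- Truncation of a real number at level `τ`. -/
noncomputable def trunc (τ x : ℝ) : ℝ := Real.sign x * min |x| τ

/-! ### The model -/

/-- The ingredients of a Tucker factor model with sample size `n`, dimensions `p`, factor numbers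
`r`, loadings `L`, deterministic factors `F t` (`1 ≤ t ≤ n` matter) and idiosyncratic
components `ξ`. -/
structure Model (K : ℕ) (r : Fin K → ℕ) (Ω : Type*) where
  n : ℕ
  p : Fin K → ℕ
  L : ∀ k, Matrix (Fin (p k)) (Fin (r k)) ℝ
  F : ℕ → Tensor r
  ξ : (∀ k, Fin (p k)) → ℤ → Ω → ℝ

namespace Model

variable {K : ℕ} {r : Fin K → ℕ} {Ω : Type*} (S : Model K r Ω)

/-- `p = ∏ p_k`. -/
def pAll : ℕ := ∏ j, S.p j

/-- `p_{-k} = ∏_{j ≠ k} p_j`. -/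
def pExcept (k : Fin K) : ℕ := ∏ j ∈ Finset.univ.erase k, S.p j

/-- The observations `X_t = F_t ×₁ Λ₁ ⋯ ×_K Λ_K + ξ_t`. -/
def X (t : ℕ) (w : Ω) : Tensor S.p := fun i => tucker (S.F t) S.L i + S.ξ i t w

/-- The elementwise truncated observations. -/
noncomputable def Xtr (τ : ℝ) (t : ℕ) (w : Ω) : Tensor S.p := fun i => trunc τ (S.X t w i)

/-- `n⁻¹ ∑ₜ mat_k(F_t) mat_k(F_t)ᵀ`. -/
noncomputable def gammaF (k : Fin K) : Matrix (Fin (r k)) (Fin (r k)) ℝ :=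
  (S.n : ℝ)⁻¹ • ∑ t ∈ Finset.Icc 1 S.n, unfold k (S.F t) * (unfold k (S.F t)).transpose

/-- The truncated mode-`k` second moment matrix. -/
noncomputable def gammaHat (τ : ℝ) (k : Fin K) (w : Ω) : Matrix (Fin (S.p k)) (Fin (S.p k)) ℝ :=
  ((S.n : ℝ) * S.pExcept k)⁻¹ • ∑ t ∈ Finset.Icc 1 S.n,
    unfold k (S.Xtr τ t w) * (unfold k (S.Xtr τ t w)).transpose

/-- The projected truncated mode-`k` second moment matrix, where the data are projected with the
Kronecker product of the matrices of the first `s j` vectors among `e j 0, e j 1, …`, `j ≠ k`. -/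
noncomputable def gammaCheck (τ : ℝ) (e : ∀ j, Fin (S.p j) → Fin (S.p j) → ℝ) (s : Fin K → ℕ)
    (k : Fin K) (w : Ω) : Matrix (Fin (S.p k)) (Fin (S.p k)) ℝ :=
  let D := kronExcept k fun j => leading (e j) (s j)
  ((S.n : ℝ) * S.pExcept k)⁻¹ • ∑ t ∈ Finset.Icc 1 S.n,
    unfold k (S.Xtr τ t w) * D * D.transpose * (unfold k (S.Xtr τ t w)).transpose

/-- The penalised ratio `μ_j / (μ_{j+1} + ρ)` of consecutive eigenvalues of the projected second
moment matrix, where `μ_j` is the `j`-th largest eigenvalue divided by `p_k`. -/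
noncomputable def ratio (τ ρ : ℝ) (e : ∀ j, Fin (S.p j) → Fin (S.p j) → ℝ) (s : Fin K → ℕ)
    (k : Fin K) (w : Ω) (j : ℕ) : ℝ :=
  (eigVal (S.gammaCheck τ e s k w) j / S.p k) /
    (eigVal (S.gammaCheck τ e s k w) (j + 1) / S.p k + ρ)

/-- `rhat m w k` are the iterates of the eigenvalue ratio procedure: each one maximises, over
`1 ≤ j ≤ rbar k`, the ratio computed from the projections onto the leading `rhat m w` vectors of
`e w`. Ties may be broken in any way; the starting value `rhat 0` is not restricted here. -/
def IsRun (τ : Fin K → ℝ) (ρ : ℝ) (rbar : Fin K → ℕ)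
    (e : Ω → ∀ j, Fin (S.p j) → Fin (S.p j) → ℝ) (rhat : ℕ → Ω → Fin K → ℕ) : Prop :=
  ∀ m w k, rhat (m + 1) w k ∈ Finset.Icc 1 (rbar k) ∧
    ∀ j ∈ Finset.Icc 1 (rbar k),
      S.ratio (τ k) ρ (e w) (rhat m w) k w j ≤
        S.ratio (τ k) ρ (e w) (rhat m w) k w (rhat (m + 1) w k)

/-! ### Assumptions on loadings, factors and tails -/

/-- Orthogonality and boundedness of the loadings. -/
def LoadingAssumption (lbar : ℝ) : Prop :=
  ∀ k, (S.p k : ℝ)⁻¹ • ((S.L k).transpose * S.L k) = 1 ∧ ∀ i j, |S.L k i j| ≤ lbar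

/-- The second moment matrices of the factors are diagonal, with `j`-th diagonal entry in
`[α k j, β k j]`. -/
def FactorAssumption (α β : ∀ k, Fin (r k) → ℝ) : Prop :=
  ∀ k, (S.gammaF k).IsDiag ∧ ∀ j, α k j ≤ S.gammaF k j j ∧ S.gammaF k j j ≤ β k j

/-- Centred idiosyncratic components with bounded `2 + 2ε` moments, averaged moment bounds on the
factors, and the uniform bound `M`. -/
structure TailAssumption [MeasurableSpace Ω] (P : Measure Ω) (ε om M : ℝ) : Prop where
  measurable : ∀ i t, Measurable (S.ξ i t)
  centred : ∀ i t, ∫ w, S.ξ i t w ∂P = 0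
  moment : ∀ i t, eLpNorm (S.ξ i t) (ENNReal.ofReal (2 + 2 * ε)) P ≤ ENNReal.ofReal om
  factor_moment : ∀ ν ∈ ({1 + ε, 2, 2 + 2 * ε} : Set ℝ),
    (S.n : ℝ)⁻¹ * ∑ t ∈ Finset.Icc 1 S.n, tnorm (S.F t) ^ ν ≤ om ^ ν
  factor_bound : ∀ t ∈ Finset.Icc 1 S.n, tnorm (S.F t) ≤ M
  om_le : om ≤ M

/-! ### Dependence -/

/-- `n⁻¹ ∑_{t,u} |F_t|^{1+ε} |F_u|^{1+ε} exp(-a |t-u|)`. -/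
noncomputable def factorMix (ε a : ℝ) : ℝ :=
  (S.n : ℝ)⁻¹ * ∑ t ∈ Finset.Icc 1 S.n, ∑ u ∈ Finset.Icc 1 S.n,
    tnorm (S.F t) ^ (1 + ε) * tnorm (S.F u) ^ (1 + ε) * Real.exp (-(a * |(t : ℝ) - (u : ℝ)|))

end Model

/-- The strong mixing coefficient of two σ-algebras. -/
noncomputable def alphaMix {Ω : Type*} [MeasurableSpace Ω] (P : Measure Ω)
    (𝒜 ℬ : MeasurableSpace Ω) : ℝ :=
  sSup {x | ∃ A B : Set Ω, MeasurableSet[𝒜] A ∧ MeasurableSet[ℬ] B ∧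
    x = |P.real (A ∩ B) - P.real A * P.real B|}

/-- The distance of two sites `(i, t)`, `(j, u)`: the maximum of `|i_k - j_k|` and `|t - u|`. -/
def siteDist {K : ℕ} {p : Fin K → ℕ} (x y : (∀ k, Fin (p k)) × ℤ) : ℕ :=
  max (Finset.univ.sup fun k => ((x.1 k : ℤ) - (y.1 k : ℤ)).natAbs) (x.2 - y.2).natAbs

/-- The distance of two sets of sites (`⊤` if one of them is empty). -/
noncomputable def setDist {K : ℕ} {p : Fin K → ℕ} (E₁ E₂ : Set ((∀ k, Fin (p k)) × ℤ)) : ℕ∞ :=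
  ⨅ x ∈ E₁, ⨅ y ∈ E₂, (siteDist x y : ℕ∞)

/-- The two alternative dependence settings: independence across the coordinates of the tensor
with strongly mixing time series, or a strongly mixing random field. -/
inductive Regime
  | indep
  | field

namespace Model

variable {K : ℕ} {r : Fin K → ℕ} {Ω : Type*} (S : Model K r Ω)

/-- The σ-algebra generated by `ξ_{i,t}`, `(i, t) ∈ E`. -/
@[reducible] def sigma (E : Set ((∀ k, Fin (S.p k)) × ℤ)) : MeasurableSpace Ω :=
  ⨆ x ∈ E, MeasurableSpace.comap (S.ξ x.1 x.2) inferInstance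

/-- Independent time series, each exponentially strongly mixing. -/
structure IndepAssumption [MeasurableSpace Ω] (P : Measure Ω) (ε om c₀ cε : ℝ) : Prop where
  indep : iIndepFun (fun i w t => S.ξ i t w) P
  mixing : ∀ (i : ∀ k, Fin (S.p k)) (t : ℤ) (m : ℕ),
    alphaMix P (S.sigma {x | x.1 = i ∧ x.2 ≤ t}) (S.sigma {x | x.1 = i ∧ t + m ≤ x.2})
      ≤ Real.exp (-(c₀ * m))
  factor₁ : S.factorMix ε (c₀ * ε / (1 + ε)) ≤ om ^ (2 + 2 * ε) * cε
  factor₂ : ∀ k, S.factorMix ε (c₀ / (3 * Real.log (S.n * S.pExcept k)))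
    ≤ om ^ (2 + 2 * ε) * cε * Real.log (S.n * S.pExcept k)

/-- An exponentially strongly mixing random field. -/
structure FieldAssumption [MeasurableSpace Ω] (P : Measure Ω) (ε om c₀ cε : ℝ) : Prop where
  mixing : ∀ (m : ℕ) (E₁ E₂ : Set ((∀ k, Fin (S.p k)) × ℤ)), (m : ℕ∞) ≤ setDist E₁ E₂ →
    alphaMix P (S.sigma E₁) (S.sigma E₂) ≤ Real.exp (-(c₀ * m))
  factor₁ : S.factorMix ε (c₀ * ε / (K * (1 + ε))) ≤ om ^ (2 + 2 * ε) * cε * K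
  factor₂ : S.factorMix ε (c₀ / (3 * K * Real.log (S.n * S.pAll)))
    ≤ om ^ (2 + 2 * ε) * cε * K * Real.log (S.n * S.pAll)

/-- The assumption on the dependence in the given regime. -/
def DependenceAssumption [MeasurableSpace Ω] (R : Regime) (P : Measure Ω)
    (ε om c₀ cε : ℝ) : Prop :=
  match R with
  | .indep => S.IndepAssumption P ε om c₀ cε
  | .field => S.FieldAssumption P ε om c₀ cε

/-- The logarithmic factor in the rates: `log (n p_{-k})` or `log^K (n p)`. -/
noncomputable def logFactor (R : Regime) (k : Fin K) : ℝ :=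
  match R with
  | .indep => Real.log (S.n * S.pExcept k)
  | .field => Real.log (S.n * S.pAll) ^ K

/-- The order `τ^{(k)}_{n,p}` of the truncation level. -/
noncomputable def tauRate (R : Regime) (ε om : ℝ) (k : Fin K) : ℝ :=
  om * ((S.n * S.pExcept k : ℝ) / S.logFactor R k) ^ (1 / (2 + 2 * ε))

/-- The rate `ψ^{(k)}_{n,p}`. -/
noncomputable def psi (R : Regime) (ε om : ℝ) (k : Fin K) : ℝ :=
  om ^ 2 * (S.logFactor R k / (S.n * S.pExcept k : ℝ)) ^ (ε / (1 + ε))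

end Model

end TensorFactor

namespace TensorFactor

open Matrix

/-! ### Eigenvalues and quadratic forms -/

/-! Write the truncated data as the common component plus a residual. Everything rests on one
estimate: with probability close to one, the energy of the unfolded residuals in direction `v`,
summed over time, is at most `Cρ · n p_{-k} p_k |v|²` in every mode (`SmallResid`). On that event
the argument is linear algebra. A vector orthogonal to the columns of `Λ_k` sees no common
component, so by the min-max principle (`eigVal_le`) all eigenvalues beyond the `r_k`-th, before and
after projection, are at most `Cρ p_k`. Conversely, a vector orthogonal to the first `s ≥ r_k`
sample eigenvectors meets only these small eigenvalues, so those eigenvectors capture at least half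
of the energy of every combination of loadings (`Setup.sub_leading_load_le`); overestimating the
factor numbers does no harm. Multiplying these inequalities over the modes, the projection keeps a
fraction `(1/2)^(K-1)` of the signal, and the `r_k`-th projected eigenvalue stays of order `p_k`
(`Setup.le_eigVal_gammaCheck`). The ratio at `r_k` is therefore at least of order `1/ρ`, while all
others stay bounded (`eq_of_ratio_max`).

For the estimate itself (`measure_quadForm_gt_le`), the Gram matrix of the residuals is compared
with its mean. The mean is controlled by row sums of covariances, which contribute `1/p_k`, and by
the squared truncation bias. The fluctuation is bounded in Frobenius norm through its second moment,
which requires summing covariances of products of two residuals (`sum_abs_covariance_mul_le`). Each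
of these has two bounds, one from moments (of order `τ^(2-2ε)`) and one from mixing (of order `τ⁴`
times an exponential in the distance). Interpolating between them costs only the logarithms in
`logFactor` and makes the fluctuation of order `ψ`. -/

theorem exists_isEigenbasis {m : ℕ} {A : Matrix (Fin m) (Fin m) ℝ} (hA : A.IsHermitian) :
    ∃ e, IsEigenbasis A e := by
  let b := (isSymmetric_toEuclideanLin_iff.mpr hA).eigenvectorBasis
    (finrank_euclideanSpace (𝕜 := ℝ) (ι := Fin m))
  refine ⟨fun j => ⇑(b (Fin.cast (Fintype.card_fin m).symm j)), ?_, ?_⟩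
  · intro i j
    have h := orthonormal_iff_ite.mp b.orthonormal (Fin.cast (Fintype.card_fin m).symm i)
      (Fin.cast (Fintype.card_fin m).symm j)
    simp only [EuclideanSpace.inner_eq_star_dotProduct] at h
    rw [dotProduct_comm]
    simpa using h
  · intro j
    -- `eigVal` counts from 1, `Fin m` from 0; hence the shift here and in all later expansions.
    have h : eigVal A (j + 1) = hA.eigenvalues₀ (Fin.cast (Fintype.card_fin m).symm j) := by
      unfold eigVal
      rw [dif_pos ⟨hA, by omega, by omega⟩]
      congr
    rw [h]
    exact congr(⇑$((isSymmetric_toEuclideanLin_iff.mpr hA).apply_eigenvectorBasis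
        (finrank_euclideanSpace (𝕜 := ℝ) (ι := Fin m)) (Fin.cast (Fintype.card_fin m).symm j)))

theorem eigVal_antitone {m : ℕ} (A : Matrix (Fin m) (Fin m) ℝ) {i j : ℕ} (hi : 1 ≤ i)
    (hij : i ≤ j) (hj : j ≤ m) : eigVal A j ≤ eigVal A i := by
  unfold eigVal
  by_cases hA : A.IsHermitian
  · rw [dif_pos ⟨hA, by omega, hj⟩, dif_pos ⟨hA, hi, by omega⟩]
    apply hA.eigenvalues₀_antitone
    simp only [Fin.mk_le_mk]
    omega
  · rw [dif_neg (fun h => hA h.1), dif_neg (fun h => hA h.1)]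

namespace IsEigenbasis

variable {m : ℕ} {A : Matrix (Fin m) (Fin m) ℝ} {e : Fin m → Fin m → ℝ}

theorem of_mul_transpose (he : IsEigenbasis A e) : Matrix.of e * (Matrix.of e)ᵀ = 1 := by
  ext i j
  simpa [Matrix.mul_apply, dotProduct, Matrix.one_apply] using he.orthonormal i j

theorem transpose_mul_of (he : IsEigenbasis A e) : (Matrix.of e)ᵀ * Matrix.of e = 1 :=
  mul_eq_one_comm.mp he.of_mul_transpose

theorem dotProduct_eq_sum (he : IsEigenbasis A e) (v w : Fin m → ℝ) :
    v ⬝ᵥ w = ∑ j, (e j ⬝ᵥ v) * (e j ⬝ᵥ w) := by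
  have : v ⬝ᵥ w = (Matrix.of e *ᵥ v) ⬝ᵥ (Matrix.of e *ᵥ w) := by
    rw [dotProduct_mulVec, ← mulVec_transpose, mulVec_mulVec, he.transpose_mul_of, one_mulVec]
  rw [this]
  rfl

theorem dotProduct_mulVec (hA : A.IsHermitian) (he : IsEigenbasis A e) (v : Fin m → ℝ) (j : Fin m) :
    e j ⬝ᵥ A *ᵥ v = eigVal A (j + 1) * (e j ⬝ᵥ v) := by
  have hT : Aᵀ = A := by simpa using hA.eq
  rw [Matrix.dotProduct_mulVec, ← mulVec_transpose, hT, he.eigenvector, smul_dotProduct, smul_eq_mul]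

theorem quadForm_eq_sum (hA : A.IsHermitian) (he : IsEigenbasis A e) (v : Fin m → ℝ) :
    v ⬝ᵥ A *ᵥ v = ∑ j : Fin m, eigVal A (j + 1) * (e j ⬝ᵥ v) ^ 2 := by
  rw [he.dotProduct_eq_sum]
  refine Finset.sum_congr rfl fun j _ => ?_
  rw [he.dotProduct_mulVec hA]
  ring

theorem quadForm_le (hA : A.IsHermitian) (he : IsEigenbasis A e) {s : ℕ} (v : Fin m → ℝ)
    (hv : ∀ j : Fin m, (j : ℕ) < s → e j ⬝ᵥ v = 0) :
    v ⬝ᵥ A *ᵥ v ≤ eigVal A (s + 1) * (v ⬝ᵥ v) := by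
  rw [he.quadForm_eq_sum hA, he.dotProduct_eq_sum, Finset.mul_sum]
  refine Finset.sum_le_sum fun j _ => ?_
  by_cases hj : (j : ℕ) < s
  · simp [hv j hj]
  · rw [← sq]
    exact mul_le_mul_of_nonneg_right (eigVal_antitone A (by omega) (by omega) (by omega))
      (sq_nonneg _)

theorem le_quadForm (hA : A.IsHermitian) (he : IsEigenbasis A e) {s : ℕ} (hsm : s ≤ m)
    (v : Fin m → ℝ) (hv : ∀ j : Fin m, s ≤ (j : ℕ) → e j ⬝ᵥ v = 0) :
    eigVal A s * (v ⬝ᵥ v) ≤ v ⬝ᵥ A *ᵥ v := by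
  rw [he.quadForm_eq_sum hA, he.dotProduct_eq_sum, Finset.mul_sum]
  refine Finset.sum_le_sum fun j _ => ?_
  by_cases hj : s ≤ (j : ℕ)
  · simp [hv j hj]
  · rw [← sq]
    exact mul_le_mul_of_nonneg_right (eigVal_antitone A (by omega) (by omega) (by omega))
      (sq_nonneg _)

end IsEigenbasis

theorem dotProduct_self_pos {ι : Type*} [Fintype ι] {v : ι → ℝ} (hv : v ≠ 0) : 0 < v ⬝ᵥ v := by
  obtain ⟨i, hi⟩ := Function.ne_iff.mp hv
  exact Finset.sum_pos' (fun _ _ => mul_self_nonneg _) ⟨i, Finset.mem_univ _, mul_self_pos.mpr hi⟩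

theorem dotProduct_self_nonneg' {ι : Type*} [Fintype ι] (v : ι → ℝ) : 0 ≤ v ⬝ᵥ v :=
  Finset.sum_nonneg fun _ _ => mul_self_nonneg _

/-- An upper bound for a quadratic form on a subspace of codimension at most `s` bounds all but the
first `s` eigenvalues. -/
theorem eigVal_le {m s : ℕ} {A : Matrix (Fin m) (Fin m) ℝ} (hA : A.IsHermitian)
    (B : Matrix (Fin m) (Fin s) ℝ) {c : ℝ} (hc : 0 ≤ c)
    (h : ∀ v, Bᵀ *ᵥ v = 0 → v ⬝ᵥ A *ᵥ v ≤ c * (v ⬝ᵥ v)) {j : ℕ} (hj : s + 1 ≤ j) :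
    eigVal A j ≤ c := by
  by_cases hjm : j ≤ m
  swap
  -- Beyond the dimension `eigVal` takes its default value 0, which is where `0 ≤ c` enters.
  · unfold eigVal
    rw [dif_neg (fun h => hjm h.2.2)]
    exact hc
  obtain ⟨e, he⟩ := exists_isEigenbasis hA
  -- Dimension count: the `s` conditions from `B` and the `m - j` conditions of orthogonality to `e
  -- j, e (j+1), …` are together fewer than `m`, so a nonzero `v` meets them all. It lies in the
  -- span of the first `j` eigenvectors.
  let f : (Fin m → ℝ) →ₗ[ℝ] (Fin s → ℝ) × ({i : Fin m // j ≤ (i : ℕ)} → ℝ) :=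
    (Matrix.mulVecLin Bᵀ).prod (LinearMap.pi fun i => dotProductBilin ℝ ℝ (e i))
  have hcard : Fintype.card {i : Fin m // j ≤ (i : ℕ)} = m - j := by
    rw [Fintype.card_subtype]
    have : (Finset.univ.filter fun i : Fin m => j ≤ (i : ℕ)) =
        Finset.univ \ (Finset.univ.filter fun i : Fin m => (i : ℕ) < j) := by
      ext i; simp
    rw [this, Finset.card_sdiff, Finset.inter_univ, Fin.card_filter_val_lt]
    simp [hjm]
  have hker : LinearMap.ker f ≠ ⊥ := by
    apply LinearMap.ker_ne_bot_of_finrank_lt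
    simp only [Module.finrank_prod, Module.finrank_fintype_fun_eq_card, Fintype.card_fin, hcard]
    omega
  obtain ⟨v, hv, hv0⟩ := (Submodule.ne_bot_iff _).mp hker
  have hv' := LinearMap.mem_ker.mp hv
  have h1 : Bᵀ *ᵥ v = 0 := congrArg Prod.fst hv'
  have h2 : ∀ i : Fin m, j ≤ (i : ℕ) → e i ⬝ᵥ v = 0 := fun i hi =>
    congrFun (congrArg Prod.snd hv') ⟨i, hi⟩
  exact le_of_mul_le_mul_right ((he.le_quadForm hA hjm v h2).trans (h v h1))
    (dotProduct_self_pos hv0)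

/-- A lower bound for a quadratic form on a subspace of dimension `s` bounds the first `s`
eigenvalues. -/
theorem le_eigVal {m s : ℕ} {A : Matrix (Fin m) (Fin m) ℝ} (hA : A.IsHermitian) (hs : 1 ≤ s)
    (B : Matrix (Fin m) (Fin s) ℝ) {c : ℝ} (hB : ∀ a, B *ᵥ a = 0 → a = 0)
    (h : ∀ a, c * ((B *ᵥ a) ⬝ᵥ (B *ᵥ a)) ≤ (B *ᵥ a) ⬝ᵥ A *ᵥ (B *ᵥ a)) :
    c ≤ eigVal A s := by
  obtain ⟨e, he⟩ := exists_isEigenbasis hA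
  obtain ⟨t, rfl⟩ := Nat.exists_eq_add_of_le' hs
  -- The dual count: `t` conditions on `t + 1` coefficients leave a nonzero `a` with `B a`
  -- orthogonal to the first `t` eigenvectors, and injectivity of `B` keeps `B a` nonzero.
  let f : (Fin (t + 1) → ℝ) →ₗ[ℝ] (Fin t → ℝ) :=
    LinearMap.pi fun i => (if h : (i : ℕ) < m then dotProductBilin ℝ ℝ (e ⟨i, h⟩) else 0) ∘ₗ
      Matrix.mulVecLin B
  have hker : LinearMap.ker f ≠ ⊥ := by
    apply LinearMap.ker_ne_bot_of_finrank_lt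
    simp
  obtain ⟨a, ha, ha0⟩ := (Submodule.ne_bot_iff _).mp hker
  have hv' := LinearMap.mem_ker.mp ha
  have h2 : ∀ i : Fin m, (i : ℕ) < t → e i ⬝ᵥ (B *ᵥ a) = 0 := fun i hi => by
    have := congrFun hv' ⟨i, hi⟩
    simpa [f] using this
  exact le_of_mul_le_mul_right ((h a).trans (he.quadForm_le hA _ h2))
    (dotProduct_self_pos fun h0 => ha0 (hB a h0))

/-! ### Kronecker products -/

section Kronecker

variable {ι : Type*} [Fintype ι] {d : ι → Type*}

/-- The Kronecker product of a family of square matrices over a finite set of modes. -/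
def kronOn [∀ j, DecidableEq (d j)] (s : Finset ι) (A : ∀ j, Matrix (d j) (d j) ℝ) :
    Matrix (∀ j, d j) (∀ j, d j) ℝ :=
  Matrix.of fun c a => ∏ j ∈ s, A j (c j) (a j)

variable [∀ j, Fintype (d j)] [∀ j, DecidableEq (d j)]

/-- A Kronecker product over tuples is a Hadamard product of pullbacks of its factors, so the Schur
product theorem applies. Monotonicity follows by changing one factor at a time: `B' ⊙ B_j - A' ⊙ A_j
= (B' - A') ⊙ B_j + A' ⊙ (B_j - A_j)`. -/
theorem posSemidef_kronOn [DecidableEq ι] (s : Finset ι) {A B : ∀ j, Matrix (d j) (d j) ℝ}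
    (hA : ∀ j, (A j).PosSemidef) (hAB : ∀ j, (B j - A j).PosSemidef) :
    (kronOn s A).PosSemidef ∧ (kronOn s B - kronOn s A).PosSemidef := by
  induction s using Finset.induction_on with
  | empty =>
    constructor
    · have : kronOn (d := d) ∅ A = vecMulVec (fun _ => 1) (star fun _ => 1) := by
        ext; simp [kronOn, vecMulVec_apply]
      rw [this]
      exact posSemidef_vecMulVec_self_star _
    · have : kronOn (d := d) ∅ B - kronOn ∅ A = 0 := by ext; simp [kronOn]
      rw [this]
      exact PosSemidef.zero
  | insert j s hj ih =>
    have h0 : ∀ C : ∀ j, Matrix (d j) (d j) ℝ, kronOn (insert j s) C =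
        (kronOn s C) ⊙ ((C j).submatrix (fun a : ∀ j, d j => a j) fun a => a j) := by
      intro C
      ext c a
      simp [kronOn, Finset.prod_insert hj, mul_comm]
    have hB : (B j).PosSemidef := by simpa using (hAB j).add (hA j)
    constructor
    · rw [h0]
      exact ih.1.hadamard ((hA j).submatrix _)
    · have : kronOn (insert j s) B - kronOn (insert j s) A =
          (kronOn s B - kronOn s A) ⊙ ((B j).submatrix (fun a : ∀ j, d j => a j) fun a => a j) +
          kronOn s A ⊙ ((B j - A j).submatrix (fun a : ∀ j, d j => a j) fun a => a j) := by
        rw [h0, h0]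
        ext c a
        simp
        ring
      rw [this]
      exact (ih.2.hadamard (hB.submatrix _)).add (ih.1.hadamard ((hAB j).submatrix _))

end Kronecker

variable {K : ℕ}

theorem kronExcept_mul {d s u : Fin K → ℕ} (k : Fin K) (A : ∀ j, Matrix (Fin (d j)) (Fin (s j)) ℝ)
    (B : ∀ j, Matrix (Fin (s j)) (Fin (u j)) ℝ) :
    kronExcept k A * kronExcept k B = kronExcept k fun j => A j * B j := by
  ext c a
  simp only [kronExcept, mul_apply, of_apply, Finset.prod_univ_sum, ← Finset.prod_mul_distrib]
  simp

theorem kronExcept_transpose {d s : Fin K → ℕ} (k : Fin K)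
    (A : ∀ j, Matrix (Fin (d j)) (Fin (s j)) ℝ) :
    (kronExcept k A)ᵀ = kronExcept k fun j => (A j)ᵀ := rfl

theorem kronExcept_smul_one {d : Fin K → ℕ} (k : Fin K) (c : Fin K → ℝ) :
    kronExcept k (fun j => c j • (1 : Matrix (Fin (d j)) (Fin (d j)) ℝ)) =
      (∏ j ∈ Finset.univ.erase k, c j) • (1 : Matrix (ColIdx d k) (ColIdx d k) ℝ) := by
  have h : ∏ j ∈ Finset.univ.erase k, c j = ∏ j : {j // j ≠ k}, c j := by
    apply Finset.prod_subtype
    simp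
  rw [h]
  ext a b
  simp only [kronExcept, of_apply, Matrix.smul_apply, one_apply, smul_eq_mul, Finset.prod_mul_distrib]
  congr 1
  by_cases hab : a = b
  · simp [hab]
  · obtain ⟨j, hj⟩ := Function.ne_iff.mp hab
    rw [if_neg hab]
    exact Finset.prod_eq_zero (Finset.mem_univ j) (by simp [hj])

/-- This turns estimates made in each mode separately into estimates for the full projection `D Dᵀ`.
-/
theorem kronExcept_mono {d : Fin K → ℕ} (k : Fin K) {A B : ∀ j, Matrix (Fin (d j)) (Fin (d j)) ℝ}
    (hA : ∀ j, (A j).PosSemidef) (hAB : ∀ j, (B j - A j).PosSemidef) (x : ColIdx d k → ℝ) :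
    x ⬝ᵥ kronExcept k A *ᵥ x ≤ x ⬝ᵥ kronExcept k B *ᵥ x := by
  have := (posSemidef_kronOn (ι := {j // j ≠ k}) (d := fun j => Fin (d j)) Finset.univ
    (A := fun j => A j) (B := fun j => B j) (fun j => hA j) (fun j => hAB j)).2
  have h := this.dotProduct_mulVec_nonneg x
  rw [sub_mulVec, dotProduct_sub] at h
  exact sub_nonneg.mp h

/-- Multiplying out all modes and unfolding. -/
theorem unfold_tucker {d e : Fin K → ℕ} (k : Fin K) (F : Tensor d)
    (L : ∀ k, Matrix (Fin (e k)) (Fin (d k)) ℝ) :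
    unfold k (tucker F L) = L k * unfold k F * (kronExcept k L)ᵀ := by
  ext i c
  simp only [unfold, of_apply, tucker, mul_apply, transpose_apply, kronExcept, Finset.sum_mul]
  rw [← (Equiv.piSplitAt k fun j => Fin (d j)).symm.sum_comp, Fintype.sum_prod_type,
    Finset.sum_comm]
  refine Finset.sum_congr rfl fun a _ => Finset.sum_congr rfl fun b _ => ?_
  have : ∏ x, L x ((Equiv.piSplitAt k fun j => Fin (e j)).symm (i, c) x)
      ((Equiv.piSplitAt k fun j => Fin (d j)).symm (b, a) x) =
      L k i b * ∏ x : {j // j ≠ k}, L x (c x) (a x) := by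
    rw [← Finset.mul_prod_erase _ _ (Finset.mem_univ k)]
    congr 1
    · simp [Equiv.piSplitAt]
    · rw [Finset.prod_subtype (p := fun j => j ≠ k) _ (by simp)]
      refine Finset.prod_congr rfl fun x _ => ?_
      simp [Equiv.piSplitAt, x.2]
  rw [this]
  ring

end TensorFactor

namespace TensorFactor

open Matrix

/-! ### Projections onto leading eigenvectors -/

theorem dotProduct_sq_le {ι : Type*} [Fintype ι] (v w : ι → ℝ) :
    (v ⬝ᵥ w) ^ 2 ≤ (v ⬝ᵥ v) * (w ⬝ᵥ w) := by
  simpa [dotProduct, sq] using Finset.sum_mul_sq_le_sq_mul_sq Finset.univ v w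

/-- In eigenbasis coordinates the projector is a 0-1 diagonal matrix, so its properties can be read
off coordinate by coordinate. -/
theorem leading_mul_transpose {m s : ℕ} (e : Fin m → Fin m → ℝ) (hs : s ≤ m) :
    leading e s * (leading e s)ᵀ =
      (Matrix.of e)ᵀ * diagonal (fun j : Fin m => if (j : ℕ) < s then (1 : ℝ) else 0) *
        Matrix.of e := by
  ext i i'
  rw [mul_apply, mul_apply]
  simp only [mul_diagonal, transpose_apply, leading, of_apply]
  let g : ℕ → ℝ := fun j => if h : j < m then e ⟨j, h⟩ i * e ⟨j, h⟩ i' else 0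
  have h1 : ∀ j : Fin s, (if h : (j : ℕ) < m then e ⟨j, h⟩ i else 0) *
      (if h : (j : ℕ) < m then e ⟨j, h⟩ i' else 0) = g j := by
    intro j
    simp [g, show (j : ℕ) < m by omega]
  have h2 : ∀ j : Fin m, e j i * (if (j : ℕ) < s then (1 : ℝ) else 0) * e j i' =
      (fun t : ℕ => if t < s then g t else 0) j := by
    intro j
    simp only [g, Fin.is_lt, dif_pos]
    split_ifs <;> simp
  rw [Finset.sum_congr rfl fun j _ => h1 j, Finset.sum_congr rfl fun j _ => h2 j,
    Fin.sum_univ_eq_sum_range, Fin.sum_univ_eq_sum_range (fun t : ℕ => if t < s then g t else 0),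
    ← Finset.sum_filter]
  congr 1
  ext t
  simp
  omega

namespace IsEigenbasis

variable {m s : ℕ} {A : Matrix (Fin m) (Fin m) ℝ} {e : Fin m → Fin m → ℝ}

theorem dotProduct_leading (he : IsEigenbasis A e) (hs : s ≤ m) (v : Fin m → ℝ) (j : Fin m) :
    e j ⬝ᵥ (leading e s * (leading e s)ᵀ) *ᵥ v = if (j : ℕ) < s then e j ⬝ᵥ v else 0 := by
  have : e j ⬝ᵥ (leading e s * (leading e s)ᵀ) *ᵥ v =
      (Matrix.of e *ᵥ ((leading e s * (leading e s)ᵀ) *ᵥ v)) j := rfl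
  rw [this, leading_mul_transpose e hs, mulVec_mulVec, ← Matrix.mul_assoc, ← Matrix.mul_assoc,
    he.of_mul_transpose, Matrix.one_mul, ← mulVec_mulVec, mulVec_diagonal, ite_mul, one_mul, zero_mul]
  rfl

theorem dotProduct_sub_leading (he : IsEigenbasis A e) (hs : s ≤ m) (v : Fin m → ℝ) (j : Fin m) :
    e j ⬝ᵥ (v - (leading e s * (leading e s)ᵀ) *ᵥ v) =
      if (j : ℕ) < s then 0 else e j ⬝ᵥ v := by
  rw [dotProduct_sub, he.dotProduct_leading hs]
  split_ifs <;> simp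

theorem sub_leading_dotProduct_self (he : IsEigenbasis A e) (hs : s ≤ m) (v : Fin m → ℝ) :
    (v - (leading e s * (leading e s)ᵀ) *ᵥ v) ⬝ᵥ (v - (leading e s * (leading e s)ᵀ) *ᵥ v) =
      (v - (leading e s * (leading e s)ᵀ) *ᵥ v) ⬝ᵥ v := by
  rw [he.dotProduct_eq_sum, he.dotProduct_eq_sum]
  refine Finset.sum_congr rfl fun j _ => ?_
  rw [he.dotProduct_sub_leading hs]
  split_ifs <;> simp

theorem sub_leading_dotProduct (he : IsEigenbasis A e) (hs : s ≤ m) (v : Fin m → ℝ) :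
    (v - (leading e s * (leading e s)ᵀ) *ᵥ v) ⬝ᵥ (v - (leading e s * (leading e s)ᵀ) *ᵥ v) =
      v ⬝ᵥ v - v ⬝ᵥ (leading e s * (leading e s)ᵀ) *ᵥ v := by
  rw [he.sub_leading_dotProduct_self hs, dotProduct_comm, dotProduct_sub]

theorem leading_posSemidef : (leading e s * (leading e s)ᵀ).PosSemidef := by
  simpa using posSemidef_self_mul_conjTranspose (leading e s)

theorem one_sub_leading_posSemidef (he : IsEigenbasis A e) (hs : s ≤ m) :
    (1 - leading e s * (leading e s)ᵀ).PosSemidef := by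
  refine .of_dotProduct_mulVec_nonneg (isHermitian_one.sub leading_posSemidef.1) fun v => ?_
  rw [sub_mulVec, one_mulVec, dotProduct_sub, star_trivial, ← he.sub_leading_dotProduct hs]
  exact dotProduct_self_nonneg' _

end IsEigenbasis

theorem eigVal_nonneg {m : ℕ} {A : Matrix (Fin m) (Fin m) ℝ} (hA : A.IsHermitian)
    (h : ∀ v, 0 ≤ v ⬝ᵥ A *ᵥ v) (j : ℕ) : 0 ≤ eigVal A j := by
  by_cases hj : 1 ≤ j ∧ j ≤ m
  · obtain ⟨e, he⟩ := exists_isEigenbasis hA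
    have h1 := h (e ⟨j - 1, by omega⟩)
    rw [he.dotProduct_mulVec hA, he.orthonormal, if_pos rfl, mul_one] at h1
    have h2 : j - 1 + 1 = j := by omega
    simpa [h2] using h1
  · unfold eigVal
    rw [dif_neg (fun h => hj h.2)]

/-! ### Sums of squares of linear forms in the data -/

/-- `∑ₜ |vᵀ Y_t|²`. -/
def energy {a b : Type*} [Fintype a] [Fintype b] (n : ℕ) (Y : ℕ → Matrix a b ℝ) (v : a → ℝ) : ℝ :=
  ∑ t ∈ Finset.Icc 1 n, (v ᵥ* Y t) ⬝ᵥ (v ᵥ* Y t)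

section energy

variable {a b c : Type*} [Fintype a] [Fintype b] [Fintype c] (n : ℕ)

theorem energy_nonneg (Y : ℕ → Matrix a b ℝ) (v : a → ℝ) : 0 ≤ energy n Y v :=
  Finset.sum_nonneg fun _ _ => dotProduct_self_nonneg' _

/-- `(y + z)² ≤ 2y² + 2z²`. It serves in both directions: to bound the data by signal and residual,
and the signal by data and residual. -/
theorem energy_le {X Y Z : ℕ → Matrix a b ℝ} {v : a → ℝ}
    (h : ∀ t, v ᵥ* X t = v ᵥ* Y t + v ᵥ* Z t) :
    energy n X v ≤ 2 * energy n Y v + 2 * energy n Z v := by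
  unfold energy
  rw [Finset.mul_sum, Finset.mul_sum, ← Finset.sum_add_distrib]
  refine Finset.sum_le_sum fun t _ => ?_
  rw [h]
  simp only [dotProduct, Finset.mul_sum, ← Finset.sum_add_distrib, Pi.add_apply]
  exact Finset.sum_le_sum fun i _ => by nlinarith [sq_nonneg ((v ᵥ* Y t) i - (v ᵥ* Z t) i)]

theorem energy_neg (Y : ℕ → Matrix a b ℝ) (v : a → ℝ) :
    energy n (fun t => - Y t) v = energy n Y v := by
  simp [energy, vecMul_neg]

theorem quadForm_sum (Y : ℕ → Matrix a b ℝ) (N : ℝ) (v : a → ℝ) :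
    v ⬝ᵥ (N⁻¹ • ∑ t ∈ Finset.Icc 1 n, Y t * (Y t)ᵀ) *ᵥ v = N⁻¹ * energy n Y v := by
  rw [smul_mulVec, dotProduct_smul, smul_eq_mul, sum_mulVec, dotProduct_sum]
  congr 1
  refine Finset.sum_congr rfl fun t _ => ?_
  rw [← mulVec_mulVec, dotProduct_mulVec, mulVec_transpose]

omit [Fintype a] in
theorem isHermitian_sum (Y : ℕ → Matrix a b ℝ) (N : ℝ) :
    (N⁻¹ • ∑ t ∈ Finset.Icc 1 n, Y t * (Y t)ᵀ).IsHermitian := by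
  rw [IsHermitian, conjTranspose_smul, conjTranspose_sum]
  simp

theorem energy_mul (Y : ℕ → Matrix a b ℝ) (D : Matrix b c ℝ) (v : a → ℝ) :
    energy n (fun t => Y t * D) v =
      ∑ t ∈ Finset.Icc 1 n, (v ᵥ* Y t) ⬝ᵥ (D * Dᵀ) *ᵥ (v ᵥ* Y t) := by
  refine Finset.sum_congr rfl fun t _ => ?_
  rw [← vecMul_vecMul, ← mulVec_mulVec, dotProduct_mulVec (v ᵥ* Y t), mulVec_transpose]

end energy

/-! ### Deterministic perturbation bounds for the sample moment matrices. -/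

namespace Model

variable {K : ℕ} {r : Fin K → ℕ} {Ω : Type*} (S : Model K r Ω)

/-- The difference between the truncated data and the common component. -/
noncomputable def resid (τ : ℝ) (t : ℕ) (w : Ω) : Tensor S.p :=
  fun i => S.Xtr τ t w i - tucker (S.F t) S.L i

theorem unfold_Xtr (τ : ℝ) (t : ℕ) (w : Ω) (k : Fin K) :
    unfold k (S.Xtr τ t w) = unfold k (tucker (S.F t) S.L) + unfold k (S.resid τ t w) := by
  ext i c
  simp [unfold, resid]

theorem gammaCheck_eq (τ : ℝ) (e : ∀ j, Fin (S.p j) → Fin (S.p j) → ℝ) (s : Fin K → ℕ)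
    (k : Fin K) (w : Ω) : S.gammaCheck τ e s k w =
      ((S.n : ℝ) * S.pExcept k)⁻¹ • ∑ t ∈ Finset.Icc 1 S.n,
        (unfold k (S.Xtr τ t w) * kronExcept k fun j => leading (e j) (s j)) *
          (unfold k (S.Xtr τ t w) * kronExcept k fun j => leading (e j) (s j))ᵀ := by
  unfold gammaCheck
  simp only [transpose_mul, Matrix.mul_assoc]

theorem gammaF_quadForm (k : Fin K) (x : Fin (r k) → ℝ) :
    x ⬝ᵥ S.gammaF k *ᵥ x = (S.n : ℝ)⁻¹ * energy S.n (fun t => unfold k (S.F t)) x :=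
  quadForm_sum _ _ _ _

theorem gammaF_quadForm_eq {k : Fin K} (h : (S.gammaF k).IsDiag) (x : Fin (r k) → ℝ) :
    x ⬝ᵥ S.gammaF k *ᵥ x = ∑ j, S.gammaF k j j * (x j * x j) := by
  rw [← h.diagonal_diag]
  simp only [mulVec_diagonal, dotProduct, diag_apply, diagonal_apply_eq]
  exact Finset.sum_congr rfl fun j _ => by ring

theorem quadForm_gammaHat (k : Fin K) (v : Fin (S.p k) → ℝ) (τ : ℝ) (w : Ω) :
    v ⬝ᵥ S.gammaHat τ k w *ᵥ v =
      ((S.n : ℝ) * S.pExcept k)⁻¹ * energy S.n (fun u => unfold k (S.Xtr τ u w)) v :=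
  quadForm_sum _ _ _ _

theorem isHermitian_gammaHat (k : Fin K) (τ : ℝ) (w : Ω) : (S.gammaHat τ k w).IsHermitian :=
  isHermitian_sum _ _ _

theorem isHermitian_gammaCheck (τ : ℝ) (e : ∀ j, Fin (S.p j) → Fin (S.p j) → ℝ) (s : Fin K → ℕ)
    (k : Fin K) (w : Ω) : (S.gammaCheck τ e s k w).IsHermitian := by
  rw [gammaCheck_eq]
  exact isHermitian_sum _ _ _

/-- The deterministic consequences of the loading and factor assumptions, and of a bound on the
operator norms of the unfolded residuals. -/
structure Setup (a b z : ℝ) (τ : Fin K → ℝ) (w : Ω) : Prop where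
  n_pos : 0 < S.n
  p_pos : ∀ k, 0 < S.p k
  load : ∀ k, (S.L k)ᵀ * S.L k = (S.p k : ℝ) • (1 : Matrix (Fin (r k)) (Fin (r k)) ℝ)
  a_pos : 0 < a
  b_nonneg : 0 ≤ b
  le_gammaF : ∀ k (x : Fin (r k) → ℝ), a * (x ⬝ᵥ x) ≤ x ⬝ᵥ S.gammaF k *ᵥ x
  gammaF_le : ∀ k (x : Fin (r k) → ℝ), x ⬝ᵥ S.gammaF k *ᵥ x ≤ b * (x ⬝ᵥ x)
  z_nonneg : 0 ≤ z
  resid_le : ∀ k v, energy S.n (fun t => unfold k (S.resid (τ k) t w)) v ≤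
    z * (S.n * S.pExcept k * S.p k) * (v ⬝ᵥ v)

namespace Setup

variable {S} {a b z : ℝ} {τ : Fin K → ℝ} {w : Ω} (H : S.Setup a b z τ w)
include H

theorem pExcept_pos (k : Fin K) : (0 : ℝ) < S.pExcept k := by
  have : 0 < S.pExcept k := Finset.prod_pos fun j _ => H.p_pos j
  exact_mod_cast this

theorem N_pos (k : Fin K) : (0 : ℝ) < S.n * S.pExcept k :=
  mul_pos (by exact_mod_cast H.n_pos) (H.pExcept_pos k)

theorem kron_load (k : Fin K) : (kronExcept k S.L)ᵀ * kronExcept k S.L =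
    (S.pExcept k : ℝ) • (1 : Matrix (ColIdx r k) (ColIdx r k) ℝ) := by
  rw [kronExcept_transpose, kronExcept_mul]
  simp only [H.load]
  rw [kronExcept_smul_one k fun j => (S.p j : ℝ)]
  simp [pExcept]

/-- The Kronecker product of the loadings has orthogonal columns of squared length `p_{-k}`, so the
other modes enter the signal energy only through that factor. -/
theorem energy_chi (k : Fin K) (v : Fin (S.p k) → ℝ) :
    energy S.n (fun t => unfold k (tucker (S.F t) S.L)) v =
      S.n * S.pExcept k * (((S.L k)ᵀ *ᵥ v) ⬝ᵥ S.gammaF k *ᵥ ((S.L k)ᵀ *ᵥ v)) := by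
  rw [gammaF_quadForm]
  have h1 : energy S.n (fun t => unfold k (tucker (S.F t) S.L)) v =
      S.pExcept k * energy S.n (fun t => unfold k (S.F t)) ((S.L k)ᵀ *ᵥ v) := by
    simp only [unfold_tucker]
    rw [energy_mul, transpose_transpose, H.kron_load, energy, Finset.mul_sum]
    refine Finset.sum_congr rfl fun t _ => ?_
    rw [smul_mulVec, one_mulVec, dotProduct_smul, smul_eq_mul, ← vecMul_vecMul, mulVec_transpose]
  have hn : (S.n : ℝ) ≠ 0 := by exact_mod_cast H.n_pos.ne'
  rw [h1]
  field_simp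

theorem load_mulVec (k : Fin K) (x : Fin (r k) → ℝ) :
    (S.L k)ᵀ *ᵥ (S.L k *ᵥ x) = (S.p k : ℝ) • x := by
  rw [mulVec_mulVec, H.load, smul_mulVec, one_mulVec]

theorem load_dotProduct (k : Fin K) (x : Fin (r k) → ℝ) :
    (S.L k *ᵥ x) ⬝ᵥ (S.L k *ᵥ x) = S.p k * (x ⬝ᵥ x) := by
  rw [dotProduct_mulVec, ← mulVec_transpose, H.load_mulVec, smul_dotProduct, smul_eq_mul]

theorem load_transpose_le (k : Fin K) (v : Fin (S.p k) → ℝ) :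
    ((S.L k)ᵀ *ᵥ v) ⬝ᵥ ((S.L k)ᵀ *ᵥ v) ≤ S.p k * (v ⬝ᵥ v) := by
  have h1 : ((S.L k)ᵀ *ᵥ v) ⬝ᵥ ((S.L k)ᵀ *ᵥ v) = v ⬝ᵥ (S.L k *ᵥ ((S.L k)ᵀ *ᵥ v)) := by
    rw [dotProduct_mulVec v, ← mulVec_transpose]
  have h2 := dotProduct_sq_le v (S.L k *ᵥ ((S.L k)ᵀ *ᵥ v))
  rw [← h1, H.load_dotProduct] at h2
  rcases (dotProduct_self_nonneg' ((S.L k)ᵀ *ᵥ v)).eq_or_lt with h | h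
  · rw [← h]
    exact mul_nonneg (Nat.cast_nonneg _) (dotProduct_self_nonneg' _)
  · refine le_of_mul_le_mul_right ?_ h
    linarith

theorem quadForm_gammaHat_le (k : Fin K) (v : Fin (S.p k) → ℝ) :
    v ⬝ᵥ S.gammaHat (τ k) k w *ᵥ v ≤ 2 * (b + z) * S.p k * (v ⬝ᵥ v) := by
  rw [S.quadForm_gammaHat, inv_mul_le_iff₀ (H.N_pos k)]
  have h1 := energy_le S.n (X := fun u => unfold k (S.Xtr (τ k) u w))
    (Y := fun u => unfold k (tucker (S.F u) S.L)) (Z := fun u => unfold k (S.resid (τ k) u w))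
    (v := v) fun t => by rw [S.unfold_Xtr, vecMul_add]
  have h2 := H.resid_le k v
  have h3 := (H.gammaF_le k _).trans
    (mul_le_mul_of_nonneg_left (H.load_transpose_le k v) H.b_nonneg)
  have h4 := mul_le_mul_of_nonneg_left h3 (H.N_pos k).le
  rw [H.energy_chi] at h1
  linarith

/-- The unfolded signal has `L k` as its left factor, so such a `v` annihilates it and only the
residual is left. -/
theorem quadForm_gammaHat_le_of_orthogonal (k : Fin K) (v : Fin (S.p k) → ℝ)
    (hv : (S.L k)ᵀ *ᵥ v = 0) :
    v ⬝ᵥ S.gammaHat (τ k) k w *ᵥ v ≤ z * S.p k * (v ⬝ᵥ v) := by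
  rw [S.quadForm_gammaHat, inv_mul_le_iff₀ (H.N_pos k)]
  have hv' : v ᵥ* S.L k = 0 := by rw [← mulVec_transpose, hv]
  have h1 : energy S.n (fun u => unfold k (S.Xtr (τ k) u w)) v =
      energy S.n (fun u => unfold k (S.resid (τ k) u w)) v := by
    refine Finset.sum_congr rfl fun t _ => ?_
    dsimp only
    rw [unfold_Xtr, vecMul_add, unfold_tucker, Matrix.mul_assoc, ← vecMul_vecMul,
      hv', zero_vecMul, zero_add]
  rw [h1]
  have h2 := H.resid_le k v
  linarith

theorem eigVal_gammaHat_le (k : Fin K) {j : ℕ} (hj : r k + 1 ≤ j) :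
    eigVal (S.gammaHat (τ k) k w) j ≤ z * S.p k :=
  eigVal_le (S.isHermitian_gammaHat k _ w) (S.L k) (mul_nonneg H.z_nonneg (Nat.cast_nonneg _))
    (H.quadForm_gammaHat_le_of_orthogonal k) hj

variable {e : ∀ j, Fin (S.p j) → Fin (S.p j) → ℝ}
  (he : ∀ k, IsEigenbasis (S.gammaHat (τ k) k w) (e k)) {s : Fin K → ℕ} (hsp : ∀ k, s k ≤ S.p k)

section
include he hsp

/-- Each mode's projector is at most the identity, hence so is `D Dᵀ`. All upper bounds for the
unprojected matrix carry over. -/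
theorem quadForm_gammaCheck_le (k : Fin K) (v : Fin (S.p k) → ℝ) (t : ℝ) :
    v ⬝ᵥ S.gammaCheck t e s k w *ᵥ v ≤ v ⬝ᵥ S.gammaHat t k w *ᵥ v := by
  rw [gammaCheck_eq, quadForm_sum, S.quadForm_gammaHat]
  refine mul_le_mul_of_nonneg_left ?_ (inv_nonneg.mpr (H.N_pos k).le)
  rw [energy_mul]
  refine Finset.sum_le_sum fun u _ => ?_
  rw [kronExcept_transpose, kronExcept_mul]
  have h := kronExcept_mono (d := S.p) k (A := fun j => leading (e j) (s j) * (leading (e j) (s j))ᵀ)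
    (B := fun j => 1) (fun j => IsEigenbasis.leading_posSemidef)
    (fun j => (he j).one_sub_leading_posSemidef (hsp j)) (v ᵥ* unfold k (S.Xtr t u w))
  have h1 : kronExcept k (fun j => (1 : Matrix (Fin (S.p j)) (Fin (S.p j)) ℝ)) = 1 := by
    simpa using kronExcept_smul_one (d := S.p) k fun _ => 1
  rwa [h1, one_mulVec] at h

theorem eigVal_gammaCheck_le (k : Fin K) {j : ℕ} (hj : r k + 1 ≤ j) :
    eigVal (S.gammaCheck (τ k) e s k w) j ≤ z * S.p k :=
  eigVal_le (S.isHermitian_gammaCheck _ e s k w) (S.L k)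
    (mul_nonneg H.z_nonneg (Nat.cast_nonneg _))
    (fun v hv => (H.quadForm_gammaCheck_le he hsp k v _).trans
      (H.quadForm_gammaHat_le_of_orthogonal k v hv)) hj

theorem eigVal_gammaCheck_le' (k : Fin K) {j : ℕ} (hj : 1 ≤ j) :
    eigVal (S.gammaCheck (τ k) e s k w) j ≤ 2 * (b + z) * S.p k :=
  eigVal_le (s := 0) (S.isHermitian_gammaCheck _ e s k w) 0
    (mul_nonneg (mul_nonneg zero_le_two (add_nonneg H.b_nonneg H.z_nonneg)) (Nat.cast_nonneg _))
    (fun v _ => (H.quadForm_gammaCheck_le he hsp k v _).trans (H.quadForm_gammaHat_le k v))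
    (by omega)

/-- The leading eigenvectors nearly span the loading space. -/
theorem sub_leading_load_le (hrs : ∀ k, r k ≤ s k) (hz : z ≤ a / 8) (k : Fin K)
    (x : Fin (r k) → ℝ) :
    (S.p k : ℝ) / 2 * (x ⬝ᵥ x) ≤
      (S.L k *ᵥ x) ⬝ᵥ (leading (e k) (s k) * (leading (e k) (s k))ᵀ) *ᵥ (S.L k *ᵥ x) := by
  set u := S.L k *ᵥ x with hu
  set y := u - (leading (e k) (s k) * (leading (e k) (s k))ᵀ) *ᵥ u with hy
  have hyy : y ⬝ᵥ y = u ⬝ᵥ u - u ⬝ᵥ (leading (e k) (s k) * (leading (e k) (s k))ᵀ) *ᵥ u :=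
    (he k).sub_leading_dotProduct (hsp k) u
  have hyu : y ⬝ᵥ y = ((S.L k)ᵀ *ᵥ y) ⬝ᵥ x := by
    rw [(he k).sub_leading_dotProduct_self (hsp k), ← hy, hu, dotProduct_mulVec, mulVec_transpose]
  have hp : (0 : ℝ) < S.p k := by exact_mod_cast H.p_pos k
  -- `y` is the part of `u` outside the leading eigenvectors. Since `r k ≤ s k`, it meets only
  -- eigenvalues beyond the `r k`-th, which come from the residual.
  have hquad : y ⬝ᵥ S.gammaHat (τ k) k w *ᵥ y ≤ z * S.p k * (y ⬝ᵥ y) := by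
    refine ((he k).quadForm_le (S.isHermitian_gammaHat k _ w) (s := s k) y fun j hj => ?_).trans ?_
    · rw [(he k).dotProduct_sub_leading (hsp k), if_pos hj]
    · exact mul_le_mul_of_nonneg_right
        (H.eigVal_gammaHat_le k (Nat.succ_le_succ (hrs k))) (dotProduct_self_nonneg' _)
  rw [S.quadForm_gammaHat, inv_mul_le_iff₀ (H.N_pos k)] at hquad
  have h1 := energy_le S.n (X := fun u => unfold k (tucker (S.F u) S.L))
    (Y := fun u => unfold k (S.Xtr (τ k) u w)) (Z := fun u => - unfold k (S.resid (τ k) u w))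
    (v := y) fun t => by rw [S.unfold_Xtr, vecMul_add, vecMul_neg, add_neg_cancel_right]
  rw [energy_neg, H.energy_chi] at h1
  have h2 := H.resid_le k y
  -- The signal energy of `y` is at most twice its data energy plus twice its residual energy; each
  -- of the two is at most `z` on this scale, hence `4 z`.
  have h3 : a * (((S.L k)ᵀ *ᵥ y) ⬝ᵥ ((S.L k)ᵀ *ᵥ y)) ≤ 4 * z * S.p k * (y ⬝ᵥ y) := by
    refine le_of_mul_le_mul_left ?_ (H.N_pos k)
    have := mul_le_mul_of_nonneg_left (H.le_gammaF k ((S.L k)ᵀ *ᵥ y)) (H.N_pos k).le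
    linarith
  have h4 := dotProduct_sq_le ((S.L k)ᵀ *ᵥ y) x
  rw [← hyu] at h4
  -- `|y|² = (Lᵀy)·x` and Cauchy–Schwarz give `a |y|⁴ ≤ 4 z p_k |y|² |x|²`, and `z ≤ a/8` makes
  -- `|y|²` at most half of `|u|² = p_k |x|²`.
  have h5 : y ⬝ᵥ y ≤ S.p k / 2 * (x ⬝ᵥ x) := by
    rcases (dotProduct_self_nonneg' y).eq_or_lt with h | h
    · rw [← h]
      exact mul_nonneg (by positivity) (dotProduct_self_nonneg' _)
    · have hxx := dotProduct_self_nonneg' x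
      refine le_of_mul_le_mul_left ?_ (mul_pos H.a_pos h)
      have h6 := mul_le_mul_of_nonneg_right h3 hxx
      have h7 := mul_le_mul_of_nonneg_left h4 H.a_pos.le
      have h8 : 0 ≤ (a / 8 - z) * (S.p k * ((y ⬝ᵥ y) * (x ⬝ᵥ x))) :=
        mul_nonneg (by linarith) (by positivity)
      nlinarith
  rw [hyy, hu, H.load_dotProduct] at h5
  linarith

theorem le_eigVal_gammaCheck (hr : ∀ k, 1 ≤ r k) (hrs : ∀ k, r k ≤ s k)
    (hz : z ≤ a / 8) (k : Fin K) (hz' : z ≤ a * (1 / 2) ^ (K + 1)) :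
    a * (1 / 2) ^ (K + 1) * S.p k ≤ eigVal (S.gammaCheck (τ k) e s k w) (r k) := by
  have hp : (0 : ℝ) < S.p k := by exact_mod_cast H.p_pos k
  refine le_eigVal (S.isHermitian_gammaCheck _ e s k w) (hr k) (S.L k) (fun x hx => ?_) fun x => ?_
  · have h1 := H.load_mulVec k x
    rw [hx, mulVec_zero] at h1
    exact (smul_eq_zero.mp h1.symm).resolve_left hp.ne'
  set v := S.L k *ᵥ x with hv
  set D := kronExcept k fun j => leading (e j) (s j) with hD
  rw [gammaCheck_eq, quadForm_sum, ← hD, ← div_eq_inv_mul, le_div_iff₀ (H.N_pos k)]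
  have h1 := energy_le S.n (X := fun u => unfold k (tucker (S.F u) S.L) * D)
    (Y := fun u => unfold k (S.Xtr (τ k) u w) * D)
    (Z := fun u => - (unfold k (S.resid (τ k) u w) * D))
    (v := v) fun t => by
      rw [S.unfold_Xtr, Matrix.add_mul, vecMul_add, vecMul_neg, add_neg_cancel_right]
  rw [energy_neg] at h1
  have hDD : D * Dᵀ = kronExcept k fun j => leading (e j) (s j) * (leading (e j) (s j))ᵀ := by
    rw [hD, kronExcept_transpose, kronExcept_mul]
  have h2 : energy S.n (fun u => unfold k (S.resid (τ k) u w) * D) v ≤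
      energy S.n (fun u => unfold k (S.resid (τ k) u w)) v := by
    rw [energy_mul, hDD]
    refine Finset.sum_le_sum fun u _ => ?_
    have h := kronExcept_mono (d := S.p) k
      (A := fun j => leading (e j) (s j) * (leading (e j) (s j))ᵀ)
      (B := fun j => 1) (fun j => IsEigenbasis.leading_posSemidef)
      (fun j => (he j).one_sub_leading_posSemidef (hsp j)) (v ᵥ* unfold k (S.resid (τ k) u w))
    have h1 : kronExcept k (fun j => (1 : Matrix (Fin (S.p j)) (Fin (S.p j)) ℝ)) = 1 := by
      simpa using kronExcept_smul_one (d := S.p) k fun _ => 1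
    rwa [h1, one_mulVec] at h
  have h3 := H.resid_le k v
  -- Each of the `K - 1` projected modes retains at least half of its loading energy `p_j`; the
  -- product of these lower bounds is `p_{-k} (1/2)^(K-1)`.
  have h4 : (S.pExcept k * (1 / 2) ^ (K - 1)) *
      energy S.n (fun u => unfold k (S.F u)) ((S.L k)ᵀ *ᵥ v) ≤
      energy S.n (fun u => unfold k (tucker (S.F u) S.L) * D) v := by
    have h5 : ∀ u, unfold k (tucker (S.F u) S.L) * D =
        S.L k * unfold k (S.F u) * ((kronExcept k S.L)ᵀ * D) := by
      intro u
      rw [unfold_tucker, Matrix.mul_assoc]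
    simp only [h5]
    rw [energy_mul, energy, Finset.mul_sum]
    refine Finset.sum_le_sum fun u _ => ?_
    have h6 : (kronExcept k S.L)ᵀ * D * ((kronExcept k S.L)ᵀ * D)ᵀ =
        kronExcept k fun j => (S.L j)ᵀ * (leading (e j) (s j) * (leading (e j) (s j))ᵀ) * S.L j := by
      rw [transpose_mul, transpose_transpose, Matrix.mul_assoc, ← Matrix.mul_assoc D, hDD,
        kronExcept_transpose, kronExcept_mul, kronExcept_mul]
      simp only [Matrix.mul_assoc]
    have h7 := kronExcept_mono (d := r) k
      (A := fun j => ((S.p j : ℝ) / 2) • (1 : Matrix (Fin (r j)) (Fin (r j)) ℝ))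
      (B := fun j => (S.L j)ᵀ * (leading (e j) (s j) * (leading (e j) (s j))ᵀ) * S.L j)
      (fun j => PosSemidef.one.smul (by positivity)) (fun j => ?_)
      (v ᵥ* (S.L k * unfold k (S.F u)))
    · rw [kronExcept_smul_one k fun j => (S.p j : ℝ) / 2, smul_mulVec, one_mulVec, dotProduct_smul,
        smul_eq_mul] at h7
      rw [h6]
      refine le_trans (le_of_eq ?_) h7
      simp only [← vecMul_vecMul, mulVec_transpose]
      congr 1
      simp only [div_eq_mul_inv, Finset.prod_mul_distrib, Finset.prod_const, pExcept, one_mul]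
      simp
    · refine .of_dotProduct_mulVec_nonneg (IsHermitian.sub ?_ (by simp [IsHermitian])) fun y => ?_
      · simpa using isHermitian_conjTranspose_mul_mul (S.L j)
          (IsEigenbasis.leading_posSemidef (e := e j) (s := s j)).1
      · have := H.sub_leading_load_le he hsp hrs hz j y
        rw [sub_mulVec, dotProduct_sub, star_trivial, smul_mulVec, one_mulVec, dotProduct_smul,
          smul_eq_mul, ← mulVec_mulVec, ← mulVec_mulVec, dotProduct_mulVec y, vecMul_transpose]
        linarith
  have h8 := H.le_gammaF k ((S.L k)ᵀ *ᵥ v)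
  have hn : (0 : ℝ) < S.n := by exact_mod_cast H.n_pos
  have h11 : ((S.L k)ᵀ *ᵥ v) ⬝ᵥ ((S.L k)ᵀ *ᵥ v) = S.p k * (v ⬝ᵥ v) := by
    rw [hv, H.load_mulVec, smul_dotProduct, dotProduct_smul, H.load_dotProduct, smul_eq_mul,
      smul_eq_mul]
  rw [gammaF_quadForm, ← div_eq_inv_mul, le_div_iff₀ hn, h11] at h8
  -- The spare factor 4 pays for the residual: with `κ = a (1/2)^(K+1)`, signal at least `4κ` and
  -- residual at most `κ` leave at least `(4κ - 2κ)/2 = κ` for the data.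
  have hK : (1 / 2 : ℝ) ^ (K - 1) = 4 * (1 / 2) ^ (K + 1) := by
    obtain ⟨q, hq⟩ := Nat.exists_eq_add_of_le' (Fin.pos k)
    have : K - 1 = q := by omega
    rw [this, hq, pow_add, pow_add]
    norm_num
    ring
  have h9 := mul_le_mul_of_nonneg_left h8
    (mul_pos (H.pExcept_pos k) (pow_pos one_half_pos (K - 1))).le
  rw [hK] at h4 h9
  have h10 : 0 ≤ (a * (1 / 2) ^ (K + 1) - z) * (S.n * S.pExcept k * (S.p k * (v ⬝ᵥ v))) :=
    mul_nonneg (by linarith) (mul_nonneg (H.N_pos k).le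
      (mul_nonneg hp.le (dotProduct_self_nonneg' _)))
  nlinarith

end

theorem eigVal_gammaCheck_nonneg (e : ∀ j, Fin (S.p j) → Fin (S.p j) → ℝ) (s : Fin K → ℕ)
    (k : Fin K) (t : ℝ) (j : ℕ) : 0 ≤ eigVal (S.gammaCheck t e s k w) j := by
  refine eigVal_nonneg (S.isHermitian_gammaCheck _ e s k w) (fun v => ?_) j
  rw [gammaCheck_eq, quadForm_sum]
  exact mul_nonneg (inv_nonneg.mpr (H.N_pos k).le) (energy_nonneg _ _ _)

end Setup
end Model

/-- The maximiser of the penalised ratios is the position of the gap. -/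
theorem eq_of_ratio_max {μ : ℕ → ℝ} {r q j : ℕ} {ρ c B C : ℝ} (hμ : ∀ j, 0 ≤ μ j)
    (hB : ∀ j, 1 ≤ j → μ j ≤ B) (hr : 1 ≤ r) (hc : 0 < c)
    (hlow : ∀ j, 1 ≤ j → j ≤ r → c ≤ μ j) (hρ : 0 < ρ)
    (hhigh : ∀ j, r + 1 ≤ j → μ j ≤ C * ρ) (hC : 0 ≤ C)
    (hsmall : (B / c) * ((C + 1) * ρ) < c) (hsmall' : C * ((C + 1) * ρ) < c)
    (hrq : r ≤ q) (hj : j ∈ Finset.Icc 1 q)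
    (hmax : ∀ i ∈ Finset.Icc 1 q, μ i / (μ (i + 1) + ρ) ≤ μ j / (μ (j + 1) + ρ)) : j = r := by
  have h1 := hmax r (Finset.mem_Icc.mpr ⟨hr, hrq⟩)
  have h2 : c / ((C + 1) * ρ) ≤ μ r / (μ (r + 1) + ρ) := by
    have h3 := hhigh (r + 1) le_rfl
    have h4 := hμ (r + 1)
    refine div_le_div₀ (hμ r) (hlow r hr le_rfl) (by linarith) (by linarith)
  have hCρ : 0 < (C + 1) * ρ := by positivity
  obtain ⟨hj1, hj2⟩ := Finset.mem_Icc.mp hj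
  -- Before the gap, numerator and denominator are both of order one, so the ratio is at most `B /
  -- c`. After it, the numerator is at most `C * ρ` and the denominator at least `ρ`, so the ratio
  -- is at most `C`. Both lie below the lower bound at `r`.
  rcases lt_trichotomy j r with h | h | h
  · exfalso
    have h3 : μ j / (μ (j + 1) + ρ) ≤ B / c :=
      div_le_div₀ ((hμ j).trans (hB j hj1)) (hB j hj1) hc (by
        linarith [hlow (j + 1) (by omega) (by omega)])
    rw [← lt_div_iff₀ hCρ] at hsmall
    linarith
  · exact h
  · exfalso
    have h3 : μ j / (μ (j + 1) + ρ) ≤ C := by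
      rw [div_le_iff₀ (by linarith [hμ (j + 1)])]
      have := mul_nonneg hC (hμ (j + 1))
      linarith [hhigh j h]
    rw [← lt_div_iff₀ hCρ] at hsmall'
    linarith

namespace Model

variable {K : ℕ} {r : Fin K → ℕ} {Ω : Type*} {S : Model K r Ω}

/-- On the event that the residuals are small, one step of the procedure finds the factor
numbers. -/
theorem Setup.rhat_eq {a b C ρ : ℝ} {τ : Fin K → ℝ} {w : Ω} (H : S.Setup a b (C * ρ) τ w)
    (hr : ∀ k, 1 ≤ r k) {e : Ω → ∀ j, Fin (S.p j) → Fin (S.p j) → ℝ}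
    (he : ∀ k, IsEigenbasis (S.gammaHat (τ k) k w) (e w k)) {rbar : Fin K → ℕ}
    {rhat : ℕ → Ω → Fin K → ℕ} (hrun : S.IsRun τ ρ rbar e rhat)
    (hrbar : ∀ k, rbar k + 1 ≤ S.p k) (hρ : 0 < ρ) (hC : 0 ≤ C) {m : ℕ}
    (hprev : ∀ k, r k ≤ rhat m w k ∧ rhat m w k ≤ rbar k) (hz : C * ρ ≤ a / 8)
    (hz' : C * ρ ≤ a * (1 / 2) ^ (K + 1))
    (h1 : (2 * (b + C * ρ)) / (a * (1 / 2) ^ (K + 1)) * ((C + 1) * ρ) < a * (1 / 2) ^ (K + 1))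
    (h2 : C * ((C + 1) * ρ) < a * (1 / 2) ^ (K + 1)) (k : Fin K) :
    rhat (m + 1) w k = r k := by
  have hp : (0 : ℝ) < S.p k := by exact_mod_cast H.p_pos k
  have hsp : ∀ k, rhat m w k ≤ S.p k := fun k => by
    have := hprev k
    have := hrbar k
    omega
  have hlow := H.le_eigVal_gammaCheck he hsp hr (fun k => (hprev k).1) hz k hz'
  refine eq_of_ratio_max
    (μ := fun j => eigVal (S.gammaCheck (τ k) (e w) (rhat m w) k w) j / S.p k)
    (fun j => div_nonneg (H.eigVal_gammaCheck_nonneg _ _ _ _ _) hp.le)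
    (fun j hj => ?_) (hr k) (mul_pos H.a_pos (by positivity)) (fun j hj hjr => ?_) hρ
    (fun j hj => ?_) hC h1 h2 ((hprev k).1.trans (hprev k).2) (hrun m w k).1 (hrun m w k).2
  · rw [div_le_iff₀ hp]
    exact H.eigVal_gammaCheck_le' he hsp k hj
  · rw [le_div_iff₀ hp]
    exact hlow.trans (eigVal_antitone _ hj hjr ((hprev k).1.trans (hsp k)))
  · rw [div_le_iff₀ hp]
    exact H.eigVal_gammaCheck_le he hsp k hj

end Model

end TensorFactor

namespace TensorFactor

/-! ### Covariance inequalities under strong mixing -/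

section covariance

variable {Ω : Type*} {𝒜 ℬ : MeasurableSpace Ω} [m0 : MeasurableSpace Ω] {P : Measure Ω} [IsProbabilityMeasure P]

theorem abs_le_of_alphaMix_le {δ : ℝ} (h : alphaMix P 𝒜 ℬ ≤ δ)
    {A B : Set Ω} (hA : MeasurableSet[𝒜] A) (hB : MeasurableSet[ℬ] B) :
    |P.real (A ∩ B) - P.real A * P.real B| ≤ δ := by
  refine le_trans (le_csSup ?_ (by exact ⟨A, B, hA, hB, rfl⟩)) h
  -- A real `sSup` dominates its elements only if the set is bounded above; 1 is a bound.
  refine ⟨1, ?_⟩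
  rintro _ ⟨A, B, -, -, rfl⟩
  have h1 : P.real (A ∩ B) ≤ 1 := measureReal_le_one
  have h2 : 0 ≤ P.real (A ∩ B) := measureReal_nonneg
  have h3 : P.real A ≤ 1 := measureReal_le_one
  have h4 : P.real B ≤ 1 := measureReal_le_one
  have h5 : 0 ≤ P.real A := measureReal_nonneg
  have h6 : 0 ≤ P.real B := measureReal_nonneg
  rw [abs_le]
  constructor <;> nlinarith

theorem memLp_of_bound {X : Ω → ℝ} (hX : Measurable X) {a : ℝ} (ha : ∀ w, |X w| ≤ a)
    (q : ENNReal) : MemLp X q P :=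
  MemLp.of_bound hX.aestronglyMeasurable a (ae_of_all _ ha)

theorem integrable_of_bound {X : Ω → ℝ} (hX : Measurable X) {a : ℝ} (ha : ∀ w, |X w| ≤ a) :
    Integrable X P :=
  Integrable.of_bound hX.aestronglyMeasurable a (ae_of_all _ ha)

/-- Replacing `W` by its conditional expectation `g` given `𝒜` leaves the integral unchanged, and
`E|g|` is the difference of the integrals of `W` over `{g ≥ 0}` and over its complement, both of
which are sets in `𝒜`. -/
theorem abs_integral_mul_le (hm : 𝒜 ≤ m0) {X W : Ω → ℝ}
    (hX : Measurable[𝒜] X) {a δ : ℝ} (ha : ∀ w, |X w| ≤ a) (hW : Integrable W P)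
    (hδ : ∀ A, MeasurableSet[𝒜] A → |∫ w in A, W w ∂P| ≤ δ) :
    |∫ w, X w * W w ∂P| ≤ 2 * a * δ := by
  have ha0 : 0 ≤ a := by
    obtain ⟨w⟩ := P.nonempty_of_neZero
    exact (abs_nonneg _).trans (ha w)
  have hXW : Integrable (X * W) P :=
    hW.bdd_mul (hX.mono hm le_rfl).aestronglyMeasurable (ae_of_all _ ha)
  set g := P[W|𝒜] with hg
  have hgm : StronglyMeasurable[𝒜] g := stronglyMeasurable_condExp
  have hgi : Integrable g P := integrable_condExp
  have h1 : ∫ w, X w * W w ∂P = ∫ w, X w * g w ∂P := by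
    have h2 := condExp_mul_of_stronglyMeasurable_left hX.stronglyMeasurable hXW hW
    have h3 := integral_condExp (μ := P) hm (f := X * W)
    rw [integral_congr_ae h2] at h3
    exact h3.symm
  have h4 : |∫ w, X w * g w ∂P| ≤ a * ∫ w, |g w| ∂P := by
    refine (abs_integral_le_integral_abs).trans ?_
    rw [← integral_const_mul]
    refine integral_mono_of_nonneg (ae_of_all _ fun _ => abs_nonneg _) (hgi.abs.const_mul a)
      (ae_of_all _ fun w => ?_)
    simp only [abs_mul]
    exact mul_le_mul_of_nonneg_right (ha w) (abs_nonneg _)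
  have hA : MeasurableSet[𝒜] {w | 0 ≤ g w} :=
    hgm.measurable measurableSet_Ici
  have h5 : ∫ w, |g w| ∂P ≤ δ + δ := by
    rw [← integral_add_compl (hm _ hA) hgi.abs]
    have h6 : ∫ w in {w | 0 ≤ g w}, |g w| ∂P = ∫ w in {w | 0 ≤ g w}, W w ∂P := by
      rw [← setIntegral_condExp hm hW hA]
      exact setIntegral_congr_fun (hm _ hA) fun w hw => abs_of_nonneg hw
    have h7 : ∫ w in {w | 0 ≤ g w}ᶜ, |g w| ∂P = - ∫ w in {w | 0 ≤ g w}ᶜ, W w ∂P := by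
      rw [← setIntegral_condExp hm hW hA.compl, ← integral_neg]
      exact setIntegral_congr_fun (hm _ hA.compl) fun w hw =>
        abs_of_neg (not_le.mp hw)
    rw [h6, h7]
    have h8 := abs_le.mp (hδ _ hA)
    have h9 := abs_le.mp (hδ _ hA.compl)
    linarith
  rw [h1]
  calc _ ≤ _ := h4
    _ ≤ a * (δ + δ) := mul_le_mul_of_nonneg_left h5 ha0
    _ = 2 * a * δ := by ring

theorem covariance_eq_integral_mul_sub {X Y : Ω → ℝ} (hX : Integrable X P) (hY : Integrable Y P)
    (hXY : Integrable (fun w => X w * Y w) P) :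
    cov[X, Y; P] = ∫ w, X w * (Y w - ∫ v, Y v ∂P) ∂P := by
  rw [covariance]
  have h1 : ∀ w, (X w - P[X]) * (Y w - P[Y]) =
      X w * (Y w - P[Y]) - P[X] * (Y w - P[Y]) := fun w => by ring
  simp_rw [h1]
  have hYc : Integrable (fun w => Y w - P[Y]) P := hY.sub (integrable_const _)
  rw [integral_sub _ (hYc.const_mul _), integral_const_mul, integral_sub hY (integrable_const _)]
  · simp
  · simp only [mul_sub]
    exact hXY.sub (hX.mul_const _)

/-- The covariance inequality for bounded variables. -/
theorem abs_covariance_le_of_alphaMix (h𝒜 : 𝒜 ≤ m0) (hℬ : ℬ ≤ m0)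
    {δ : ℝ} (h : alphaMix P 𝒜 ℬ ≤ δ) {X Y : Ω → ℝ} (hX : Measurable[𝒜] X) (hY : Measurable[ℬ] Y)
    {a b : ℝ} (ha : ∀ w, |X w| ≤ a) (hb : ∀ w, |Y w| ≤ b) :
    |cov[X, Y; P]| ≤ 4 * a * b * δ := by
  have hX' : Measurable X := hX.mono h𝒜 le_rfl
  have hY' : Measurable Y := hY.mono hℬ le_rfl
  have hXi : Integrable X P := integrable_of_bound hX' ha
  have hYi : Integrable Y P := integrable_of_bound hY' hb
  rw [covariance_eq_integral_mul_sub hXi hYi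
    (hYi.bdd_mul hX'.aestronglyMeasurable (ae_of_all _ ha))]
  have := abs_integral_mul_le (P := P) h𝒜 hX (W := fun w => Y w - ∫ v, Y v ∂P) (δ := 2 * b * δ) ha
    (hYi.sub (integrable_const _)) fun A hA => ?_
  · linarith
  have hA' := h𝒜 _ hA
  -- This integral tests `Y` against a centred indicator, so the same lemma applies with `𝒜` and `ℬ`
  -- exchanged. What remains is `P(A ∩ B) - P(A) P(B)`.
  have h1 : ∫ w in A, (Y w - ∫ v, Y v ∂P) ∂P =
      ∫ w, Y w * (A.indicator (fun _ => (1 : ℝ)) w - P.real A) ∂P := by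
    have h2 : ∀ w, Y w * (A.indicator (fun _ => (1 : ℝ)) w - P.real A) =
        A.indicator Y w - Y w * P.real A := by
      intro w
      by_cases hw : w ∈ A <;> simp [hw]
      ring
    simp_rw [h2]
    rw [integral_sub hYi.integrableOn (integrable_const _), setIntegral_const,
      integral_sub (hYi.indicator hA') (hYi.mul_const _), integral_indicator hA', integral_mul_const,
      smul_eq_mul]
    ring
  rw [h1]
  refine abs_integral_mul_le hℬ hY hb
    (((integrable_const (1 : ℝ)).indicator hA').sub (integrable_const _)) fun B hB => ?_
  have hB' := hℬ _ hB
  rw [integral_sub ((integrable_const (1 : ℝ)).indicator hA').integrableOn (integrable_const _),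
    setIntegral_const, setIntegral_indicator hA', setIntegral_const, smul_eq_mul, smul_eq_mul,
    mul_one, Set.inter_comm, mul_comm (P.real B)]
  exact abs_le_of_alphaMix_le h hA hB

/-- Cauchy–Schwarz in weighted arithmetic-mean form; the free weight `t` balances a variable of
order one against a small one. -/
theorem abs_covariance_le {U V : Ω → ℝ} (hU : MemLp U 2 P) (hV : MemLp V 2 P) {t : ℝ}
    (ht : 0 < t) :
    |cov[U, V; P]| ≤ (t * ∫ w, U w ^ 2 ∂P + t⁻¹ * ∫ w, V w ^ 2 ∂P) / 2 := by
  have h1 : ∀ {X : Ω → ℝ}, MemLp X 2 P → ∫ w, (X w - P[X]) ^ 2 ∂P ≤ ∫ w, X w ^ 2 ∂P := by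
    intro X hX
    rw [← variance_eq_integral hX.aemeasurable]
    exact variance_le_expectation_sq hX.aestronglyMeasurable
  have hU' : Integrable (fun w => (U w - P[U]) ^ 2) P := (hU.sub (memLp_const _)).integrable_sq
  have hV' : Integrable (fun w => (V w - P[V]) ^ 2) P := (hV.sub (memLp_const _)).integrable_sq
  have h2 : |cov[U, V; P]| ≤
      ∫ w, (t * (U w - P[U]) ^ 2 + t⁻¹ * (V w - P[V]) ^ 2) / 2 ∂P := by
    refine abs_integral_le_integral_abs.trans ?_
    refine integral_mono_of_nonneg (ae_of_all _ fun _ => abs_nonneg _)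
      (((hU'.const_mul t).add (hV'.const_mul t⁻¹)).div_const 2) (ae_of_all _ fun w => ?_)
    simp only [abs_mul]
    have h3 : |U w - P[U]| ^ 2 = (U w - P[U]) ^ 2 := sq_abs _
    have h4 : |V w - P[V]| ^ 2 = (V w - P[V]) ^ 2 := sq_abs _
    rw [← h3, ← h4]
    have h5 : t * t⁻¹ = 1 := mul_inv_cancel₀ ht.ne'
    have h6 : t * |U w - P[U]| ^ 2 + t⁻¹ * |V w - P[V]| ^ 2 - 2 * (|U w - P[U]| * |V w - P[V]|) =
        t * (|U w - P[U]| - t⁻¹ * |V w - P[V]|) ^ 2 := by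
      field_simp
      ring
    have h7 : 0 ≤ t * (|U w - P[U]| - t⁻¹ * |V w - P[V]|) ^ 2 := by positivity
    linarith
  rw [integral_div, integral_add (hU'.const_mul t) (hV'.const_mul t⁻¹), integral_const_mul,
    integral_const_mul] at h2
  have h8 := mul_le_mul_of_nonneg_left (h1 hU) ht.le
  have h9 := mul_le_mul_of_nonneg_left (h1 hV) (inv_pos.mpr ht).le
  linarith

/-- A bounded random variable with a bound for its absolute moment of order `2 + 2ε`. -/
structure MomentBound (P : Measure Ω) (ε Q b : ℝ) (X : Ω → ℝ) : Prop where
  measurable : Measurable X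
  bound : ∀ w, |X w| ≤ b
  moment : ∫ w, |X w| ^ (2 + 2 * ε) ∂P ≤ Q

namespace MomentBound

variable {ε Q b : ℝ} {X Y : Ω → ℝ} (hε : 0 < ε)
include hε

omit [IsProbabilityMeasure P] in
theorem integrable_rpow [IsFiniteMeasure P] (h : MomentBound P ε Q b X) :
    Integrable (fun w => |X w| ^ (2 + 2 * ε)) P := by
  refine Integrable.of_bound (h.measurable.abs.pow_const _).aestronglyMeasurable
    (b ^ (2 + 2 * ε)) (ae_of_all _ fun w => ?_)
  rw [Real.norm_eq_abs, abs_of_nonneg (Real.rpow_nonneg (abs_nonneg _) _)]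
  exact Real.rpow_le_rpow (abs_nonneg _) (h.bound w) (by linarith)

omit [IsProbabilityMeasure P] hε in
theorem Q_nonneg (h : MomentBound P ε Q b X) : 0 ≤ Q :=
  (integral_nonneg fun _ => Real.rpow_nonneg (abs_nonneg _) _).trans h.moment

theorem integral_sq_le (h : MomentBound P ε Q b X) : ∫ w, X w ^ 2 ∂P ≤ 1 + Q := by
  have h1 : ∫ w, X w ^ 2 ∂P ≤ ∫ w, (1 + |X w| ^ (2 + 2 * ε)) ∂P := by
    refine integral_mono_of_nonneg (ae_of_all _ fun _ => sq_nonneg _)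
      ((integrable_const _).add (h.integrable_rpow hε)) (ae_of_all _ fun w => ?_)
    dsimp only
    rw [← sq_abs]
    rcases le_total |X w| 1 with h2 | h2
    · have h3 := Real.rpow_nonneg (abs_nonneg (X w)) (2 + 2 * ε)
      nlinarith [abs_nonneg (X w)]
    · have h3 : |X w| ^ (2 : ℝ) ≤ |X w| ^ (2 + 2 * ε) :=
        Real.rpow_le_rpow_of_exponent_le h2 (by linarith)
      rw [Real.rpow_two] at h3
      linarith
  rw [integral_add (integrable_const _) (h.integrable_rpow hε)] at h1
  simp only [integral_const, probReal_univ, smul_eq_mul, one_mul] at h1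
  linarith [h.moment]

theorem integral_tail_le (h : MomentBound P ε Q b X) {a : ℝ} (ha : 0 < a) :
    ∫ w, (if |X w| ≤ a then 0 else X w) ^ 2 ∂P ≤ a ^ (-(2 * ε)) * Q := by
  refine le_trans ?_ (mul_le_mul_of_nonneg_left h.moment (Real.rpow_nonneg ha.le _))
  rw [← integral_const_mul]
  refine integral_mono_of_nonneg (ae_of_all _ fun _ => sq_nonneg _)
    ((h.integrable_rpow hε).const_mul _) (ae_of_all _ fun w => ?_)
  dsimp only
  split_ifs with hw
  · have := Real.rpow_nonneg (abs_nonneg (X w)) (2 + 2 * ε)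
    have := Real.rpow_nonneg ha.le (-(2 * ε))
    rw [zero_pow two_ne_zero]
    positivity
  · have hw' := not_le.mp hw
    have hX : 0 < |X w| := ha.trans hw'
    rw [Real.rpow_add hX, Real.rpow_two, sq_abs, Real.rpow_neg ha.le, inv_mul_eq_div,
      le_div_iff₀ (Real.rpow_pos_of_pos ha _)]
    exact mul_le_mul_of_nonneg_left (Real.rpow_le_rpow ha.le hw'.le (by linarith)) (sq_nonneg _)

theorem integral_pow_four_le (h : MomentBound P ε Q b X) (hε1 : ε < 1) :
    ∫ w, X w ^ 4 ∂P ≤ b ^ (2 - 2 * ε) * Q := by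
  have hb : 0 ≤ b := by
    obtain ⟨w⟩ := P.nonempty_of_neZero
    exact (abs_nonneg _).trans (h.bound w)
  refine le_trans ?_ (mul_le_mul_of_nonneg_left h.moment (Real.rpow_nonneg hb _))
  rw [← integral_const_mul]
  refine integral_mono_of_nonneg (ae_of_all _ fun _ => by positivity)
    ((h.integrable_rpow hε).const_mul _) (ae_of_all _ fun w => ?_)
  dsimp only
  have h1 : X w ^ 4 = |X w| ^ (2 - 2 * ε) * |X w| ^ (2 + 2 * ε) := by
    rw [← Real.rpow_add_of_nonneg (abs_nonneg _) (by linarith) (by linarith)]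
    have : 2 - 2 * ε + (2 + 2 * ε) = (4 : ℕ) := by push_cast; ring
    rw [this, Real.rpow_natCast, Even.pow_abs (by decide)]
  rw [h1]
  exact mul_le_mul_of_nonneg_right (Real.rpow_le_rpow (abs_nonneg _) (h.bound w) (by linarith))
    (Real.rpow_nonneg (abs_nonneg _) _)

/-- The second moment of a product. -/
theorem integral_mul_sq_le (hX : MomentBound P ε Q b X) (hY : MomentBound P ε Q b Y)
    (hε1 : ε < 1) : ∫ w, (X w * Y w) ^ 2 ∂P ≤ b ^ (2 - 2 * ε) * Q := by
  have hi : ∀ {Z : Ω → ℝ}, MomentBound P ε Q b Z → Integrable (fun w => Z w ^ 4) P := by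
    intro Z hZ
    refine integrable_of_bound (hZ.measurable.pow_const 4) (a := b ^ 4) fun w => ?_
    rw [abs_pow]
    exact pow_le_pow_left₀ (abs_nonneg _) (hZ.bound w) 4
  have h1 : ∫ w, (X w * Y w) ^ 2 ∂P ≤ ∫ w, (X w ^ 4 + Y w ^ 4) / 2 ∂P := by
    refine integral_mono_of_nonneg (ae_of_all _ fun _ => sq_nonneg _)
      (((hi hX).add (hi hY)).div_const 2) (ae_of_all _ fun w => ?_)
    dsimp only
    nlinarith [sq_nonneg (X w ^ 2 - Y w ^ 2)]
  rw [integral_div, integral_add (hi hX) (hi hY)] at h1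
  have := hX.integral_pow_four_le hε hε1
  have := hY.integral_pow_four_le hε hε1
  linarith

omit [IsProbabilityMeasure P] hε in
theorem bound_mul (hX : MomentBound P ε Q b X) (hY : MomentBound P ε Q b Y) (w : Ω) :
    |X w * Y w| ≤ b ^ 2 := by
  rw [abs_mul, sq]
  exact mul_le_mul (hX.bound w) (hY.bound w) (abs_nonneg _) ((abs_nonneg _).trans (hX.bound w))

/-- Only the powers beyond `2 + 2ε` are paid for by the bound, giving `b^(2-2ε)` where boundedness
alone would give `b⁴`. The rate of the fluctuations depends on this saving. -/
theorem abs_covariance_mul_le {X' Y' : Ω → ℝ} (hX : MomentBound P ε Q b X)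
    (hY : MomentBound P ε Q b Y) (hX' : MomentBound P ε Q b X') (hY' : MomentBound P ε Q b Y')
    (hε1 : ε < 1) :
    |cov[fun w => X w * Y w, fun w => X' w * Y' w; P]| ≤ b ^ (2 - 2 * ε) * Q := by
  have h := abs_covariance_le
    (memLp_of_bound (P := P) (hX.measurable.mul hY.measurable) (hX.bound_mul hY) 2)
    (memLp_of_bound (P := P) (hX'.measurable.mul hY'.measurable) (hX'.bound_mul hY') 2)
    one_pos
  have h1 := hX.integral_mul_sq_le hε hY hε1
  have h2 := hX'.integral_mul_sq_le hε hY' hε1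
  simp only [inv_one, one_mul, Pi.mul_apply] at h
  exact h.trans (by linarith)

theorem abs_covariance_le_one_add (hX : MomentBound P ε Q b X) (hY : MomentBound P ε Q b Y) :
    |cov[X, Y; P]| ≤ 1 + Q := by
  have h := abs_covariance_le (memLp_of_bound (P := P) hX.measurable hX.bound 2)
    (memLp_of_bound (P := P) hY.measurable hY.bound 2) one_pos
  have h1 := hX.integral_sq_le hε
  have h2 := hY.integral_sq_le hε
  simp only [inv_one, one_mul] at h
  exact h.trans (by linarith)

/-- A covariance inequality for variables with moments of order `2 + 2ε`. -/
theorem abs_covariance_le_exp (h𝒜 : 𝒜 ≤ m0) (hℬ : ℬ ≤ m0)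
    {c m : ℝ} (hcm : 0 ≤ c * m) (hε1 : ε < 1) (h : alphaMix P 𝒜 ℬ ≤ Real.exp (-(c * m)))
    (hX𝒜 : Measurable[𝒜] X) (hYℬ : Measurable[ℬ] Y) (hX : MomentBound P ε Q b X)
    (hY : MomentBound P ε Q b Y) :
    |cov[X, Y; P]| ≤ (5 + 2 * Q) * Real.exp (-(ε * c / 4 * m)) := by
  -- Both variables are split at level `a`. The bounded parts contribute `4 a² e^(-cm) = 4
  -- e^(-cm/2)`, and the tails have second moment at most `a^(-2ε) Q = t² Q`, so weighting
  -- Cauchy–Schwarz by `t` makes every term of order `t`.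
  set a := Real.exp (c * m / 4) with ha
  have ha0 : 0 < a := Real.exp_pos _
  set t := Real.exp (-(ε * c / 4 * m)) with ht
  have ht0 : 0 < t := Real.exp_pos _
  have hat : a ^ (-(2 * ε)) = t ^ 2 := by
    rw [ha, ht, ← Real.exp_mul, sq, ← Real.exp_add]
    congr 1
    ring
  let f : ℝ → ℝ := fun x => if |x| ≤ a then x else 0
  let g : ℝ → ℝ := fun x => if |x| ≤ a then 0 else x
  have hf : Measurable f :=
    Measurable.ite (measurableSet_le measurable_id.abs measurable_const) measurable_id
      measurable_const
  have hg : Measurable g :=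
    Measurable.ite (measurableSet_le measurable_id.abs measurable_const) measurable_const
      measurable_id
  have hfg : ∀ x, x = f x + g x := fun x => by
    simp only [f, g]; split_ifs <;> simp
  have hfa : ∀ x, |f x| ≤ a := fun x => by
    simp only [f]; split_ifs with h
    · exact h
    · simpa using ha0.le
  have hfx : ∀ x, |f x| ≤ |x| := fun x => by
    simp only [f]; split_ifs <;> simp
  have hgx : ∀ x, |g x| ≤ |x| := fun x => by
    simp only [g]; split_ifs <;> simp
  have hf2 : ∀ {Z : Ω → ℝ}, MomentBound P ε Q b Z → MemLp (fun w => f (Z w)) 2 P := fun hZ =>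
    memLp_of_bound (hf.comp hZ.measurable) (a := b) (fun w => (hfx _).trans (hZ.bound w)) 2
  have hg2 : ∀ {Z : Ω → ℝ}, MomentBound P ε Q b Z → MemLp (fun w => g (Z w)) 2 P := fun hZ =>
    memLp_of_bound (hg.comp hZ.measurable) (a := b) (fun w => (hgx _).trans (hZ.bound w)) 2
  have hY2 : MemLp Y 2 P := memLp_of_bound hY.measurable hY.bound 2
  have hdec : cov[X, Y; P] = cov[fun w => f (X w), fun w => f (Y w); P] +
      cov[fun w => f (X w), fun w => g (Y w); P] + cov[fun w => g (X w), Y; P] := by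
    have h1 : X = (fun w => f (X w)) + fun w => g (X w) := funext fun w => hfg _
    have h2 : Y = (fun w => f (Y w)) + fun w => g (Y w) := funext fun w => hfg _
    conv_lhs => rw [h1]
    rw [covariance_add_left (hf2 hX) (hg2 hX) hY2]
    conv_lhs => enter [1]; rw [h2]
    rw [covariance_add_right (hf2 hX) (hf2 hY) (hg2 hY)]
  have h1 : |cov[fun w => f (X w), fun w => f (Y w); P]| ≤ 4 * t := by
    refine (abs_covariance_le_of_alphaMix h𝒜 hℬ h (hf.comp hX𝒜) (hf.comp hYℬ)
      (fun w => hfa _) (fun w => hfa _)).trans ?_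
    have h2 : 4 * a * a * Real.exp (-(c * m)) = 4 * Real.exp (-(c * m / 2)) := by
      rw [ha, mul_assoc 4, ← Real.exp_add, mul_assoc, ← Real.exp_add]
      congr 2
      ring
    rw [h2]
    refine mul_le_mul_of_nonneg_left (Real.exp_le_exp.mpr ?_) (by norm_num)
    nlinarith
  have hQ := hX.Q_nonneg
  have h2 : |cov[fun w => f (X w), fun w => g (Y w); P]| ≤ (1 + 2 * Q) / 2 * t := by
    refine (abs_covariance_le (hf2 hX) (hg2 hY) ht0).trans ?_
    have h3 : ∫ w, f (X w) ^ 2 ∂P ≤ 1 + Q := by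
      refine le_trans (integral_mono_of_nonneg (ae_of_all _ fun _ => sq_nonneg _)
        (memLp_of_bound (P := P) hX.measurable hX.bound 2).integrable_sq
        (ae_of_all _ fun w => ?_)) (hX.integral_sq_le hε)
      exact sq_le_sq.mpr (hfx _)
    have h4 : ∫ w, g (Y w) ^ 2 ∂P ≤ t ^ 2 * Q := hat ▸ hY.integral_tail_le hε ha0
    have h5 := mul_le_mul_of_nonneg_left h3 ht0.le
    have h6 := mul_le_mul_of_nonneg_left h4 (inv_pos.mpr ht0).le
    have h7 : t⁻¹ * (t ^ 2 * Q) = t * Q := by field_simp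
    linarith
  have h3 : |cov[fun w => g (X w), Y; P]| ≤ (1 + 2 * Q) / 2 * t := by
    rw [covariance_comm]
    refine (abs_covariance_le hY2 (hg2 hX) ht0).trans ?_
    have h3 := hY.integral_sq_le hε
    have h4 : ∫ w, g (X w) ^ 2 ∂P ≤ t ^ 2 * Q := hat ▸ hX.integral_tail_le hε ha0
    have h5 := mul_le_mul_of_nonneg_left h3 ht0.le
    have h6 := mul_le_mul_of_nonneg_left h4 (inv_pos.mpr ht0).le
    have h7 : t⁻¹ * (t ^ 2 * Q) = t * Q := by field_simp
    linarith
  rw [hdec]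
  refine (abs_add_le _ _).trans ?_
  have := abs_add_le (cov[fun w => f (X w), fun w => f (Y w); P])
    (cov[fun w => f (X w), fun w => g (Y w); P])
  linarith

end MomentBound

end covariance

/-! ### Sums of exponentials -/

theorem sum_exp_neg_nat_le {a : ℝ} (ha : 0 < a) (s : Finset ℕ) :
    ∑ x ∈ s, Real.exp (-(a * x)) ≤ 1 + 1 / a := by
  have h0 : ∀ x : ℕ, Real.exp (-(a * x)) = Real.exp (-a) ^ x := fun x => by
    rw [← Real.exp_nat_mul]; congr 1; ring
  have h1 : Real.exp (-a) < 1 := Real.exp_zero ▸ Real.exp_lt_exp.mpr (by linarith)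
  simp_rw [h0]
  refine ((summable_geometric_of_lt_one (Real.exp_pos _).le h1).sum_le_tsum s
    fun _ _ => by positivity).trans ?_
  rw [tsum_geometric_of_lt_one (Real.exp_pos _).le h1]
  have h2 : a + 1 ≤ Real.exp a := Real.add_one_le_exp a
  have h3 : Real.exp (-a) ≤ 1 / (a + 1) := by
    rw [Real.exp_neg, ← one_div]
    exact one_div_le_one_div_of_le (by linarith) h2
  have h4 : a / (a + 1) ≤ 1 - Real.exp (-a) := by
    have : a / (a + 1) = 1 - 1 / (a + 1) := by field_simp; ring
    linarith
  calc (1 - Real.exp (-a))⁻¹ ≤ (a / (a + 1))⁻¹ := inv_anti₀ (by positivity) h4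
    _ = 1 + 1 / a := by field_simp

theorem sum_exp_neg_int_le {a : ℝ} (ha : 0 < a) (c : ℤ) (s : Finset ℤ) :
    ∑ x ∈ s, Real.exp (-(a * (c - x).natAbs)) ≤ 2 * (1 + 1 / a) := by
  classical
  rw [← Finset.sum_filter_add_sum_filter_not s fun x => c ≤ x, two_mul]
  have key : ∀ u : Finset ℤ, Set.InjOn (fun x => (c - x).natAbs) u →
      ∑ x ∈ u, Real.exp (-(a * (c - x).natAbs)) ≤ 1 + 1 / a := by
    intro u hu
    have := Finset.sum_image (f := fun x : ℕ => Real.exp (-(a * x))) hu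
    rw [← this]
    exact sum_exp_neg_nat_le ha _
  refine add_le_add (key _ fun x hx y hy hxy => ?_) (key _ fun x hx y hy hxy => ?_)
  · simp only [Finset.coe_filter, Set.mem_ofPred_eq] at hx hy hxy
    omega
  · simp only [Finset.coe_filter, Set.mem_ofPred_eq] at hx hy hxy
    omega

/-- Interpolation of a flat bound with a decaying bound that starts a factor `e^L` too high. Up to
`y = L` the flat one suffices; beyond it `L - y = L (1 - y/L) ≤ 1 - y/L`. The decay is slowed by the
factor `L`, the source of the logarithms. -/
theorem le_mul_exp_of_le {x A C L y : ℝ} (hA : 0 ≤ A) (hC : 1 ≤ C) (hL : 1 ≤ L)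
    (h1 : x ≤ A) (h2 : x ≤ A * C * Real.exp (L - y)) :
    x ≤ A * C * Real.exp (1 - y / L) := by
  have hL0 : 0 < L := by linarith
  rcases le_total y L with h | h
  · have h3 : 1 ≤ Real.exp (1 - y / L) :=
      Real.one_le_exp (by rw [sub_nonneg, div_le_one hL0]; exact h)
    have h4 : 1 ≤ C * Real.exp (1 - y / L) := one_le_mul_of_one_le_of_one_le hC h3
    calc x ≤ A * 1 := by linarith
      _ ≤ A * (C * Real.exp (1 - y / L)) := mul_le_mul_of_nonneg_left h4 hA
      _ = _ := by ring
  · refine h2.trans (mul_le_mul_of_nonneg_left (Real.exp_le_exp.mpr ?_) (by positivity))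
    have h3 : 1 - y / L ≤ 0 := by rw [sub_nonpos, one_le_div hL0]; exact h
    have h4 : L - y = L * (1 - y / L) := by field_simp
    rw [h4]
    nlinarith

end TensorFactor

namespace TensorFactor

open Matrix

/-! ### Quadratic forms of random matrices -/

/-- The Schur test for symmetric matrices. -/
theorem sum_mul_le_of_row_sum_le {p : ℕ} {g : Fin p → Fin p → ℝ} (hg : ∀ i j, g i j = g j i) {R : ℝ}
    (hR : ∀ i, ∑ j, |g i j| ≤ R) (v : Fin p → ℝ) :
    ∑ i, ∑ j, v i * v j * g i j ≤ R * (v ⬝ᵥ v) := by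
  have h1 : ∀ i j, v i * v j * g i j ≤ (|g i j| * v i ^ 2 + |g j i| * v j ^ 2) / 2 := by
    intro i j
    rw [hg j i]
    have h2 : v i * v j * g i j ≤ |v i * v j| * |g i j| := (le_abs_self _).trans_eq (abs_mul _ _)
    have h3 : |v i * v j| ≤ (v i ^ 2 + v j ^ 2) / 2 := by
      rw [abs_mul, ← sq_abs (v i), ← sq_abs (v j)]
      nlinarith [sq_nonneg (|v i| - |v j|)]
    have h4 := mul_le_mul_of_nonneg_right h3 (abs_nonneg (g i j))
    linarith
  have h5 : ∑ i, ∑ j, |g i j| * v i ^ 2 ≤ R * (v ⬝ᵥ v) := by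
    rw [dotProduct, Finset.mul_sum]
    refine Finset.sum_le_sum fun i _ => ?_
    rw [← Finset.sum_mul, ← sq]
    exact mul_le_mul_of_nonneg_right (hR i) (sq_nonneg _)
  have h6 : ∑ i, ∑ j, |g j i| * v j ^ 2 = ∑ i, ∑ j, |g i j| * v i ^ 2 := Finset.sum_comm
  calc _ ≤ ∑ i, ∑ j, (|g i j| * v i ^ 2 + |g j i| * v j ^ 2) / 2 :=
        Finset.sum_le_sum fun i _ => Finset.sum_le_sum fun j _ => h1 i j
    _ = (∑ i, ∑ j, |g i j| * v i ^ 2 + ∑ i, ∑ j, |g j i| * v j ^ 2) / 2 := by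
        simp_rw [← Finset.sum_div, Finset.sum_add_distrib]
    _ ≤ _ := by rw [h6]; linarith

theorem sq_sum_mul_le {p : ℕ} (D : Fin p → Fin p → ℝ) (v : Fin p → ℝ) :
    (∑ i, ∑ j, v i * v j * D i j) ^ 2 ≤ (v ⬝ᵥ v) ^ 2 * ∑ i, ∑ j, D i j ^ 2 := by
  have h := Finset.sum_mul_sq_le_sq_mul_sq (Finset.univ : Finset (Fin p × Fin p))
    (fun x => v x.1 * v x.2) (fun x => D x.1 x.2)
  rw [Fintype.sum_prod_type, Fintype.sum_prod_type, Fintype.sum_prod_type] at h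
  have h0 : ∑ i, ∑ j, (v i * v j) ^ 2 = (v ⬝ᵥ v) ^ 2 := by
    rw [sq (v ⬝ᵥ v), dotProduct, Finset.sum_mul_sum]
    exact Finset.sum_congr rfl fun i _ => Finset.sum_congr rfl fun j _ => by ring
  rwa [h0] at h

theorem measure_quadForm_gt_le {Ω ι : Type*} [MeasurableSpace Ω] {P : Measure Ω}
    [IsProbabilityMeasure P] {s : Finset ι} {p : ℕ} {Z : Fin p → ι → Ω → ℝ} {b β R V σ : ℝ}
    (hZ : ∀ i, ∀ x ∈ s, Measurable (Z i x)) (hb : ∀ i, ∀ x ∈ s, ∀ w, |Z i x w| ≤ b)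
    (hβ : ∀ i, ∀ x ∈ s, |∫ w, Z i x w ∂P| ≤ β)
    (hR : ∀ i, ∀ x ∈ s, ∑ j, |cov[Z i x, Z j x; P]| ≤ R)
    (hV : ∀ i j, ∀ x ∈ s,
      ∑ y ∈ s, |cov[fun w => Z i x w * Z j x w, fun w => Z i y w * Z j y w; P]| ≤ V)
    (hσ : 0 < σ) (hp : 0 < p) (hs : s.Nonempty) :
    P {w | ¬ ∀ v : Fin p → ℝ, ∑ x ∈ s, (∑ i, v i * Z i x w) ^ 2 ≤
      (R + p * β ^ 2 + p * σ) * s.card * (v ⬝ᵥ v)} ≤ ENNReal.ofReal (V / (s.card * σ ^ 2)) := by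
  have hcard : (0 : ℝ) < s.card := by exact_mod_cast hs.card_pos
  have hp' : (0 : ℝ) < p := by exact_mod_cast hp
  have hL : ∀ i, ∀ x ∈ s, MemLp (Z i x) 2 P := fun i x hx => memLp_of_bound (hZ i x hx) (hb i x hx) 2
  have hLL : ∀ i j, ∀ x ∈ s, MemLp (fun w => Z i x w * Z j x w) 2 P := fun i j x hx =>
    memLp_of_bound ((hZ i x hx).mul (hZ j x hx)) (a := b * b) (fun w => by
      rw [Pi.mul_apply, abs_mul]
      exact mul_le_mul (hb i x hx w) (hb j x hx w) (abs_nonneg _)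
        ((abs_nonneg _).trans (hb i x hx w))) 2
  let G : Fin p → Fin p → Ω → ℝ := fun i j w => ∑ x ∈ s, Z i x w * Z j x w
  let g : Fin p → Fin p → ℝ := fun i j => ∫ w, G i j w ∂P
  have hG : ∀ i j, MemLp (G i j) 2 P := fun i j => memLp_finsetSum s fun x hx => hLL i j x hx
  have hvar : ∀ i j, ∫ w, (G i j w - g i j) ^ 2 ∂P ≤ s.card * V := by
    intro i j
    rw [← variance_eq_integral (hG i j).aemeasurable, ← covariance_self (hG i j).aemeasurable]
    have h1 : cov[G i j, G i j; P] = ∑ x ∈ s, ∑ y ∈ s,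
        cov[fun w => Z i x w * Z j x w, fun w => Z i y w * Z j y w; P] :=
      covariance_fun_sum_fun_sum' (fun x hx => hLL i j x hx) (fun x hx => hLL i j x hx)
    rw [h1, ← nsmul_eq_mul]
    refine Finset.sum_le_card_nsmul _ _ _ fun x hx => le_trans ?_ (hV i j x hx)
    exact Finset.sum_le_sum fun y _ => le_abs_self _
  have hg : ∀ i, ∑ j, |g i j| ≤ (R + p * β ^ 2) * s.card := by
    intro i
    have h1 : ∀ j, |g i j| ≤ ∑ x ∈ s, (|cov[Z i x, Z j x; P]| + β ^ 2) := by
      intro j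
      have h2 : g i j = ∑ x ∈ s, ∫ w, Z i x w * Z j x w ∂P :=
        integral_finsetSum s fun x hx => (hLL i j x hx).integrable one_le_two
      rw [h2]
      refine (Finset.abs_sum_le_sum_abs _ _).trans (Finset.sum_le_sum fun x hx => ?_)
      have h3 := covariance_eq_sub (hL i x hx) (hL j x hx)
      have h4 : ∫ w, Z i x w * Z j x w ∂P = cov[Z i x, Z j x; P] +
          (∫ w, Z i x w ∂P) * ∫ w, Z j x w ∂P := by
        rw [h3]; simp
      rw [h4]
      refine (abs_add_le _ _).trans (add_le_add le_rfl ?_)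
      rw [abs_mul, sq]
      exact mul_le_mul (hβ i x hx) (hβ j x hx) (abs_nonneg _) ((abs_nonneg _).trans (hβ i x hx))
    refine (Finset.sum_le_sum fun j _ => h1 j).trans ?_
    rw [Finset.sum_comm, mul_comm, ← nsmul_eq_mul]
    refine Finset.sum_le_card_nsmul _ _ _ fun x hx => ?_
    rw [Finset.sum_add_distrib]
    simpa using hR i x hx
  -- The squared Frobenius norm of the fluctuation. It dominates the squared operator norm, and its
  -- expectation is a sum of `p²` variances; this is why the threshold contains `p * σ`.
  let W : Ω → ℝ := fun w => ∑ i, ∑ j, (G i j w - g i j) ^ 2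
  have hWi : ∀ i j, Integrable (fun w => (G i j w - g i j) ^ 2) P := fun i j =>
    ((hG i j).sub (memLp_const _)).integrable_sq
  have hWint : Integrable W P :=
    integrable_finsetSum _ fun i _ => integrable_finsetSum _ fun j _ => hWi i j
  have hW0 : ∀ w, 0 ≤ W w := fun w =>
    Finset.sum_nonneg fun i _ => Finset.sum_nonneg fun j _ => sq_nonneg _
  have hW : ∫ w, W w ∂P ≤ p ^ 2 * (s.card * V) := by
    have h1 : ∫ w, W w ∂P = ∑ i, ∑ j, ∫ w, (G i j w - g i j) ^ 2 ∂P := by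
      rw [integral_finsetSum _ fun i _ => integrable_finsetSum _ fun j _ => hWi i j]
      exact Finset.sum_congr rfl fun i _ => integral_finsetSum _ fun j _ => hWi i j
    rw [h1]
    refine (Finset.sum_le_sum fun i _ => Finset.sum_le_sum fun j _ => hvar i j).trans_eq ?_
    simp
    ring
  set θ : ℝ := (p * σ * s.card) ^ 2 with hθ
  have hθ0 : 0 < θ := by positivity
  have hmarkov := mul_meas_ge_le_integral_of_nonneg (ae_of_all P hW0) hWint θ
  have hsub : {w | ¬ ∀ v : Fin p → ℝ, ∑ x ∈ s, (∑ i, v i * Z i x w) ^ 2 ≤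
      (R + p * β ^ 2 + p * σ) * s.card * (v ⬝ᵥ v)} ⊆ {w | θ ≤ W w} := by
    intro w hw
    by_contra hlt
    refine hw fun v => ?_
    have hlt' : W w ≤ θ := (not_le.mp hlt).le
    have h1 : ∑ x ∈ s, (∑ i, v i * Z i x w) ^ 2 = ∑ i, ∑ j, v i * v j * G i j w := by
      have h2 : ∀ x, (∑ i, v i * Z i x w) ^ 2 =
          ∑ i, ∑ j, v i * v j * (Z i x w * Z j x w) := by
        intro x
        rw [sq, Finset.sum_mul_sum]
        exact Finset.sum_congr rfl fun i _ => Finset.sum_congr rfl fun j _ => by ring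
      simp_rw [h2, G, Finset.mul_sum]
      rw [Finset.sum_comm]
      exact Finset.sum_congr rfl fun i _ => Finset.sum_comm
    have h2 : ∑ i, ∑ j, v i * v j * G i j w =
        ∑ i, ∑ j, v i * v j * g i j + ∑ i, ∑ j, v i * v j * (G i j w - g i j) := by
      simp only [← Finset.sum_add_distrib]
      exact Finset.sum_congr rfl fun i _ => Finset.sum_congr rfl fun j _ => by ring
    -- The mean Gram matrix is handled by the Schur test, the centred one by its Frobenius norm.
    have h3 := sum_mul_le_of_row_sum_le (g := g) (fun i j => by simp only [g, G, mul_comm]) hg v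
    have h4 : ∑ i, ∑ j, v i * v j * (G i j w - g i j) ≤ p * σ * s.card * (v ⬝ᵥ v) := by
      refine abs_le_of_sq_le_sq' ?_ (mul_nonneg (by positivity) (dotProduct_self_nonneg' v)) |>.2
      refine (sq_sum_mul_le (fun i j => G i j w - g i j) v).trans ?_
      rw [mul_pow, mul_comm]
      exact mul_le_mul_of_nonneg_right hlt' (sq_nonneg _)
    rw [h1, h2]
    linarith
  refine (measure_mono hsub).trans ?_
  rw [ENNReal.le_ofReal_iff_toReal_le (measure_ne_top _ _)]
  · change P.real _ ≤ _
    have h5 : P.real {w | θ ≤ W w} ≤ (p ^ 2 * (s.card * V)) / θ := by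
      rw [le_div_iff₀ hθ0, mul_comm]
      exact hmarkov.trans hW
    refine h5.trans_eq ?_
    rw [hθ]
    field_simp
  · obtain ⟨x, hx⟩ := hs
    have : 0 ≤ V := (Finset.sum_nonneg fun _ _ => abs_nonneg _).trans (hV ⟨0, hp⟩ ⟨0, hp⟩ x hx)
    positivity

/-! ### Truncation -/

theorem trunc_eq {τ : ℝ} (hτ : 0 ≤ τ) (x : ℝ) : trunc τ x = max (-τ) (min x τ) := by
  unfold trunc
  rcases lt_trichotomy x 0 with h | h | h
  · rw [Real.sign_of_neg h, abs_of_neg h, min_eq_left (h.le.trans hτ), neg_one_mul, ← max_neg_neg,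
      neg_neg, max_comm]
  · simp [h, hτ]
  · rw [Real.sign_of_pos h, abs_of_pos h, one_mul, max_eq_right]
    exact (neg_nonpos.mpr hτ).trans (le_min h.le hτ)

theorem measurable_trunc {τ : ℝ} (hτ : 0 ≤ τ) : Measurable (trunc τ) := by
  have : trunc τ = fun x => max (-τ) (min x τ) := funext (trunc_eq hτ)
  rw [this]
  fun_prop

/-- Clipping is 1-Lipschitz and fixes `c`. Hence the residuals inherit the moments of the
idiosyncratic components. -/
theorem abs_trunc_sub_le {τ c : ℝ} (hc : |c| ≤ τ) (y : ℝ) : |trunc τ (c + y) - c| ≤ |y| := by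
  have hτ : 0 ≤ τ := (abs_nonneg c).trans hc
  rw [trunc_eq hτ]
  obtain ⟨h1, h2⟩ := abs_le.mp hc
  rcases max_cases (-τ) (min (c + y) τ) with ⟨h, h'⟩ | ⟨h, h'⟩ <;>
  rcases min_cases (c + y) τ with ⟨h3, h3'⟩ | ⟨h3, h3'⟩ <;>
  rcases abs_cases y with ⟨h4, h4'⟩ | ⟨h4, h4'⟩ <;>
  rw [h, abs_le] <;> constructor <;> linarith

theorem abs_trunc_sub_le' {τ c : ℝ} (hc : |c| ≤ τ) (y : ℝ) :
    |trunc τ (c + y) - c| ≤ 2 * τ := by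
  have hτ : 0 ≤ τ := (abs_nonneg c).trans hc
  rw [trunc_eq hτ]
  obtain ⟨h1, h2⟩ := abs_le.mp hc
  have h3 : max (-τ) (min (c + y) τ) ≤ τ := max_le (by linarith) (min_le_right _ _)
  have h4 : -τ ≤ max (-τ) (min (c + y) τ) := le_max_left _ _
  rw [abs_le]
  constructor <;> linarith

theorem abs_trunc_sub_sub_le {τ c : ℝ} (hc : |c| ≤ τ / 2) (y : ℝ) :
    |trunc τ (c + y) - c - y| ≤ if |y| ≤ τ / 2 then 0 else |y| := by
  have hτ : 0 ≤ τ := by linarith [(abs_nonneg c).trans hc]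
  rw [trunc_eq hτ]
  obtain ⟨h1, h2⟩ := abs_le.mp hc
  split_ifs with hy
  · obtain ⟨h3, h4⟩ := abs_le.mp hy
    rw [min_eq_left (by linarith), max_eq_right (by linarith)]
    simp
  · rcases max_cases (-τ) (min (c + y) τ) with ⟨h, h'⟩ | ⟨h, h'⟩ <;>
    rcases min_cases (c + y) τ with ⟨h3, h3'⟩ | ⟨h3, h3'⟩ <;>
    rcases abs_cases y with ⟨h4, h4'⟩ | ⟨h4, h4'⟩ <;>
    rw [h, abs_le] <;> constructor <;> linarith

/-! ### Moments of the residuals -/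

theorem abs_tucker_le {K : ℕ} {d e : Fin K → ℕ} (F : Tensor d)
    (L : ∀ k, Matrix (Fin (e k)) (Fin (d k)) ℝ) {l : ℝ} (hL : ∀ k i j, |L k i j| ≤ l)
    (i : ∀ k, Fin (e k)) : |tucker F L i| ≤ (∏ k, d k : ℕ) * |l| ^ K * tnorm F := by
  unfold tucker
  refine (Finset.abs_sum_le_sum_abs _ _).trans ?_
  have h1 : ∀ j, |F j * ∏ k, L k (i k) (j k)| ≤ |l| ^ K * tnorm F := by
    intro j
    rw [abs_mul, mul_comm, Finset.abs_prod]
    refine mul_le_mul ?_ ?_ (abs_nonneg _) (by positivity)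
    · refine (Finset.prod_le_prod (fun _ _ => abs_nonneg _) fun k _ =>
        (hL k (i k) (j k)).trans (le_abs_self l)).trans_eq ?_
      simp
    · exact Real.abs_le_sqrt (Finset.single_le_sum (f := fun j => F j ^ 2)
        (fun _ _ => sq_nonneg _) (Finset.mem_univ j))
  refine (Finset.sum_le_sum fun j _ => h1 j).trans_eq ?_
  simp
  ring

theorem integral_rpow_le_of_eLpNorm_le {Ω : Type*} [MeasurableSpace Ω] {P : Measure Ω}
    {X : Ω → ℝ} (hX : Measurable X) {q om : ℝ} (hq : 0 < q) (hom : 0 ≤ om)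
    (h : eLpNorm X (ENNReal.ofReal q) P ≤ ENNReal.ofReal om) :
    Integrable (fun w => |X w| ^ q) P ∧ ∫ w, |X w| ^ q ∂P ≤ om ^ q := by
  have hq' : ENNReal.ofReal q ≠ 0 := by simpa using hq
  have hm : MemLp X (ENNReal.ofReal q) P :=
    ⟨hX.aestronglyMeasurable, h.trans_lt ENNReal.ofReal_lt_top⟩
  have h1 := hm.integrable_norm_rpow hq' ENNReal.ofReal_ne_top
  rw [ENNReal.toReal_ofReal hq.le] at h1
  refine ⟨h1, ?_⟩
  rw [hm.eLpNorm_eq_integral_rpow_norm hq' ENNReal.ofReal_ne_top, ENNReal.toReal_ofReal hq.le,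
    ENNReal.ofReal_le_ofReal_iff hom] at h
  have h2 : 0 ≤ ∫ w, ‖X w‖ ^ q ∂P := integral_nonneg fun _ => by positivity
  have h3 := Real.rpow_le_rpow (Real.rpow_nonneg h2 _) h hq.le
  rwa [← Real.rpow_mul h2, inv_mul_cancel₀ hq.ne', Real.rpow_one] at h3

namespace Model

variable {K : ℕ} {r : Fin K → ℕ} {Ω : Type*} (S : Model K r Ω)

/-- The common component is well below the truncation level. -/
def SmallSignal (τ : ℝ) : Prop :=
  0 < τ ∧ ∀ t ∈ Finset.Icc 1 S.n, ∀ i, |tucker (S.F t) S.L i| ≤ τ / 2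

variable {S} [MeasurableSpace Ω] {P : Measure Ω} [IsProbabilityMeasure P] {ε om M τ : ℝ}

omit [MeasurableSpace Ω] in
theorem resid_eq (t : ℕ) (i : ∀ k, Fin (S.p k)) : (fun w => S.resid τ t w i) =
    (fun x => trunc τ (tucker (S.F t) S.L i + x) - tucker (S.F t) S.L i) ∘ S.ξ i t := rfl

theorem measurable_trunc_add_sub (hτ : 0 < τ) (c : ℝ) :
    Measurable fun x => trunc τ (c + x) - c :=
  ((measurable_trunc hτ.le).comp (measurable_const_add c)).sub_const c

omit [IsProbabilityMeasure P] in
theorem momentBound_resid (hε : 0 < ε) (hom : 0 < om) (hT : S.TailAssumption P ε om M)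
    (hτ : S.SmallSignal τ) {t : ℕ} (ht : t ∈ Finset.Icc 1 S.n) (i : ∀ k, Fin (S.p k)) :
    MomentBound P ε (om ^ (2 + 2 * ε)) (2 * τ) fun w => S.resid τ t w i := by
  have hc : |tucker (S.F t) S.L i| ≤ τ := by linarith [hτ.1, hτ.2 t ht i]
  refine ⟨?_, fun w => abs_trunc_sub_le' hc _, ?_⟩
  · rw [resid_eq]
    exact (measurable_trunc_add_sub hτ.1 _).comp (hT.measurable i t)
  · obtain ⟨h1, h2⟩ := integral_rpow_le_of_eLpNorm_le (hT.measurable i t)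
      (by linarith : 0 < 2 + 2 * ε) hom.le (hT.moment i t)
    refine le_trans (integral_mono_of_nonneg (ae_of_all _ fun _ =>
      Real.rpow_nonneg (abs_nonneg _) _) h1 (ae_of_all _ fun w => ?_)) h2
    exact Real.rpow_le_rpow (abs_nonneg _) (abs_trunc_sub_le hc _) (by linarith)

/-- As `ξ` is centred, the bias is the mean of `resid - ξ`. With the signal below `τ/2` this
difference vanishes unless `|ξ| > τ/2`, where `|ξ| ≤ (τ/2)^(-(1+2ε)) |ξ|^(2+2ε)`. -/
theorem abs_integral_resid_le (hε : 0 < ε) (hom : 0 < om) (hT : S.TailAssumption P ε om M)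
    (hτ : S.SmallSignal τ) {t : ℕ} (ht : t ∈ Finset.Icc 1 S.n) (i : ∀ k, Fin (S.p k)) :
    |∫ w, S.resid τ t w i ∂P| ≤ (τ / 2) ^ (-(1 + 2 * ε)) * om ^ (2 + 2 * ε) := by
  have hτ2 : 0 < τ / 2 := half_pos hτ.1
  obtain ⟨h1, h2⟩ := integral_rpow_le_of_eLpNorm_le (hT.measurable i t)
    (by linarith : 0 < 2 + 2 * ε) hom.le (hT.moment i t)
  have hint : Integrable (S.ξ i t) P := by
    have hm : MemLp (S.ξ i t) (ENNReal.ofReal (2 + 2 * ε)) P :=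
      ⟨(hT.measurable i t).aestronglyMeasurable, (hT.moment i t).trans_lt ENNReal.ofReal_lt_top⟩
    refine hm.integrable ?_
    rw [ENNReal.one_le_ofReal]
    linarith
  have hZ := momentBound_resid hε hom hT hτ ht i
  have hZi := integrable_of_bound (P := P) hZ.measurable hZ.bound
  have h3 : ∫ w, S.resid τ t w i ∂P = ∫ w, (S.resid τ t w i - S.ξ i t w) ∂P := by
    rw [integral_sub hZi hint, hT.centred i t, sub_zero]
  rw [h3]
  refine abs_integral_le_integral_abs.trans ?_
  refine le_trans (integral_mono_of_nonneg (ae_of_all _ fun _ => abs_nonneg _)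
    (h1.const_mul ((τ / 2) ^ (-(1 + 2 * ε)))) (ae_of_all _ fun w => ?_)) ?_
  · refine (abs_trunc_sub_sub_le (hτ.2 t ht i) (S.ξ i t w)).trans ?_
    split_ifs with hy
    · exact mul_nonneg (Real.rpow_nonneg hτ2.le _) (Real.rpow_nonneg (abs_nonneg _) _)
    · have hy' := not_le.mp hy
      have hX : 0 < |S.ξ i t w| := hτ2.trans hy'
      have h4 : |S.ξ i t w| ^ (2 + 2 * ε) = |S.ξ i t w| * |S.ξ i t w| ^ (1 + 2 * ε) := by
        rw [← Real.rpow_one_add' hX.le (by linarith)]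
        congr 1
        ring
      dsimp only
      rw [h4, Real.rpow_neg hτ2.le, inv_mul_eq_div, le_div_iff₀ (Real.rpow_pos_of_pos hτ2 _)]
      exact mul_le_mul_of_nonneg_left (Real.rpow_le_rpow hτ2.le hy'.le (by linarith)) hX.le
  · rw [integral_const_mul]
    exact mul_le_mul_of_nonneg_left h2 (Real.rpow_nonneg hτ2.le _)

end Model

end TensorFactor

namespace TensorFactor

/-! ### Covariances of the residuals -/

theorem sum_exp_neg_fin_le {a : ℝ} (ha : 0 < a) {p : ℕ} (c : Fin p) :
    ∑ x : Fin p, Real.exp (-(a * ((c : ℤ) - (x : ℤ)).natAbs)) ≤ 2 * (1 + 1 / a) := by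
  have h := sum_exp_neg_int_le ha (c : ℤ)
    ((Finset.univ : Finset (Fin p)).image fun x : Fin p => ((x : ℕ) : ℤ))
  rwa [Finset.sum_image fun x _ y _ h => Fin.ext (by exact_mod_cast h)] at h

theorem sum_exp_neg_Icc_le {a : ℝ} (ha : 0 < a) (t n : ℕ) :
    ∑ u ∈ Finset.Icc 1 n, Real.exp (-(a * ((t : ℤ) - (u : ℤ)).natAbs)) ≤ 2 * (1 + 1 / a) := by
  have h := sum_exp_neg_int_le ha (t : ℤ) ((Finset.Icc 1 n).image fun x : ℕ => (x : ℤ))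
  rwa [Finset.sum_image fun x _ y _ h => by exact_mod_cast h] at h

theorem le_setDist {K : ℕ} {p : Fin K → ℕ} {E₁ E₂ : Set ((∀ k, Fin (p k)) × ℤ)} {m : ℕ}
    (h : ∀ x ∈ E₁, ∀ y ∈ E₂, m ≤ siteDist x y) : (m : ℕ∞) ≤ setDist E₁ E₂ :=
  le_iInf₂ fun x hx => le_iInf₂ fun y hy => by exact_mod_cast h x hx y hy

/-- The site in row `i` and column `c` of the mode-`k` unfolding. -/
def rowCol {K : ℕ} {p : Fin K → ℕ} (k : Fin K) (i : Fin (p k)) (c : ColIdx p k) : ∀ k, Fin (p k) :=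
  (Equiv.piSplitAt k fun j => Fin (p j)).symm (i, c)

section rowCol

variable {K : ℕ} {p : Fin K → ℕ} {k : Fin K}

theorem rowCol_self (i : Fin (p k)) (c : ColIdx p k) : rowCol k i c k = i := by
  simp [rowCol, Equiv.piSplitAt]

theorem rowCol_of_ne (i : Fin (p k)) (c : ColIdx p k) (j : {j // j ≠ k}) :
    rowCol k i c j = c j := by
  simp [rowCol, Equiv.piSplitAt, j.2]

theorem rowCol_inj {i i' : Fin (p k)} {c c' : ColIdx p k} :
    rowCol k i c = rowCol k i' c' ↔ i = i' ∧ c = c' := by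
  rw [rowCol, rowCol, Equiv.apply_eq_iff_eq, Prod.mk.injEq]

theorem natAbs_le_siteDist (x y : (∀ k, Fin (p k)) × ℤ) (k : Fin K) :
    ((x.1 k : ℤ) - (y.1 k : ℤ)).natAbs ≤ siteDist x y :=
  le_max_of_le_left
    (Finset.le_sup (f := fun k => ((x.1 k : ℤ) - (y.1 k : ℤ)).natAbs) (Finset.mem_univ k))

/-- The distance of two columns and times. -/
def colDist (c d : ColIdx p k) (t u : ℕ) : ℕ :=
  max (Finset.univ.sup fun j => ((c j : ℤ) - (d j : ℤ)).natAbs) ((t : ℤ) - (u : ℤ)).natAbs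

theorem colDist_le_siteDist (i i' : Fin (p k)) (c d : ColIdx p k) (t u : ℕ) :
    colDist c d t u ≤ siteDist (rowCol k i c, (t : ℤ)) (rowCol k i' d, (u : ℤ)) := by
  refine max_le (Finset.sup_le fun j _ => ?_) (le_max_right _ _)
  have := natAbs_le_siteDist (rowCol k i c, (t : ℤ)) (rowCol k i' d, (u : ℤ)) j
  simpa only [rowCol_of_ne] using this

/-- A maximum of `K` coordinate distances is at least their average, so the exponential is bounded
by a product of one-dimensional ones with rate `a / K`, and the sum factorises. -/
theorem sum_exp_neg_colDist_le {a : ℝ} (ha : 0 < a) (c : ColIdx p k) (t n : ℕ) :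
    ∑ y ∈ Finset.Icc 1 n ×ˢ (Finset.univ : Finset (ColIdx p k)),
      Real.exp (-(a * colDist c y.2 t y.1)) ≤ (2 * (1 + K / a)) ^ K := by
  have hK : 0 < K := Fin.pos k
  have hK' : (0 : ℝ) < K := by exact_mod_cast hK
  have haK : 0 < a / K := by positivity
  have hcard : Fintype.card {j // j ≠ k} = K - 1 := by
    rw [Fintype.card_subtype_compl]; simp
  have h1 : ∀ (d : ColIdx p k) (u : ℕ), Real.exp (-(a * colDist c d t u)) ≤
      Real.exp (-(a / K * ((t : ℤ) - (u : ℤ)).natAbs)) *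
        ∏ j, Real.exp (-(a / K * ((c j : ℤ) - (d j : ℤ)).natAbs)) := by
    intro d u
    rw [← Real.exp_sum, ← Real.exp_add]
    refine Real.exp_le_exp.mpr ?_
    have h2 : ∑ j : {j // j ≠ k}, (((c j : ℤ) - (d j : ℤ)).natAbs : ℝ) ≤
        (K - 1 : ℕ) * (colDist c d t u : ℝ) := by
      rw [← nsmul_eq_mul, ← hcard, ← Finset.card_univ]
      refine Finset.sum_le_card_nsmul _ _ _ fun j _ => ?_
      exact Nat.cast_le.mpr <| le_max_of_le_left
        (Finset.le_sup (f := fun j => ((c j : ℤ) - (d j : ℤ)).natAbs) (Finset.mem_univ j))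
    have h3 : (((t : ℤ) - (u : ℤ)).natAbs : ℝ) ≤ colDist c d t u := by
      exact Nat.cast_le.mpr (le_max_right _ _)
    rw [Nat.cast_sub hK] at h2
    rw [Finset.sum_neg_distrib, ← Finset.mul_sum]
    have h4 : a * colDist c d t u = a / K * (K * colDist c d t u) := by field_simp
    rw [h4, ← neg_add, ← mul_add]
    refine neg_le_neg (mul_le_mul_of_nonneg_left ?_ haK.le)
    push_cast at h2
    linarith
  calc _ ≤ ∑ y ∈ Finset.Icc 1 n ×ˢ (Finset.univ : Finset (ColIdx p k)),
        Real.exp (-(a / K * ((t : ℤ) - (y.1 : ℤ)).natAbs)) *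
        ∏ j, Real.exp (-(a / K * ((c j : ℤ) - (y.2 j : ℤ)).natAbs)) :=
        Finset.sum_le_sum fun y _ => h1 y.2 y.1
    _ = (∑ u ∈ Finset.Icc 1 n, Real.exp (-(a / K * ((t : ℤ) - (u : ℤ)).natAbs))) *
        ∏ j : {j // j ≠ k}, ∑ x : Fin (p j),
          Real.exp (-(a / K * ((c j : ℤ) - (x : ℤ)).natAbs)) := by
        rw [Finset.sum_product, Finset.prod_univ_sum, Fintype.piFinset_univ, Finset.sum_mul_sum]
    _ ≤ (2 * (1 + 1 / (a / K))) * ∏ j : {j // j ≠ k}, (2 * (1 + 1 / (a / K))) := by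
        refine mul_le_mul (sum_exp_neg_Icc_le haK t n)
          (Finset.prod_le_prod (fun _ _ => Finset.sum_nonneg fun _ _ => (Real.exp_pos _).le)
            fun j _ => sum_exp_neg_fin_le haK _)
          (Finset.prod_nonneg fun _ _ => Finset.sum_nonneg fun _ _ => (Real.exp_pos _).le)
          (by positivity)
    _ = (2 * (1 + K / a)) ^ K := by
        rw [Finset.prod_const, Finset.card_univ, hcard, ← pow_succ', Nat.sub_add_cancel hK,
          one_div_div]

end rowCol

namespace Model

variable {K : ℕ} {r : Fin K → ℕ} {Ω : Type*} (S : Model K r Ω)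

/-- The residual as a function of the idiosyncratic component. -/
noncomputable def residFun (τ : ℝ) (t : ℕ) (i : ∀ k, Fin (S.p k)) (x : ℝ) : ℝ :=
  trunc τ (tucker (S.F t) S.L i + x) - tucker (S.F t) S.L i

/-- The entries of the unfolded residuals, with columns of all times put next to each other. -/
noncomputable def residEntry (τ : ℝ) (k : Fin K) (i : Fin (S.p k)) (x : ℕ × ColIdx S.p k) (w : Ω) :
    ℝ := S.residFun τ x.1 (rowCol k i x.2) (S.ξ (rowCol k i x.2) x.1 w)

variable {S} {τ : ℝ} {k : Fin K}

theorem energy_resid (w : Ω) (v : Fin (S.p k) → ℝ) :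
    energy S.n (fun t => unfold k (S.resid τ t w)) v =
      ∑ x ∈ Finset.Icc 1 S.n ×ˢ (Finset.univ : Finset (ColIdx S.p k)),
        (∑ i, v i * S.residEntry τ k i x w) ^ 2 := by
  rw [Finset.sum_product]
  refine Finset.sum_congr rfl fun t _ => Finset.sum_congr rfl fun c _ => ?_
  rw [sq]
  rfl

theorem measurable_residFun (hτ : 0 < τ) (t : ℕ) (i : ∀ k, Fin (S.p k)) :
    Measurable (S.residFun τ t i) := measurable_trunc_add_sub hτ _

theorem measurable_sigma {E : Set ((∀ k, Fin (S.p k)) × ℤ)} {i : ∀ k, Fin (S.p k)} {t : ℤ}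
    (h : (i, t) ∈ E) {f : ℝ → ℝ} (hf : Measurable f) :
    Measurable[S.sigma E] fun w => f (S.ξ i t w) := by
  refine hf.comp (Measurable.mono (comap_measurable (S.ξ i t)) ?_ le_rfl)
  exact le_iSup₂ (f := fun (x : (∀ k, Fin (S.p k)) × ℤ) (_ : x ∈ E) =>
    MeasurableSpace.comap (S.ξ x.1 x.2) inferInstance) (i, t) h

variable [m0 : MeasurableSpace Ω] {P : Measure Ω} [IsProbabilityMeasure P] {ε om M c₀ cε : ℝ}

omit [IsProbabilityMeasure P] in
theorem sigma_le (hT : S.TailAssumption P ε om M) (E : Set ((∀ k, Fin (S.p k)) × ℤ)) :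
    S.sigma E ≤ m0 :=
  iSup₂_le fun x _ => (hT.measurable x.1 x.2).comap_le

omit [IsProbabilityMeasure P] in
theorem momentBound_residEntry (hε : 0 < ε) (hom : 0 < om) (hT : S.TailAssumption P ε om M)
    (hτ : S.SmallSignal τ) (i : Fin (S.p k)) {x : ℕ × ColIdx S.p k}
    (hx : x.1 ∈ Finset.Icc 1 S.n) :
    MomentBound P ε (om ^ (2 + 2 * ε)) (2 * τ) (S.residEntry τ k i x) :=
  momentBound_resid hε hom hT hτ hx _

/-- Covariances of residuals in the same column. -/
theorem abs_covariance_residEntry_le (R : Regime) (hε : 0 < ε) (hε1 : ε < 1) (hom : 0 < om)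
    (hc₀ : 0 < c₀) (hT : S.TailAssumption P ε om M) (hD : S.DependenceAssumption R P ε om c₀ cε)
    (hτ : S.SmallSignal τ) (i j : Fin (S.p k)) {x : ℕ × ColIdx S.p k}
    (hx : x.1 ∈ Finset.Icc 1 S.n) :
    |cov[S.residEntry τ k i x, S.residEntry τ k j x; P]| ≤
      (5 + 2 * om ^ (2 + 2 * ε)) * Real.exp (-(ε * c₀ / 4 * ((i : ℤ) - (j : ℤ)).natAbs)) := by
  have hi := momentBound_residEntry hε hom hT hτ i hx
  have hj := momentBound_residEntry hε hom hT hτ j hx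
  cases R with
  | indep =>
    have hD' : S.IndepAssumption P ε om c₀ cε := hD
    -- Under independence only the diagonal entry survives, and there the exponential equals 1.
    by_cases hij : i = j
    · subst hij
      refine (hi.abs_covariance_le_one_add hε hi).trans ?_
      have := hi.Q_nonneg
      simp
      linarith
    · have h1 : IndepFun (S.residEntry τ k i x) (S.residEntry τ k j x) P := by
        have h2 := hD'.indep.indepFun (i := rowCol k i x.2) (j := rowCol k j x.2)
          fun h => hij (rowCol_inj.mp h).1
        exact h2.comp
          (φ := fun y : ℤ → ℝ => S.residFun τ x.1 (rowCol k i x.2) (y x.1))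
          (ψ := fun y : ℤ → ℝ => S.residFun τ x.1 (rowCol k j x.2) (y x.1))
          ((measurable_residFun hτ.1 _ _).comp (measurable_pi_apply _))
          ((measurable_residFun hτ.1 _ _).comp (measurable_pi_apply _))
      rw [h1.covariance_eq_zero (memLp_of_bound hi.measurable hi.bound 2)
        (memLp_of_bound hj.measurable hj.bound 2), abs_zero]
      have := hi.Q_nonneg
      positivity
  | field =>
    have hD' : S.FieldAssumption P ε om c₀ cε := hD
    have hmix := hD'.mixing ((i : ℤ) - (j : ℤ)).natAbs {(rowCol k i x.2, (x.1 : ℤ))}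
      {(rowCol k j x.2, (x.1 : ℤ))} (le_setDist ?_)
    · exact MomentBound.abs_covariance_le_exp hε (sigma_le hT _) (sigma_le hT _)
        (mul_nonneg hc₀.le (Nat.cast_nonneg _)) hε1 hmix
        (measurable_sigma (Set.mem_singleton _) (measurable_residFun hτ.1 _ _))
        (measurable_sigma (Set.mem_singleton _) (measurable_residFun hτ.1 _ _)) hi hj
    rintro _ rfl _ rfl
    have := natAbs_le_siteDist (rowCol k i x.2, (x.1 : ℤ)) (rowCol k j x.2, (x.1 : ℤ)) k
    simpa only [rowCol_self] using this

theorem abs_covariance_time_le (hT : S.TailAssumption P ε om M)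
    (hD : S.IndepAssumption P ε om c₀ cε) (i : ∀ k, Fin (S.p k)) {f g : ℝ → ℝ}
    (hf : Measurable f) (hg : Measurable g) {a b : ℝ} (ha : ∀ w, |f w| ≤ a) (hb : ∀ w, |g w| ≤ b)
    (t u : ℕ) : |cov[fun w => f (S.ξ i t w), fun w => g (S.ξ i u w); P]| ≤
      4 * a * b * Real.exp (-(c₀ * ((t : ℤ) - (u : ℤ)).natAbs)) := by
  rcases le_total t u with h | h
  · refine abs_covariance_le_of_alphaMix (sigma_le hT _) (sigma_le hT _)
      (hD.mixing i t ((t : ℤ) - (u : ℤ)).natAbs) (measurable_sigma ?_ hf) (measurable_sigma ?_ hg)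
      (fun w => ha _) (fun w => hb _)
    · exact ⟨rfl, le_rfl⟩
    · exact ⟨rfl, by dsimp only; omega⟩
  -- The mixing bound sets the past against the future, so the two variables are exchanged.
  · rw [covariance_comm, mul_assoc 4, mul_comm a, ← mul_assoc]
    refine abs_covariance_le_of_alphaMix (sigma_le hT _) (sigma_le hT _)
      (hD.mixing i u ((t : ℤ) - (u : ℤ)).natAbs) (measurable_sigma ?_ hg) (measurable_sigma ?_ hf)
      (fun w => hb _) (fun w => ha _)
    · exact ⟨rfl, le_rfl⟩
    · exact ⟨rfl, by dsimp only; omega⟩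

end Model

/-- The covariance of products of variables from two independent pairs. -/
theorem abs_covariance_mul_le_of_indep {Ω : Type*} [MeasurableSpace Ω] {P : Measure Ω}
    [IsProbabilityMeasure P] {X Y X' Y' : Ω → ℝ} {b δ : ℝ} (hX : Measurable X) (hY : Measurable Y)
    (hX' : Measurable X') (hY' : Measurable Y') (bX : ∀ w, |X w| ≤ b) (bY : ∀ w, |Y w| ≤ b)
    (bX' : ∀ w, |X' w| ≤ b) (bY' : ∀ w, |Y' w| ≤ b)
    (hind : IndepFun (fun w => (X w, X' w)) (fun w => (Y w, Y' w)) P)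
    (h1 : |cov[X, X'; P]| ≤ δ) (h2 : |cov[Y, Y'; P]| ≤ δ) :
    |cov[fun w => X w * Y w, fun w => X' w * Y' w; P]| ≤ 2 * b ^ 2 * δ := by
  have hb2 : ∀ {U V : Ω → ℝ}, (∀ w, |U w| ≤ b) → (∀ w, |V w| ≤ b) → ∀ w, |U w * V w| ≤ b ^ 2 := by
    intro U V hU hV w
    rw [abs_mul, sq]
    exact mul_le_mul (hU w) (hV w) (abs_nonneg _) ((abs_nonneg _).trans (hU w))
  have hint : ∀ {U : Ω → ℝ} {B : ℝ}, (∀ w, |U w| ≤ B) → |∫ w, U w ∂P| ≤ B := by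
    intro U B hU
    have := norm_integral_le_of_norm_le_const (μ := P) (f := U) (C := B) (ae_of_all _ hU)
    simpa using this
  have e1 : ∫ w, X w * Y w ∂P = (∫ w, X w ∂P) * ∫ w, Y w ∂P :=
    (hind.comp measurable_fst measurable_fst).integral_fun_mul_eq_mul_integral
      hX.aestronglyMeasurable hY.aestronglyMeasurable
  have e2 : ∫ w, X' w * Y' w ∂P = (∫ w, X' w ∂P) * ∫ w, Y' w ∂P :=
    (hind.comp measurable_snd measurable_snd).integral_fun_mul_eq_mul_integral
      hX'.aestronglyMeasurable hY'.aestronglyMeasurable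
  have e3 : ∫ w, (X w * X' w) * (Y w * Y' w) ∂P =
      (∫ w, X w * X' w ∂P) * ∫ w, Y w * Y' w ∂P :=
    (hind.comp (φ := fun z : ℝ × ℝ => z.1 * z.2) (ψ := fun z : ℝ × ℝ => z.1 * z.2)
      (by fun_prop) (by fun_prop)).integral_fun_mul_eq_mul_integral
      (hX.mul hX').aestronglyMeasurable (hY.mul hY').aestronglyMeasurable
  have c0 := covariance_eq_sub (memLp_of_bound (P := P) (hX.mul hY) (hb2 bX bY) 2)
    (memLp_of_bound (P := P) (hX'.mul hY') (hb2 bX' bY') 2)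
  have c1 := covariance_eq_sub (memLp_of_bound (P := P) hX bX 2) (memLp_of_bound (P := P) hX' bX' 2)
  have c2 := covariance_eq_sub (memLp_of_bound (P := P) hY bY 2) (memLp_of_bound (P := P) hY' bY' 2)
  have e4 : ∫ w, (X w * Y w) * (X' w * Y' w) ∂P = (∫ w, X w * X' w ∂P) * ∫ w, Y w * Y' w ∂P := by
    rw [← e3]
    exact integral_congr_ae (ae_of_all _ fun w => by ring)
  simp only [Pi.mul_apply] at c0 c1 c2
  -- Independence of the pairs factorises every moment; adding and subtracting `E X · E X' · E[Y
  -- Y']` leaves one covariance from each pair.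
  have key : cov[fun w => X w * Y w, fun w => X' w * Y' w; P] =
      cov[X, X'; P] * ∫ w, Y w * Y' w ∂P +
        ((∫ w, X w ∂P) * ∫ w, X' w ∂P) * cov[Y, Y'; P] := by
    refine (show _ = _ from c0).trans ?_
    rw [e4, e1, e2, c1, c2]
    ring
  have hb0 : 0 ≤ b := by
    obtain ⟨w⟩ := P.nonempty_of_neZero
    exact (abs_nonneg _).trans (bX w)
  rw [key]
  refine (abs_add_le _ _).trans ?_
  rw [abs_mul, abs_mul, abs_mul]
  have i1 := mul_le_mul h1 (hint (hb2 bY bY')) (abs_nonneg _) ((abs_nonneg _).trans h1)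
  have i2 : |∫ w, X w ∂P| * |∫ w, X' w ∂P| ≤ b * b :=
    mul_le_mul (hint bX) (hint bX') (abs_nonneg _) hb0
  have i3 := mul_le_mul i2 h2 (abs_nonneg _) (by positivity)
  linarith

end TensorFactor

namespace TensorFactor

/-! ### Summing covariances of products, and the operator norm of the residuals. -/

namespace Model

variable {K : ℕ} {r : Fin K → ℕ} {Ω : Type*} {S : Model K r Ω} {τ : ℝ} {k : Fin K}
variable [m0 : MeasurableSpace Ω] {P : Measure Ω} [IsProbabilityMeasure P] {ε om M c₀ cε : ℝ}

variable (S) in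
/-- The logarithm appearing in the rates. -/
noncomputable def logSize (R : Regime) (k : Fin K) : ℝ :=
  match R with
  | .indep => Real.log (S.n * S.pExcept k)
  | .field => Real.log (S.n * S.pAll)

omit m0 [IsProbabilityMeasure P] in
theorem abs_residFun_le (hτ : S.SmallSignal τ) {t : ℕ} (ht : t ∈ Finset.Icc 1 S.n)
    (i : ∀ k, Fin (S.p k)) (x : ℝ) : |S.residFun τ t i x| ≤ 2 * τ :=
  abs_trunc_sub_le' (by linarith [hτ.1, hτ.2 t ht i]) _

theorem abs_covariance_mul_le_field (hε : 0 < ε) (hom : 0 < om)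
    (hT : S.TailAssumption P ε om M) (hD : S.FieldAssumption P ε om c₀ cε)
    (hτ : S.SmallSignal τ) (i j : Fin (S.p k)) {x y : ℕ × ColIdx S.p k}
    (hx : x.1 ∈ Finset.Icc 1 S.n) (hy : y.1 ∈ Finset.Icc 1 S.n) :
    |cov[fun w => S.residEntry τ k i x w * S.residEntry τ k j x w,
      fun w => S.residEntry τ k i y w * S.residEntry τ k j y w; P]| ≤
      8 * (2 * τ) ^ 4 * Real.exp (-(c₀ * colDist x.2 y.2 x.1 y.1)) := by
  have hb := fun (i : Fin (S.p k)) {x : ℕ × ColIdx S.p k} (hx : x.1 ∈ Finset.Icc 1 S.n) =>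
    momentBound_residEntry hε hom hT hτ i hx
  have hmix := hD.mixing (colDist x.2 y.2 x.1 y.1)
    {(rowCol k i x.2, (x.1 : ℤ)), (rowCol k j x.2, (x.1 : ℤ))}
    {(rowCol k i y.2, (y.1 : ℤ)), (rowCol k j y.2, (y.1 : ℤ))} (le_setDist ?_)
  · refine (abs_covariance_le_of_alphaMix (sigma_le hT _) (sigma_le hT _) hmix ?_ ?_
      ((hb i hx).bound_mul (hb j hx)) ((hb i hy).bound_mul (hb j hy))).trans ?_
    · exact (measurable_sigma (by simp) (measurable_residFun hτ.1 _ _)).mul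
        (measurable_sigma (by simp) (measurable_residFun hτ.1 _ _))
    · exact (measurable_sigma (by simp) (measurable_residFun hτ.1 _ _)).mul
        (measurable_sigma (by simp) (measurable_residFun hτ.1 _ _))
    · refine mul_le_mul_of_nonneg_right ?_ (Real.exp_pos _).le
      have : 0 ≤ (2 * τ) ^ 4 := by positivity
      nlinarith
  · rintro _ (rfl | rfl) _ (rfl | rfl) <;> exact colDist_le_siteDist _ _ _ _ _ _

/-- Mixing is assumed for each series separately, so `i ≠ j` goes through the identity for
independent pairs, with constant `2 · 4 = 8`. For `i = j` the product is a function of a single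
series and `4` would do. -/
theorem abs_covariance_mul_le_indep (hε : 0 < ε) (hom : 0 < om)
    (hT : S.TailAssumption P ε om M) (hD : S.IndepAssumption P ε om c₀ cε)
    (hτ : S.SmallSignal τ) (i j : Fin (S.p k)) {t u : ℕ} (c : ColIdx S.p k)
    (ht : t ∈ Finset.Icc 1 S.n) (hu : u ∈ Finset.Icc 1 S.n) :
    |cov[fun w => S.residEntry τ k i (t, c) w * S.residEntry τ k j (t, c) w,
      fun w => S.residEntry τ k i (u, c) w * S.residEntry τ k j (u, c) w; P]| ≤
      8 * (2 * τ) ^ 4 * Real.exp (-(c₀ * ((t : ℤ) - (u : ℤ)).natAbs)) := by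
  have hmt := fun i => momentBound_residEntry (x := (t, c)) hε hom hT hτ i ht
  have hmu := fun i => momentBound_residEntry (x := (u, c)) hε hom hT hτ i hu
  have hmeas := fun (i : ∀ k, Fin (S.p k)) (t : ℕ) => measurable_residFun (S := S) hτ.1 t i
  have hexp := Real.exp_pos (-(c₀ * ((t : ℤ) - (u : ℤ)).natAbs))
  by_cases hij : i = j
  · subst hij
    have hsq : ∀ {t : ℕ}, t ∈ Finset.Icc 1 S.n → ∀ x,
        |S.residFun τ t (rowCol k i c) x * S.residFun τ t (rowCol k i c) x| ≤ (2 * τ) ^ 2 := by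
      intro t ht x
      rw [← sq, abs_pow]
      exact pow_le_pow_left₀ (abs_nonneg _) (abs_residFun_le hτ ht _ x) 2
    refine (abs_covariance_time_le hT hD (rowCol k i c) ((hmeas (rowCol k i c) t).mul (hmeas _ t))
      ((hmeas (rowCol k i c) u).mul (hmeas _ u)) (hsq ht) (hsq hu) t u).trans ?_
    refine mul_le_mul_of_nonneg_right ?_ hexp.le
    have : 0 ≤ (2 * τ) ^ 4 := by positivity
    nlinarith
  · have h2 := hD.indep.indepFun (i := rowCol k i c) (j := rowCol k j c)
      fun h => hij (rowCol_inj.mp h).1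
    have hφ : ∀ i : ∀ k, Fin (S.p k), Measurable fun y : ℤ → ℝ =>
        (S.residFun τ t i (y t), S.residFun τ u i (y u)) := fun i =>
      ((hmeas i t).comp (measurable_pi_apply _)).prodMk ((hmeas i u).comp (measurable_pi_apply _))
    have h3 := h2.comp (hφ (rowCol k i c)) (hφ (rowCol k j c))
    have h4 := fun i => abs_covariance_time_le hT hD (rowCol k i c) (hmeas (rowCol k i c) t)
      (hmeas (rowCol k i c) u)
      (abs_residFun_le hτ ht (rowCol k i c)) (abs_residFun_le hτ hu (rowCol k i c)) t u
    refine (abs_covariance_mul_le_of_indep (hmt i).measurable (hmt j).measurable (hmu i).measurable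
      (hmu j).measurable (hmt i).bound (hmt j).bound (hmu i).bound (hmu j).bound h3 (h4 i)
      (h4 j)).trans_eq ?_
    ring

theorem covariance_mul_eq_zero_indep (hε : 0 < ε) (hom : 0 < om)
    (hT : S.TailAssumption P ε om M) (hD : S.IndepAssumption P ε om c₀ cε)
    (hτ : S.SmallSignal τ) (i j : Fin (S.p k)) {x y : ℕ × ColIdx S.p k}
    (hx : x.1 ∈ Finset.Icc 1 S.n) (hy : y.1 ∈ Finset.Icc 1 S.n) (hxy : y.2 ≠ x.2) :
    cov[fun w => S.residEntry τ k i x w * S.residEntry τ k j x w,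
      fun w => S.residEntry τ k i y w * S.residEntry τ k j y w; P] = 0 := by
  classical
  have hb := fun (i : Fin (S.p k)) {x : ℕ × ColIdx S.p k} (hx : x.1 ∈ Finset.Icc 1 S.n) =>
    momentBound_residEntry hε hom hT hτ i hx
  have hmeas := fun (i : ∀ k, Fin (S.p k)) (t : ℕ) => measurable_residFun (S := S) hτ.1 t i
  have hpath : ∀ i : ∀ k, Fin (S.p k), Measurable fun w (t : ℤ) => S.ξ i t w := fun i =>
    measurable_pi_lambda _ fun t => hT.measurable i t
  have hdisj : Disjoint ({rowCol k i x.2, rowCol k j x.2} : Finset (∀ k, Fin (S.p k)))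
      {rowCol k i y.2, rowCol k j y.2} := by
    rw [Finset.disjoint_left]
    intro a ha hb
    simp only [Finset.mem_insert, Finset.mem_singleton] at ha hb
    rcases ha with rfl | rfl <;> rcases hb with h | h <;> exact hxy (rowCol_inj.mp h).2.symm
  have h1 := hD.indep.indepFun_finset _ _ hdisj hpath
  have hφ : ∀ x : ℕ × ColIdx S.p k, Measurable
      fun z : (({rowCol k i x.2, rowCol k j x.2} : Finset (∀ k, Fin (S.p k))) → ℤ → ℝ) =>
        S.residFun τ x.1 (rowCol k i x.2) (z ⟨rowCol k i x.2, by simp⟩ x.1) *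
          S.residFun τ x.1 (rowCol k j x.2) (z ⟨rowCol k j x.2, by simp⟩ x.1) := fun x =>
    ((hmeas _ _).comp ((measurable_pi_apply _).comp (measurable_pi_apply _))).mul
      ((hmeas _ _).comp ((measurable_pi_apply _).comp (measurable_pi_apply _)))
  exact (h1.comp (hφ x) (hφ y)).covariance_eq_zero
    (memLp_of_bound ((hb i hx).measurable.mul (hb j hx).measurable)
      ((hb i hx).bound_mul (hb j hx)) 2)
    (memLp_of_bound ((hb i hy).measurable.mul (hb j hy).measurable)
      ((hb i hy).bound_mul (hb j hy)) 2)

/-- Covariances of products of residuals are summable over the columns and times, up to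
logarithms. -/
theorem sum_abs_covariance_mul_le (R : Regime) (hε : 0 < ε) (hε1 : ε < 1) (hom : 0 < om)
    (hc₀ : 0 < c₀) (hT : S.TailAssumption P ε om M) (hD : S.DependenceAssumption R P ε om c₀ cε)
    (hτ : S.SmallSignal τ) {C : ℝ} (hC : 1 ≤ C) (hL : 1 ≤ S.logSize R k)
    (hτC : 8 * (2 * τ) ^ 4 ≤
      (2 * τ) ^ (2 - 2 * ε) * om ^ (2 + 2 * ε) * C * Real.exp (S.logSize R k))
    (i j : Fin (S.p k)) {x : ℕ × ColIdx S.p k} (hx : x.1 ∈ Finset.Icc 1 S.n) :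
    ∑ y ∈ Finset.Icc 1 S.n ×ˢ (Finset.univ : Finset (ColIdx S.p k)),
      |cov[fun w => S.residEntry τ k i x w * S.residEntry τ k j x w,
        fun w => S.residEntry τ k i y w * S.residEntry τ k j y w; P]| ≤
      (2 * τ) ^ (2 - 2 * ε) * om ^ (2 + 2 * ε) * C * Real.exp 1 * (2 * (1 + K / c₀)) ^ K *
        S.logFactor R k := by
  set A := (2 * τ) ^ (2 - 2 * ε) * om ^ (2 + 2 * ε) with hA
  have hτ0 := hτ.1
  have hA0 : 0 ≤ A := by positivity
  set L := S.logSize R k with hLdef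
  have hL0 : 0 < L := by linarith
  have hK : (1 : ℝ) ≤ K := by exact_mod_cast Fin.pos k
  have hb := fun (i : Fin (S.p k)) {x : ℕ × ColIdx S.p k} (hx : x.1 ∈ Finset.Icc 1 S.n) =>
    momentBound_residEntry hε hom hT hτ i hx
  have hcA : ∀ {y : ℕ × ColIdx S.p k}, y.1 ∈ Finset.Icc 1 S.n →
      |cov[fun w => S.residEntry τ k i x w * S.residEntry τ k j x w,
        fun w => S.residEntry τ k i y w * S.residEntry τ k j y w; P]| ≤ A := fun hy =>
    (hb i hx).abs_covariance_mul_le hε (hb j hx) (hb i hy) (hb j hy) hε1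
  -- The moment bound `A` and the mixing bound are interpolated; `hτC` says that the latter starts
  -- at most `C e^L` above `A`.
  have hstep : ∀ {z d : ℝ}, z ≤ A → z ≤ 8 * (2 * τ) ^ 4 * Real.exp (-(c₀ * d)) →
      z ≤ A * C * Real.exp 1 * Real.exp (-(c₀ / L * d)) := by
    intro z d h1 h2
    have h3 : z ≤ A * C * Real.exp (L - c₀ * d) := by
      refine h2.trans ?_
      rw [sub_eq_add_neg, Real.exp_add, ← mul_assoc]
      exact mul_le_mul_of_nonneg_right hτC (Real.exp_pos _).le
    refine (le_mul_exp_of_le hA0 hC hL h1 h3).trans_eq ?_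
    rw [sub_eq_add_neg, Real.exp_add, ← mul_assoc]
    congr 3
    ring
  have hLc : 0 < c₀ / L := by positivity
  have hlin : ∀ q : ℝ, 0 ≤ q → 2 * (1 + q / (c₀ / L)) ≤ 2 * (1 + q / c₀) * L := by
    intro q hq
    have : q / (c₀ / L) = q / c₀ * L := by field_simp
    rw [this]
    nlinarith
  have hpre : 0 ≤ A * C * Real.exp 1 := by positivity
  cases R with
  | indep =>
    have hD' : S.IndepAssumption P ε om c₀ cε := hD
    have hF : S.logFactor .indep k = L := rfl
    rw [Finset.sum_product, hF]
    have h1 : ∀ u ∈ Finset.Icc 1 S.n, ∑ d : ColIdx S.p k,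
        |cov[fun w => S.residEntry τ k i x w * S.residEntry τ k j x w,
          fun w => S.residEntry τ k i (u, d) w * S.residEntry τ k j (u, d) w; P]| ≤
        A * C * Real.exp 1 * Real.exp (-(c₀ / L * ((x.1 : ℤ) - (u : ℤ)).natAbs)) := by
      intro u hu
      -- Distinct columns are independent, so only time is summed over, giving `L` where the random
      -- field gives `L ^ K`.
      rw [Finset.sum_eq_single x.2]
      · exact hstep (hcA (y := (u, x.2)) hu) (abs_covariance_mul_le_indep hε hom hT hD' hτ i j x.2 hx hu)
      · intro d _ hd
        rw [covariance_mul_eq_zero_indep hε hom hT hD' hτ i j hx (y := (u, d)) hu hd, abs_zero]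
      · simp
    refine (Finset.sum_le_sum h1).trans ?_
    rw [← Finset.mul_sum, mul_assoc (A * C * Real.exp 1)]
    refine mul_le_mul_of_nonneg_left ((sum_exp_neg_Icc_le hLc _ _).trans ?_) hpre
    refine (hlin 1 zero_le_one).trans (mul_le_mul_of_nonneg_right ?_ hL0.le)
    have h2 : 2 * (1 + 1 / c₀) ≤ 2 * (1 + K / c₀) := by gcongr
    have h3 : 1 ≤ 2 * (1 + K / c₀) := by
      have : 0 ≤ K / c₀ := by positivity
      linarith
    exact h2.trans (le_self_pow₀ h3 (Fin.pos k).ne')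
  | field =>
    have hD' : S.FieldAssumption P ε om c₀ cε := hD
    have hF : S.logFactor .field k = L ^ K := rfl
    have h1 : ∀ y ∈ Finset.Icc 1 S.n ×ˢ (Finset.univ : Finset (ColIdx S.p k)),
        |cov[fun w => S.residEntry τ k i x w * S.residEntry τ k j x w,
          fun w => S.residEntry τ k i y w * S.residEntry τ k j y w; P]| ≤
        A * C * Real.exp 1 * Real.exp (-(c₀ / L * colDist x.2 y.2 x.1 y.1)) := by
      intro y hy
      have hy1 := (Finset.mem_product.mp hy).1
      exact hstep (hcA hy1) (abs_covariance_mul_le_field hε hom hT hD' hτ i j hx hy1)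
    refine (Finset.sum_le_sum h1).trans ?_
    rw [← Finset.mul_sum, mul_assoc (A * C * Real.exp 1), hF, ← mul_pow]
    refine mul_le_mul_of_nonneg_left ((sum_exp_neg_colDist_le hLc _ _ _).trans ?_) hpre
    exact pow_le_pow_left₀ (by positivity) (hlin K (by linarith)) K

/-- The probability that the residuals have a large operator norm. -/
theorem measure_energy_resid_le (R : Regime) (hε : 0 < ε) (hε1 : ε < 1) (hom : 0 < om)
    (hc₀ : 0 < c₀) (hT : S.TailAssumption P ε om M) (hD : S.DependenceAssumption R P ε om c₀ cε)
    (hτ : S.SmallSignal τ) {C σ : ℝ} (hC : 1 ≤ C) (hL : 1 ≤ S.logSize R k)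
    (hτC : 8 * (2 * τ) ^ 4 ≤
      (2 * τ) ^ (2 - 2 * ε) * om ^ (2 + 2 * ε) * C * Real.exp (S.logSize R k))
    (hσ : 0 < σ) (hn : 0 < S.n) (hp : ∀ k, 0 < S.p k) :
    P {w | ¬ ∀ v : Fin (S.p k) → ℝ, energy S.n (fun t => unfold k (S.resid τ t w)) v ≤
      ((5 + 2 * om ^ (2 + 2 * ε)) * (2 * (1 + 1 / (ε * c₀ / 4))) / S.p k +
        ((τ / 2) ^ (-(1 + 2 * ε)) * om ^ (2 + 2 * ε)) ^ 2 + σ) *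
          (S.n * S.pExcept k * S.p k) * (v ⬝ᵥ v)} ≤
      ENNReal.ofReal ((2 * τ) ^ (2 - 2 * ε) * om ^ (2 + 2 * ε) * C * Real.exp 1 *
        (2 * (1 + K / c₀)) ^ K * S.logFactor R k / (S.n * S.pExcept k * σ ^ 2)) := by
  set s := Finset.Icc 1 S.n ×ˢ (Finset.univ : Finset (ColIdx S.p k)) with hs
  have hmem : ∀ {x}, x ∈ s → x.1 ∈ Finset.Icc 1 S.n := fun hx => (Finset.mem_product.mp hx).1
  have hb := fun (i : Fin (S.p k)) {x : ℕ × ColIdx S.p k} (hx : x ∈ s) =>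
    momentBound_residEntry hε hom hT hτ i (hmem hx)
  have hcard : (s.card : ℝ) = S.n * S.pExcept k := by
    have h : ∏ j ∈ Finset.univ.erase k, S.p j = ∏ j : {j // j ≠ k}, S.p j :=
      Finset.prod_subtype _ (by simp) _
    simp [hs, Finset.card_product, pExcept, h]
  have hpk : (0 : ℝ) < S.p k := by exact_mod_cast hp k
  have hcard0 : 0 < s.card := by
    have : (0 : ℝ) < s.card := by
      rw [hcard, pExcept]
      push_cast
      exact mul_pos (by exact_mod_cast hn) (Finset.prod_pos fun j _ => by exact_mod_cast hp j)
    exact_mod_cast this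
  have hQ : 0 ≤ 5 + 2 * om ^ (2 + 2 * ε) := by positivity
  have hmain := measure_quadForm_gt_le (P := P) (s := s) (Z := S.residEntry τ k) (σ := σ)
    (R := (5 + 2 * om ^ (2 + 2 * ε)) * (2 * (1 + 1 / (ε * c₀ / 4))))
    (fun i x hx => (hb i hx).measurable) (fun i x hx => (hb i hx).bound)
    (fun i x hx => abs_integral_resid_le hε hom hT hτ (hmem hx) _)
    (fun i x hx => (Finset.sum_le_sum fun j _ =>
      abs_covariance_residEntry_le R hε hε1 hom hc₀ hT hD hτ i j (hmem hx)).trans (by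
        rw [← Finset.mul_sum]
        exact mul_le_mul_of_nonneg_left (sum_exp_neg_fin_le (by positivity) i) hQ))
    (fun i j x hx => sum_abs_covariance_mul_le R hε hε1 hom hc₀ hT hD hτ hC hL hτC i j (hmem hx))
    hσ (hp k) (Finset.card_pos.mp hcard0)
  rw [hcard] at hmain
  simp only [energy_resid]
  convert hmain using 8
  field_simp

end Model

end TensorFactor

namespace TensorFactor

/-! ### Rates -/

/-- The squared bias has order `T^(-2-4ε)`, which for `T ≥ 1` is below the order `T^(-2ε)` of `psi`.
-/
theorem rpow_bias_le {ε c T τ Q : ℝ} (hε : 0 < ε) (hc : 0 < c) (hT : 1 ≤ T) (hTτ : T ≤ c * τ)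
    (hQ : 0 ≤ Q) :
    ((τ / 2) ^ (-(1 + 2 * ε)) * Q) ^ 2 ≤ ((2 * c) ^ (1 + 2 * ε)) ^ 2 * Q * (Q * T ^ (-(2 * ε))) := by
  have hT0 : 0 < T := by linarith
  have h1 : T / (2 * c) ≤ τ / 2 := by
    rw [div_le_iff₀ (by positivity)]
    linarith
  have h2 : (τ / 2) ^ (-(1 + 2 * ε)) ≤ (2 * c) ^ (1 + 2 * ε) * T ^ (-(1 + 2 * ε)) := by
    refine (Real.rpow_le_rpow_of_nonpos (by positivity) h1 (by linarith)).trans_eq ?_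
    rw [Real.div_rpow hT0.le (by positivity), Real.rpow_neg (by positivity : 0 ≤ 2 * c), div_inv_eq_mul,
      mul_comm]
  have h0 : 0 ≤ (τ / 2) ^ (-(1 + 2 * ε)) :=
    Real.rpow_nonneg ((by positivity : 0 ≤ T / (2 * c)).trans h1) _
  have h3 : (T ^ (-(1 + 2 * ε))) ^ 2 ≤ T ^ (-(2 * ε)) := by
    rw [← Real.rpow_mul_natCast hT0.le]
    refine Real.rpow_le_rpow_of_exponent_le hT ?_
    push_cast
    linarith
  calc ((τ / 2) ^ (-(1 + 2 * ε)) * Q) ^ 2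
      ≤ ((2 * c) ^ (1 + 2 * ε) * T ^ (-(1 + 2 * ε)) * Q) ^ 2 := by gcongr
    _ = ((2 * c) ^ (1 + 2 * ε)) ^ 2 * Q * (Q * (T ^ (-(1 + 2 * ε))) ^ 2) := by ring
    _ ≤ _ := by gcongr

/-- The exponents add up to `-4ε`, twice that of `psi`: the fluctuations have standard deviation of
order `psi`. -/
theorem rpow_variance_le {ε c T τ Q : ℝ} (hε1 : ε < 1) (hc : 0 < c) (hT : 0 < T) (hτ : 0 ≤ τ)
    (hTτ : τ ≤ c * T) (hQ : 0 ≤ Q) :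
    (2 * τ) ^ (2 - 2 * ε) * Q * (Q * T ^ (-(2 + 2 * ε))) ≤
      (2 * c) ^ (2 - 2 * ε) * (Q * T ^ (-(2 * ε))) ^ 2 := by
  have h1 : (2 * τ) ^ (2 - 2 * ε) ≤ (2 * c) ^ (2 - 2 * ε) * T ^ (2 - 2 * ε) := by
    rw [← Real.mul_rpow (by positivity) hT.le]
    exact Real.rpow_le_rpow (by positivity) (by linarith) (by linarith)
  have h2 : T ^ (2 - 2 * ε) * T ^ (-(2 + 2 * ε)) = (T ^ (-(2 * ε))) ^ 2 := by
    rw [← Real.rpow_add hT, ← Real.rpow_mul_natCast hT.le]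
    congr 1
    push_cast
    ring
  calc _ ≤ (2 * c) ^ (2 - 2 * ε) * T ^ (2 - 2 * ε) * Q * (Q * T ^ (-(2 + 2 * ε))) := by gcongr
    _ = (2 * c) ^ (2 - 2 * ε) * (Q ^ 2 * (T ^ (2 - 2 * ε) * T ^ (-(2 + 2 * ε)))) := by ring
    _ = _ := by rw [h2]; ring

namespace Model

variable {K : ℕ} {r : Fin K → ℕ} {Ω : Type*} {S : Model K r Ω} {k : Fin K} {ε om : ℝ}

theorem tauRate_pos (R : Regime) (hom : 0 < om) (hN : (0 : ℝ) < S.n * S.pExcept k)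
    (hl : 0 < S.logFactor R k) : 0 < S.tauRate R ε om k :=
  mul_pos hom (Real.rpow_pos_of_pos (div_pos hN hl) _)

theorem tauRate_rpow (R : Regime) (hε : 0 < ε) (hom : 0 < om)
    (hN : (0 : ℝ) < S.n * S.pExcept k) (hl : 0 < S.logFactor R k) :
    S.tauRate R ε om k ^ (2 + 2 * ε) =
      om ^ (2 + 2 * ε) * ((S.n * S.pExcept k : ℝ) / S.logFactor R k) := by
  have hx := div_pos hN hl
  rw [tauRate, Real.mul_rpow hom.le (Real.rpow_nonneg hx.le _), ← Real.rpow_mul hx.le,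
    one_div_mul_cancel (by linarith), Real.rpow_one]

/-- Here and in `psi_eq` the rates are rewritten as powers of `tauRate`, so that comparing them
becomes arithmetic of exponents. -/
theorem logFactor_div_eq (R : Regime) (hε : 0 < ε) (hom : 0 < om)
    (hN : (0 : ℝ) < S.n * S.pExcept k) (hl : 0 < S.logFactor R k) :
    S.logFactor R k / (S.n * S.pExcept k : ℝ) =
      om ^ (2 + 2 * ε) * S.tauRate R ε om k ^ (-(2 + 2 * ε)) := by
  rw [Real.rpow_neg (tauRate_pos R hom hN hl).le, tauRate_rpow R hε hom hN hl]
  have : om ^ (2 + 2 * ε) ≠ 0 := (Real.rpow_pos_of_pos hom _).ne'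
  field_simp

theorem psi_eq (R : Regime) (hε : 0 < ε) (hom : 0 < om)
    (hN : (0 : ℝ) < S.n * S.pExcept k) (hl : 0 < S.logFactor R k) :
    S.psi R ε om k = om ^ (2 + 2 * ε) * S.tauRate R ε om k ^ (-(2 * ε)) := by
  have hx := div_pos hN hl
  rw [psi, tauRate, Real.mul_rpow hom.le (Real.rpow_nonneg hx.le _), ← Real.rpow_mul hx.le,
    ← mul_assoc, ← Real.rpow_add hom, ← inv_div, Real.inv_rpow hx.le, ← Real.rpow_neg hx.le]
  have h1 : 2 + 2 * ε + -(2 * ε) = (2 : ℕ) := by push_cast; ring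
  rw [h1, Real.rpow_natCast]
  congr 2
  field_simp

/-- The event that the residuals have a small operator norm. -/
def SmallResid (S : Model K r Ω) (τ z : ℝ) (k : Fin K) (w : Ω) : Prop :=
  ∀ v : Fin (S.p k) → ℝ, energy S.n (fun t => unfold k (S.resid τ t w)) v ≤
    z * (S.n * S.pExcept k * S.p k) * (v ⬝ᵥ v)

theorem SmallResid.mono {τ z z' : ℝ} {w : Ω} (h : S.SmallResid τ z k w) (hz : z ≤ z') :
    S.SmallResid τ z' k w := fun v =>
  (h v).trans (mul_le_mul_of_nonneg_right (mul_le_mul_of_nonneg_right hz (by positivity))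
    (dotProduct_self_nonneg' v))

theorem measure_not_smallResid_le [MeasurableSpace Ω] {P : Measure Ω} [IsProbabilityMeasure P]
    {τ M c₀ cε c₁ c₂ B C ρ : ℝ} (R : Regime) (hε : 0 < ε)
    (hε1 : ε < 1) (hom : 0 < om) (hc₀ : 0 < c₀) (hT : S.TailAssumption P ε om M)
    (hD : S.DependenceAssumption R P ε om c₀ cε) (hτ : S.SmallSignal τ)
    (hn : 0 < S.n) (hp : ∀ k, 0 < S.p k) (hL : 1 ≤ S.logSize R k)
    (hLN : (S.n * S.pExcept k : ℝ) ≤ Real.exp (S.logSize R k)) (hl : 1 ≤ S.logFactor R k)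
    (hT1 : 1 ≤ S.tauRate R ε om k) (hc₁ : 0 < c₁) (hc₂ : 0 < c₂)
    (h₁ : S.tauRate R ε om k ≤ c₁ * τ) (h₂ : τ ≤ c₂ * S.tauRate R ε om k)
    (hB : 0 < B) (hρ : 0 < ρ) (hψ : S.psi R ε om k ≤ C * ρ)
    (hpρ : 1 / (S.p k : ℝ) ≤ C * ρ) :
    P {w | ¬ S.SmallResid τ (((5 + 2 * om ^ (2 + 2 * ε)) * (2 * (1 + 1 / (ε * c₀ / 4))) * C +
      ((2 * c₁) ^ (1 + 2 * ε)) ^ 2 * om ^ (2 + 2 * ε) * C + B) * ρ) k w} ≤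
      ENNReal.ofReal ((2 * c₂) ^ (2 - 2 * ε) * (max 1 (8 * (2 * c₂) ^ (2 + 2 * ε)) * Real.exp 1 *
        (2 * (1 + K / c₀)) ^ K) * C ^ 2 / B ^ 2) := by
  set T := S.tauRate R ε om k with hTdef
  set Q := om ^ (2 + 2 * ε) with hQ
  have hQ0 : 0 < Q := Real.rpow_pos_of_pos hom _
  have hT0 : 0 < T := by linarith
  have hτ0 := hτ.1
  have hN : (0 : ℝ) < S.n * S.pExcept k := by
    rw [pExcept]
    push_cast
    exact mul_pos (by exact_mod_cast hn) (Finset.prod_pos fun j _ => by exact_mod_cast hp j)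
  have hl0 : 0 < S.logFactor R k := by linarith
  set C₂ := max 1 (8 * (2 * c₂) ^ (2 + 2 * ε)) with hC₂
  -- The two covariance bounds differ by a factor of order `τ^(2+2ε)`, which is at most of order `n
  -- p_{-k}` by the choice of the truncation level.
  have hτC : 8 * (2 * τ) ^ 4 ≤ (2 * τ) ^ (2 - 2 * ε) * Q * C₂ * Real.exp (S.logSize R k) := by
    have e1 : (2 * τ) ^ 4 = (2 * τ) ^ (2 - 2 * ε) * (2 * τ) ^ (2 + 2 * ε) := by
      rw [← Real.rpow_add (by positivity)]
      have : 2 - 2 * ε + (2 + 2 * ε) = (4 : ℕ) := by push_cast; ring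
      rw [this, Real.rpow_natCast]
    have e2 : (2 * τ) ^ (2 + 2 * ε) ≤ (2 * c₂) ^ (2 + 2 * ε) * T ^ (2 + 2 * ε) := by
      rw [← Real.mul_rpow (by positivity) hT0.le]
      exact Real.rpow_le_rpow (by positivity) (by linarith) (by linarith)
    have e3 : T ^ (2 + 2 * ε) ≤ Q * Real.exp (S.logSize R k) := by
      rw [hTdef, tauRate_rpow R hε hom hN hl0]
      exact mul_le_mul_of_nonneg_left ((div_le_self hN.le hl).trans hLN) hQ0.le
    have e4 : 8 * (2 * τ) ^ (2 + 2 * ε) ≤ C₂ * (Q * Real.exp (S.logSize R k)) :=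
      calc 8 * (2 * τ) ^ (2 + 2 * ε) ≤ (8 * (2 * c₂) ^ (2 + 2 * ε)) * T ^ (2 + 2 * ε) := by linarith
        _ ≤ C₂ * (Q * Real.exp (S.logSize R k)) :=
          mul_le_mul (le_max_right _ _) e3 (by positivity) (by positivity)
    rw [e1]
    have := mul_le_mul_of_nonneg_left e4 (by positivity : 0 ≤ (2 * τ) ^ (2 - 2 * ε))
    linarith
  have hmain := measure_energy_resid_le (P := P) (σ := B * ρ) R hε hε1 hom hc₀ hT hD hτ
    (le_max_left 1 (8 * (2 * c₂) ^ (2 + 2 * ε))) hL hτC (by positivity) hn hp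
  rw [psi_eq R hε hom hN hl0, ← hTdef, ← hQ] at hψ
  refine le_trans (measure_mono ?_) (hmain.trans (ENNReal.ofReal_le_ofReal ?_))
  · intro w hw hsmall
    refine hw (SmallResid.mono (z := (5 + 2 * Q) * (2 * (1 + 1 / (ε * c₀ / 4))) / S.p k +
        ((τ / 2) ^ (-(1 + 2 * ε)) * Q) ^ 2 + B * ρ) hsmall ?_)
    -- The three summands of the threshold come from the bias, the covariances in a column and the
    -- fluctuation `B ρ`.
    have b1 := rpow_bias_le hε hc₁ hT1 h₁ hQ0.le
    have b2 := mul_le_mul_of_nonneg_left hψ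
      (by positivity : 0 ≤ ((2 * c₁) ^ (1 + 2 * ε)) ^ 2 * Q)
    have b3 := mul_le_mul_of_nonneg_left hpρ
      (by positivity : 0 ≤ (5 + 2 * Q) * (2 * (1 + 1 / (ε * c₀ / 4))))
    rw [mul_one_div] at b3
    linarith
  · have v1 := rpow_variance_le hε1 hc₂ hT0 hτ0.le h₂ hQ0.le
    have hl' := logFactor_div_eq R hε hom hN hl0
    rw [← hTdef, ← hQ] at hl'
    rw [← hl'] at v1
    have v2 : (Q * T ^ (-(2 * ε))) ^ 2 ≤ (C * ρ) ^ 2 := by gcongr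
    set E := C₂ * Real.exp 1 * (2 * (1 + K / c₀)) ^ K with hE
    have hE0 : 0 ≤ E := by positivity
    calc _ = (2 * τ) ^ (2 - 2 * ε) * Q * (S.logFactor R k / (S.n * S.pExcept k)) * E /
          (B * ρ) ^ 2 := by
          rw [hE, ← hQ, ← hC₂]
          ring
      _ ≤ (2 * c₂) ^ (2 - 2 * ε) * (C * ρ) ^ 2 * E / (B * ρ) ^ 2 := by
          exact div_le_div_of_nonneg_right (mul_le_mul_of_nonneg_right (v1.trans
            (mul_le_mul_of_nonneg_left v2 (by positivity))) hE0) (sq_nonneg _)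
      _ = _ := by
          field_simp

end Model

end TensorFactor

/-! ### Passage to the limit along the sequence of models. -/

namespace TensorFactor

open Matrix

/-- The residuals have operator norms of the order of the penalty, in probability. -/
theorem exists_eventually_smallResid {K : ℕ} {r : Fin K → ℕ} {Ω : ℕ → Type*}
    [∀ ν, MeasurableSpace (Ω ν)] {P : ∀ ν, Measure (Ω ν)} [∀ ν, IsProbabilityMeasure (P ν)]
    {S : ∀ ν, Model K r (Ω ν)} (hn : Tendsto (fun ν => (S ν).n) atTop atTop)
    (hp : ∀ k, Tendsto (fun ν => (S ν).p k) atTop atTop)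
    {R : Regime} {lbar ε om c₀ cε : ℝ} (hε : 0 < ε) (hε1 : ε < 1) (hom : 0 < om) (hc₀ : 0 < c₀)
    {M : ℕ → ℝ} (hL : ∀ ν, (S ν).LoadingAssumption lbar)
    (hT : ∀ ν, (S ν).TailAssumption (P ν) ε om (M ν))
    (hD : ∀ ν, (S ν).DependenceAssumption R (P ν) ε om c₀ cε)
    {τ : ℕ → Fin K → ℝ} (hτ0 : ∀ ν k, 0 < τ ν k)
    (hτ : ∀ k, (fun ν => τ ν k) =Θ[atTop] fun ν => (S ν).tauRate R ε om k)
    (hM : ∀ k, Tendsto (fun ν => M ν * ((S ν).tauRate R ε om k)⁻¹ *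
      Real.log ((S ν).n * (S ν).pExcept k) ^ (1 / (2 * ε))) atTop (𝓝 0))
    {ρ : ℕ → ℝ} (hρ0 : ∀ ν, 0 < ρ ν)
    (hψρ : (fun ν => ∑ k, max ((S ν).psi R ε om k) (1 / ((S ν).p k : ℝ))) =O[atTop] ρ)
    (k : Fin K) {η : ℝ} (hη : 0 < η) :
    ∃ C, 0 ≤ C ∧ ∀ᶠ ν in atTop,
      P ν {w | ¬ (S ν).SmallResid (τ ν k) (C * ρ ν) k w} ≤ ENNReal.ofReal η := by
  obtain ⟨c₂, hc₂, h₂⟩ := (hτ k).1.exists_pos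
  obtain ⟨c₁, hc₁, h₁⟩ := (hτ k).2.exists_pos
  obtain ⟨C, hC, hCρ⟩ := hψρ.exists_pos
  set E := (2 * c₂) ^ (2 - 2 * ε) * (max 1 (8 * (2 * c₂) ^ (2 + 2 * ε)) * Real.exp 1 *
        (2 * (1 + K / c₀)) ^ K) * C ^ 2 with hE
  have hE0 : 0 ≤ E := by positivity
  -- As `B ≥ 1`, `E / B² ≤ E / B ≤ η`: a large multiple of `ρ` makes the exceptional probability
  -- small.
  set B := E / η + 1 with hB
  have hB1 : 1 ≤ B := by
    have : 0 ≤ E / η := by positivity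
    linarith
  have hEB : E / B ^ 2 ≤ η := by
    rw [div_le_iff₀ (by positivity)]
    have h1 : η * B = E + η := by rw [hB]; field_simp
    nlinarith
  set Cχ := ((∏ k, r k : ℕ) : ℝ) * |lbar| ^ K with hCχ
  have hCχ0 : 0 ≤ Cχ := by positivity
  -- From `M ≤ δ T`, where `T` is `tauRate`, the first entry gives `om ≤ M ≤ om * T`, hence `T ≥ 1`;
  -- the second brings the common component below `τ/2`.
  set δ := min om (1 / (2 * (Cχ + 1) * c₁)) with hδ
  have hδ0 : 0 < δ := lt_min hom (by positivity)
  refine ⟨(5 + 2 * om ^ (2 + 2 * ε)) * (2 * (1 + 1 / (ε * c₀ / 4))) * C +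
    ((2 * c₁) ^ (1 + 2 * ε)) ^ 2 * om ^ (2 + 2 * ε) * C + B, by positivity, ?_⟩
  -- `n ≥ 3 > e` makes all the logarithms at least one.
  filter_upwards [h₁.bound, h₂.bound, hCρ.bound, hn.eventually_ge_atTop 3,
    eventually_all.mpr fun j => (hp j).eventually_ge_atTop 1,
    (hM k).eventually (eventually_lt_nhds hδ0)] with ν h₁ h₂ hCρ hn hp hM
  have hpE : (1 : ℝ) ≤ (S ν).pExcept k := by
    have : 0 < (S ν).pExcept k := Finset.prod_pos fun j _ => hp j
    exact_mod_cast this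
  have hn3 : (3 : ℝ) ≤ (S ν).n := by exact_mod_cast hn
  have hN3 : (3 : ℝ) ≤ (S ν).n * (S ν).pExcept k := by nlinarith
  have hlog3 : ∀ {x : ℝ}, 3 ≤ x → 1 ≤ Real.log x := fun hx => by
    rw [Real.le_log_iff_exp_le (by linarith)]
    linarith [Real.exp_one_lt_d9]
  have hpA : ((S ν).pAll : ℝ) = (S ν).p k * (S ν).pExcept k := by
    rw [Model.pAll, Model.pExcept, ← Nat.cast_mul, Finset.mul_prod_erase _ _ (Finset.mem_univ k)]
  have hpk : (1 : ℝ) ≤ (S ν).p k := by exact_mod_cast hp k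
  have hNA : ((S ν).n * (S ν).pExcept k : ℝ) ≤ (S ν).n * (S ν).pAll := by
    rw [hpA]
    exact mul_le_mul_of_nonneg_left (le_mul_of_one_le_left (by linarith) hpk) (by linarith)
  have hsize : 1 ≤ (S ν).logSize R k ∧
      ((S ν).n * (S ν).pExcept k : ℝ) ≤ Real.exp ((S ν).logSize R k) ∧
      1 ≤ (S ν).logFactor R k := by
    cases R with
    | indep =>
      refine ⟨hlog3 hN3, ?_, hlog3 hN3⟩
      change _ ≤ Real.exp (Real.log _)
      rw [Real.exp_log (by linarith)]
    | field =>
      refine ⟨hlog3 (hN3.trans hNA), ?_, one_le_pow₀ (hlog3 (hN3.trans hNA))⟩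
      change _ ≤ Real.exp (Real.log _)
      rw [Real.exp_log (by linarith)]
      exact hNA
  have hTpos : 0 < (S ν).tauRate R ε om k :=
    Model.tauRate_pos R hom (by linarith) (by linarith [hsize.2.2])
  have hMom := (hT ν).om_le
  have hMT : M ν ≤ δ * (S ν).tauRate R ε om k := by
    have h3 : 1 ≤ Real.log ((S ν).n * (S ν).pExcept k) ^ (1 / (2 * ε)) :=
      Real.one_le_rpow (hlog3 hN3) (by positivity)
    have h4 : 0 ≤ M ν * ((S ν).tauRate R ε om k)⁻¹ :=
      mul_nonneg (by linarith) (inv_nonneg.mpr hTpos.le)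
    have h5 : M ν * ((S ν).tauRate R ε om k)⁻¹ ≤ δ := by nlinarith
    rwa [← div_eq_mul_inv, div_le_iff₀ hTpos] at h5
  have hT1 : 1 ≤ (S ν).tauRate R ε om k := by
    have h3 : om ≤ om * (S ν).tauRate R ε om k :=
      (hMom.trans hMT).trans (mul_le_mul_of_nonneg_right (min_le_left _ _) hTpos.le)
    exact (le_mul_iff_one_le_right hom).mp h3
  rw [Real.norm_of_nonneg hTpos.le, Real.norm_of_nonneg (hτ0 ν k).le] at h₁ h₂
  have hterm : ∀ j, 0 ≤ max ((S ν).psi R ε om j) (1 / ((S ν).p j : ℝ)) := fun j =>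
    le_max_of_le_right (by positivity)
  rw [Real.norm_of_nonneg (Finset.sum_nonneg fun j _ => hterm j),
    Real.norm_of_nonneg (hρ0 ν).le] at hCρ
  have hmax : max ((S ν).psi R ε om k) (1 / ((S ν).p k : ℝ)) ≤ C * ρ ν :=
    (Finset.single_le_sum (f := fun j => max ((S ν).psi R ε om j) (1 / ((S ν).p j : ℝ)))
      (fun j _ => hterm j) (Finset.mem_univ k)).trans hCρ
  have hsmall : (S ν).SmallSignal (τ ν k) := by
    refine ⟨hτ0 ν k, fun t ht i => ?_⟩
    refine (abs_tucker_le _ _ (fun k => (hL ν k).2) i).trans ?_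
    have h3 : Cχ * tnorm ((S ν).F t) ≤ Cχ * (δ * (c₁ * τ ν k)) :=
      mul_le_mul_of_nonneg_left (((hT ν).factor_bound t ht).trans
        (hMT.trans (mul_le_mul_of_nonneg_left h₁ hδ0.le))) hCχ0
    have h4 : δ * (2 * (Cχ + 1) * c₁) ≤ 1 := by
      rw [← le_div_iff₀ (by positivity)]
      exact min_le_right _ _
    have h5 := mul_le_mul_of_nonneg_right h4 (hτ0 ν k).le
    have h6 : 0 < δ * (c₁ * τ ν k) := mul_pos hδ0 (mul_pos hc₁ (hτ0 ν k))
    linarith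
  exact (Model.measure_not_smallResid_le R hε hε1 hom hc₀ (hT ν) (hD ν) hsmall (by omega) hp
    hsize.1 hsize.2.1 hsize.2.2 hT1 hc₁ hc₂ h₁ h₂ (by linarith) (hρ0 ν)
    ((le_max_left _ _).trans hmax) ((le_max_right _ _).trans hmax)).trans
    (ENNReal.ofReal_le_ofReal hEB)

/-- Bounds for the second moment matrices of the factors which are uniform in the mode. -/
theorem exists_uniform_bounds {K : ℕ} {r : Fin K → ℕ} (α β : ∀ k, Fin (r k) → ℝ)
    (hα : ∀ k j, 0 < α k j) :
    ∃ a b : ℝ, 0 < a ∧ 0 ≤ b ∧ ∀ k j, a ≤ α k j ∧ β k j ≤ b := by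
  have h1 : BddAbove (Set.range fun x : Σ k, Fin (r k) => β x.1 x.2) := (Set.finite_range _).bddAbove
  have h2 : BddAbove (Set.range fun x : Σ k, Fin (r k) => (α x.1 x.2)⁻¹) :=
    (Set.finite_range _).bddAbove
  obtain ⟨b, hb⟩ := h1
  obtain ⟨c, hc⟩ := h2
  have hc' : 0 < max c 1 := lt_max_of_lt_right one_pos
  refine ⟨(max c 1)⁻¹, max b 0, inv_pos.mpr hc', le_max_right _ _, fun k j => ⟨?_, ?_⟩⟩
  · exact inv_le_of_inv_le₀ (hα k j) ((hc ⟨⟨k, j⟩, rfl⟩).trans (le_max_left _ _))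
  · exact (hb ⟨⟨k, j⟩, rfl⟩).trans (le_max_left _ _)

theorem Model.setup_of_smallResid {K : ℕ} {r : Fin K → ℕ} {Ω : Type*} {S : Model K r Ω}
    {lbar a b z : ℝ} {α β : ∀ k, Fin (r k) → ℝ} {τ : Fin K → ℝ} {w : Ω}
    (hn : 0 < S.n) (hp : ∀ k, 0 < S.p k) (hL : S.LoadingAssumption lbar)
    (hF : S.FactorAssumption α β) (ha : 0 < a) (hb : 0 ≤ b)
    (hab : ∀ k j, a ≤ α k j ∧ β k j ≤ b) (hz : 0 ≤ z) (hs : ∀ k, S.SmallResid (τ k) z k w) :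
    S.Setup a b z τ w where
  n_pos := hn
  p_pos := hp
  load k := by
    have hpk : (S.p k : ℝ) ≠ 0 := by exact_mod_cast (hp k).ne'
    rw [← (hL k).1, smul_inv_smul₀ hpk]
  a_pos := ha
  b_nonneg := hb
  le_gammaF k x := by
    rw [S.gammaF_quadForm_eq (hF k).1, dotProduct, Finset.mul_sum]
    exact Finset.sum_le_sum fun j _ => mul_le_mul_of_nonneg_right
      ((hab k j).1.trans ((hF k).2 j).1) (mul_self_nonneg _)
  gammaF_le k x := by
    rw [S.gammaF_quadForm_eq (hF k).1, dotProduct, Finset.mul_sum]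
    exact Finset.sum_le_sum fun j _ => mul_le_mul_of_nonneg_right
      (((hF k).2 j).2.trans (hab k j).2) (mul_self_nonneg _)
  z_nonneg := hz
  resid_le := hs

end TensorFactor

/-! ### Union bound over the modes and the previous iterate. -/

theorem mainTheorem5 {K : ℕ} {r : Fin K → ℕ} (hr : ∀ k, 1 ≤ r k)
    -- a sequence of models with growing sample size and dimensions
    {Ω : ℕ → Type*} [∀ ν, MeasurableSpace (Ω ν)] (P : ∀ ν, Measure (Ω ν))
    [∀ ν, IsProbabilityMeasure (P ν)] (S : ∀ ν, TensorFactor.Model K r (Ω ν))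
    (hn : Tendsto (fun ν => (S ν).n) atTop atTop)
    (hp : ∀ k, Tendsto (fun ν => (S ν).p k) atTop atTop)
    -- the fixed constants
    (R : TensorFactor.Regime) (lbar ε om c₀ cε : ℝ) (α β : ∀ k, Fin (r k) → ℝ)
    (hε : 0 < ε) (hε1 : ε < 1) (hom : 0 < om) (hc₀ : 0 < c₀) (hcε : 0 < cε)
    (hα : ∀ k j, 0 < α k j) (hαβ : ∀ k (i j : Fin (r k)), i < j → β k j < α k i)
    -- the model assumptions
    (M : ℕ → ℝ)
    (hL : ∀ ν, (S ν).LoadingAssumption lbar)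
    (hF : ∀ ν, (S ν).FactorAssumption α β)
    (hT : ∀ ν, (S ν).TailAssumption (P ν) ε om (M ν))
    (hD : ∀ ν, (S ν).DependenceAssumption R (P ν) ε om c₀ cε)
    -- the truncation levels
    (τ : ℕ → Fin K → ℝ) (hτ0 : ∀ ν k, 0 < τ ν k)
    (hτ : ∀ k, (fun ν => τ ν k) =Θ[atTop] fun ν => (S ν).tauRate R ε om k)
    (hM : ∀ k, Tendsto (fun ν => M ν * ((S ν).tauRate R ε om k)⁻¹ *
      Real.log ((S ν).n * (S ν).pExcept k) ^ (1 / (2 * ε))) atTop (𝓝 0))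
    -- the penalty and the maximal factor numbers
    (ρ : ℕ → ℝ) (hρ0 : ∀ ν, 0 < ρ ν) (hρ : Tendsto ρ atTop (𝓝 0))
    (hψρ : (fun ν => ∑ k, max ((S ν).psi R ε om k) (1 / ((S ν).p k : ℝ))) =O[atTop] ρ)
    (rbar : ℕ → Fin K → ℕ) (hrbar : ∀ ν k, 1 ≤ rbar ν k ∧ rbar ν k + 1 ≤ (S ν).p k)
    -- the eigenvectors of the truncated second moment matrices, and a run of the procedure
    (e : ∀ ν, Ω ν → ∀ k, Fin ((S ν).p k) → Fin ((S ν).p k) → ℝ)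
    (he : ∀ ν w k, TensorFactor.IsEigenbasis ((S ν).gammaHat (τ ν k) k w) (e ν w k))
    (rhat : ∀ ν, ℕ → Ω ν → Fin K → ℕ)
    (hrun : ∀ ν, (S ν).IsRun (τ ν) (ρ ν) (rbar ν) (e ν) (rhat ν))
    -- the previous iterate lies in the required range with probability tending to one
    (m : ℕ) (hm : 1 ≤ m)
    (hprev : Tendsto (fun ν => P ν {w | ¬ ∀ k, r k ≤ rhat ν (m - 1) w k ∧
      rhat ν (m - 1) w k ≤ rbar ν k}) atTop (𝓝 0)) :
    ∀ k, Tendsto (fun ν => P ν {w | rhat ν m w k = r k}) atTop (𝓝 1) ∧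
      Tendsto (fun ν => P ν {w | rhat ν m w k ≠ r k}) atTop (𝓝 0) := by

  obtain ⟨m, rfl⟩ := Nat.exists_eq_add_of_le' hm
  obtain ⟨a, b, ha, hb, hab⟩ := TensorFactor.exists_uniform_bounds α β hα
  set κ := a * (1 / 2) ^ (K + 1) with hκ
  have hκ0 : 0 < κ := by positivity
  intro k
  have hne : Tendsto (fun ν => P ν {w | rhat ν (m + 1) w k ≠ r k}) atTop (𝓝 0) := by
    rw [ENNReal.tendsto_nhds_zero]
    intro η hη
    -- There are `K + 1` exceptional events: one per mode, and failure of the previous iterate.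
    obtain ⟨η', hη'0, hη'⟩ : ∃ η' : ℝ, 0 < η' ∧ ENNReal.ofReal η' * (K + 1) ≤ η := by
      rcases eq_or_ne η ⊤ with rfl | hη1
      · exact ⟨1, one_pos, le_top⟩
      · have hK : (0 : ℝ) < K + 1 := by positivity
        refine ⟨η.toReal / (K + 1), div_pos (ENNReal.toReal_pos hη.ne' hη1) hK, ?_⟩
        have : ((K : ENNReal) + 1) = ENNReal.ofReal (K + 1) := by
          rw [ENNReal.ofReal_add (by positivity) zero_le_one]
          simp
        rw [this, ← ENNReal.ofReal_mul (by positivity), div_mul_cancel₀ _ hK.ne',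
          ENNReal.ofReal_toReal hη1]
    choose C hC0 hC using fun k =>
      TensorFactor.exists_eventually_smallResid hn hp hε hε1 hom hc₀ hL hT hD hτ0 hτ
        hM hρ0 hψρ k hη'0
    -- One constant that dominates those of all modes.
    set D := ∑ k, C k with hD'
    have hD0 : 0 ≤ D := Finset.sum_nonneg fun k _ => hC0 k
    -- Every smallness condition on the penalty has the form `q ρ < c` with `q` continuous and
    -- vanishing at 0.
    have lim : ∀ q : ℝ → ℝ, Continuous q → q 0 = 0 → ∀ c : ℝ, 0 < c →
        ∀ᶠ ν in atTop, q (ρ ν) < c := fun q hq hq0 c hc =>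
      ((hq0 ▸ (hq.tendsto 0).comp hρ : Tendsto (q ∘ ρ) atTop (𝓝 0))).eventually
        (eventually_lt_nhds hc)
    filter_upwards [eventually_all.mpr hC,
      (ENNReal.tendsto_nhds_zero.mp hprev) (ENNReal.ofReal η') (ENNReal.ofReal_pos.mpr hη'0),
      hn.eventually_ge_atTop 1, eventually_all.mpr fun j => (hp j).eventually_ge_atTop 1,
      lim (fun x => D * x) (by fun_prop) (by simp) (a / 8) (by positivity),
      lim (fun x => D * x) (by fun_prop) (by simp) κ hκ0,
      lim (fun x => 2 * (b + D * x) / κ * ((D + 1) * x)) (by fun_prop) (by simp) κ hκ0,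
      lim (fun x => D * ((D + 1) * x)) (by fun_prop) (by simp) κ hκ0] with ν hCν hprevν hnν hpν
        h1 h2 h3 h4
    have hsub : {w | rhat ν (m + 1) w k ≠ r k} ⊆
        (⋃ j, {w | ¬ (S ν).SmallResid (τ ν j) (C j * ρ ν) j w}) ∪
          {w | ¬ ∀ k, r k ≤ rhat ν (m + 1 - 1) w k ∧ rhat ν (m + 1 - 1) w k ≤ rbar ν k} := by
      intro w hw
      by_contra hgood
      simp only [Set.mem_union, Set.mem_iUnion, Set.mem_ofPred_eq, not_or, not_exists,
        not_not] at hgood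
      have hsmall : ∀ j, (S ν).SmallResid (τ ν j) (D * ρ ν) j w := fun j =>
        (hgood.1 j).mono (mul_le_mul_of_nonneg_right
          (Finset.single_le_sum (f := C) (fun k _ => hC0 k) (Finset.mem_univ j)) (hρ0 ν).le)
      exact hw ((TensorFactor.Model.setup_of_smallResid hnν hpν (hL ν) (hF ν) ha hb hab
        (mul_nonneg hD0 (hρ0 ν).le) hsmall).rhat_eq hr (he ν w) (hrun ν) (fun k => (hrbar ν k).2)
        (hρ0 ν) hD0 hgood.2 h1.le h2.le h3 h4 k)
    calc P ν {w | rhat ν (m + 1) w k ≠ r k} ≤ _ := measure_mono hsub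
      _ ≤ _ := measure_union_le _ _
      _ ≤ ∑ _j : Fin K, ENNReal.ofReal η' + ENNReal.ofReal η' := by
          refine add_le_add ((measure_iUnion_le _).trans ?_) hprevν
          rw [tsum_fintype]
          exact Finset.sum_le_sum fun j _ => hCν j
      _ = ENNReal.ofReal η' * (K + 1) := by
          simp
          ring
      _ ≤ η := hη'
  refine ⟨?_, hne⟩
  have h1 : Tendsto (fun ν => 1 - P ν {w | rhat ν (m + 1) w k ≠ r k}) atTop (𝓝 1) := by
    simpa using ENNReal.Tendsto.sub tendsto_const_nhds hne (Or.inl ENNReal.one_ne_top)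
  refine tendsto_of_tendsto_of_tendsto_of_le_of_le h1 tendsto_const_nhds (fun ν => ?_)
    fun ν => prob_le_one
  -- The events need not be measurable, so the complement rule is replaced by subadditivity of the
  -- outer measure.
  rw [tsub_le_iff_right, ← measure_univ (μ := P ν)]
  refine (measure_mono fun w _ => ?_).trans (measure_union_le _ _)
  exact em _
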